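/- Let $(A_0,A_1)$ be a compatible couple of (quasi-)Banach spaces (both continuously embedded in a common Hausdorff topological vector space) with $A_0\cap A_1\neq\{0\}$, and let $K(t,f)=K(t,f;A_0,A_1)=\inf\{\|f_0\|_{A_0}+t\|f_1\|_{A_1}: f=f_0+f_1,\ f_i\in A_i\}$ for $f\in A_0+A_1$, $t>0$. For $0<q\le\infty$ and an interval $I\subset(0,\infty)$ let $\|\cdot\|_{q,I}$ be the usual (quasi-)norm of $L_q(I)$, with $1/\infty=0$. A positive Lebesgue measurable function $b$ on $(0,\infty)$ is slowly varying, $b\in SV$, if for every $\varepsilon>0$ the function $t^{\varepsilon}b(t)$ is equivalent to a non-decreasing function and $t^{-\varepsilon}b(t)$ is equivalent to a non-increasing function (up to positive multiplicative constants). For any couple, $0\le\theta\le1$, $0<s,r,q\le\infty$ and positive functions $a,b,c$ on $(0,\infty)$ define the following spaces of those $f\in A_0+A_1$ for which the respective (quasi-)norm is finite: $$\begin{aligned} \bar A_{\theta,q;b}:&\quad \big\|u^{-\theta-1/q}b(u)K(u,f)\big\|_{q,(0,\infty)},\\ \bar A^{\mathcal L}_{\theta,r,b,q,a}:&\quad \Big\|t^{-1/r}b(t)\big\|u^{-\theta-1/q}a(u)K(u,f)\big\|_{q,(0,t)}\Big\|_{r,(0,\infty)},\\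 \bar A^{\mathcal L,\mathcal L}_{\theta,s,c,r,b,q,a}:&\quad \bigg\|t^{-1/s}c(t)\Big\|u^{-1/r}b(u)\big\|v^{-\theta-1/q}a(v)K(v,f)\big\|_{q,(0,u)}\Big\|_{r,(0,t)}\bigg\|_{s,(0,\infty)},\\ \bar A^{\mathcal L,\mathcal R}_{\theta,s,c,r,b,q,a}:&\quad \bigg\|t^{-1/s}c(t)\Big\|u^{-1/r}b(u)\big\|v^{-\theta-1/q}a(v)K(v,f)\big\|_{q,(t,u)}\Big\|_{r,(t,\infty)}\bigg\|_{s,(0,\infty)}. \end{aligned}$$ For a couple $(X_0,X_1)$ write $(X_0,X_1)_{\theta,q;b}$ for the first of these spaces formed with $K(\cdot,\cdot;X_0,X_1)$. Equality of spaces means that they have the same elements and equivalent (quasi-)norms; an intersection carries the maximum of the (quasi-)norms. Let $0<r,r_0,q_0,r_1,q_1\le\infty$ and $a,a_0,b_0,a_1,b_1\in SV$, and assume $$\Big\|s^{-1/r_0}b_0(s)\|u^{-1/q_0}a_0(u)\|_{q_0,(1,s)}\Big\|_{r_0,(1,\infty)}<\infty,\qquad \|s^{-1/r_1}b_1(s)\|_{r_1,(1,\infty)}<\infty,\qquad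 \Big\|s^{-1/r_1}b_1(s)\|u^{-1/q_1}a_1(u)\|_{q_1,(0,s)}\Big\|_{r_1,(0,1)}<\infty .$$ For $t>0$ put $$\chi_0(t)=\Big\|s^{-1/r_0}b_0(s)\|u^{-1/q_0}a_0(u)\|_{q_0,(t,s)}\Big\|_{r_0,(t,\infty)},$$ $$\chi_1(t)=\Big\|s^{-1/r_1}b_1(s)\|u^{-1/q_1}a_1(u)\|_{q_1,(0,s)}\Big\|_{r_1,(0,t)}+\|s^{-1/r_1}b_1(s)\|_{r_1,(t,\infty)}\,\|u^{-1/q_1}a_1(u)\|_{q_1,(0,t)},$$ $\rho(t)=t\,\chi_0(t)/\chi_1(t)$, and for $0\le\theta\le1$ put $a^{\#}_\theta=\chi_0^{1-\theta}\chi_1^{\theta}\,(a\circ\rho)$. Let $X_0=\bar A^{\mathcal L}_{0,r_0,b_0,q_0,a_0}$ and $X_1=\bar A^{\mathcal L}_{1,r_1,b_1,q_1,a_1}$. Then: (i) If $0<\theta<1$, then $(X_0,X_1)_{\theta,r;a}=\bar A_{\theta,r;a^{\#}_\theta}$. (ii) If $\|s^{-1/r}a(s)\|_{r,(1,\infty)}<\infty$,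 then $$(X_0,X_1)_{0,r;a}=\bar A_{0,r;a^{\#}_0}\cap\bar A^{\mathcal L}_{0,r,B_0,q_0,a_0}\cap\bar A^{\mathcal L,\mathcal L}_{0,r,a\circ\rho,r_0,b_0,q_0,a_0},\qquad B_0(t)=\|s^{-1/r_0}b_0(s)\|_{r_0,(t,\infty)}\,a(\rho(t)).$$ (iii) If $\|s^{-1/r}a(s)\|_{r,(0,1)}<\infty$, then $$(X_0,X_1)_{1,r;a}=\bar A_{1,r;a^{\#}_1}\cap\bar A^{\mathcal L,\mathcal R}_{1,r,a\circ\rho,r_1,b_1,q_1,a_1}.$$ -/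

import Mathlib

open MeasureTheory Set
open scoped ENNReal NNReal Topology

noncomputable section

namespace RealInterp

/-- A quasi-Banach space over `𝕜` continuously embedded in the topological vector space `V`,
given by its quasi-norm extended by `∞` to all of `V`: the space is `{f | qnorm f < ∞}`. -/
structure QuasiBanachSubspace (𝕜 V : Type*) [RCLike 𝕜] [AddCommGroup V] [Module 𝕜 V]
    [TopologicalSpace V] where
  /-- the quasi-norm, equal to `∞` outside the space -/
  qnorm : V → ℝ≥0∞
  eq_zero_of_qnorm : ∀ f, qnorm f = 0 → f = 0
  qnorm_smul : ∀ (c : 𝕜) (f : V), qnorm (c • f) = ‖c‖ₑ * qnorm f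
  qnorm_add : ∃ C : ℝ≥0, ∀ f g : V, qnorm (f + g) ≤ C * (qnorm f + qnorm g)
  complete : ∀ u : ℕ → V, (∀ n, qnorm (u n) < ∞) →
    (∀ ε : ℝ≥0∞, 0 < ε → ∃ M, ∀ m ≥ M, ∀ n ≥ M, qnorm (u m - u n) < ε) →
    ∃ f, qnorm f < ∞ ∧ Filter.Tendsto (fun n => qnorm (u n - f)) Filter.atTop (𝓝 0)
  continuous_embedding : ∀ U ∈ 𝓝 (0 : V), ∃ ε : ℝ≥0∞, 0 < ε ∧ ∀ f, qnorm f < ε → f ∈ U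

/-- A positive Lebesgue measurable function `b` on `(0, ∞)` is slowly varying if for every `ε > 0`
the function `t ^ ε * b t` is equivalent to a non-decreasing function and `t ^ (-ε) * b t` is
equivalent to a non-increasing function. Only the values on `(0, ∞)` matter. -/
structure SlowlyVarying (b : ℝ → ℝ) : Prop where
  pos : ∀ t, 0 < t → 0 < b t
  measurable : AEMeasurable b (volume.restrict (Ioi 0))
  equiv_increasing : ∀ ε : ℝ, 0 < ε → ∃ g : ℝ → ℝ, MonotoneOn g (Ioi 0) ∧
    ∃ C : ℝ, 0 < C ∧ ∀ t, 0 < t → t ^ ε * b t ≤ C * g t ∧ g t ≤ C * (t ^ ε * b t)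
  equiv_decreasing : ∀ ε : ℝ, 0 < ε → ∃ g : ℝ → ℝ, AntitoneOn g (Ioi 0) ∧
    ∃ C : ℝ, 0 < C ∧ ∀ t, 0 < t → t ^ (-ε) * b t ≤ C * g t ∧ g t ≤ C * (t ^ (-ε) * b t)

/-- `‖u ^ (-θ - 1 / q) * b u * g u‖` in `L_q` on the set `I ⊆ (0, ∞)`, where `1 / ∞ = 0`
(`0 < q ≤ ∞`; the value may be `∞`). -/
def wnorm (q : ℝ≥0∞) (I : Set ℝ) (θ : ℝ) (b : ℝ → ℝ) (g : ℝ → ℝ≥0∞) : ℝ≥0∞ :=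
  eLpNorm (fun u => ENNReal.ofReal (u ^ (-θ - 1 / q.toReal) * b u) * g u) q (volume.restrict I)

variable {V : Type*} [AddCommGroup V]

/-- Peetre's `K`-functional of two spaces inside `V`, given by their extended quasi-norms. It is
`∞` exactly when `f` is not in the sum of the two spaces. -/
def K (N₀ N₁ : V → ℝ≥0∞) (t : ℝ) (f : V) : ℝ≥0∞ :=
  ⨅ (f₀ : V) (f₁ : V) (_ : f₀ + f₁ = f), N₀ f₀ + ENNReal.ofReal t * N₁ f₁

/-- The (extended) quasi-norm of the standard interpolation space `(N₀, N₁)_{θ, q; b}`. -/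
def stdSpace (N₀ N₁ : V → ℝ≥0∞) (θ : ℝ) (q : ℝ≥0∞) (b : ℝ → ℝ) (f : V) : ℝ≥0∞ :=
  wnorm q (Ioi 0) θ b fun u => K N₀ N₁ u f

/-- The quasi-norm of the limiting space `(N₀, N₁)^L_{θ, r, b, q, a}`. -/
def LSpace (N₀ N₁ : V → ℝ≥0∞) (θ : ℝ) (r : ℝ≥0∞) (b : ℝ → ℝ) (q : ℝ≥0∞) (a : ℝ → ℝ)
    (f : V) : ℝ≥0∞ :=
  wnorm r (Ioi 0) 0 b fun t => wnorm q (Ioo 0 t) θ a fun u => K N₀ N₁ u f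

/-- The quasi-norm of the extremal space `(N₀, N₁)^{L,L}_{θ, s, c, r, b, q, a}`. -/
def LLSpace (N₀ N₁ : V → ℝ≥0∞) (θ : ℝ) (s : ℝ≥0∞) (c : ℝ → ℝ) (r : ℝ≥0∞) (b : ℝ → ℝ)
    (q : ℝ≥0∞) (a : ℝ → ℝ) (f : V) : ℝ≥0∞ :=
  wnorm s (Ioi 0) 0 c fun t => wnorm r (Ioo 0 t) 0 b fun u =>
    wnorm q (Ioo 0 u) θ a fun v => K N₀ N₁ v f

/-- The quasi-norm of the extremal space `(N₀, N₁)^{L,R}_{θ, s, c, r, b, q, a}`. -/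
def LRSpace (N₀ N₁ : V → ℝ≥0∞) (θ : ℝ) (s : ℝ≥0∞) (c : ℝ → ℝ) (r : ℝ≥0∞) (b : ℝ → ℝ)
    (q : ℝ≥0∞) (a : ℝ → ℝ) (f : V) : ℝ≥0∞ :=
  wnorm s (Ioi 0) 0 c fun t => wnorm r (Ioi t) 0 b fun u =>
    wnorm q (Ioo t u) θ a fun v => K N₀ N₁ v f

/-- The intersection of two spaces, with the maximum of the two quasi-norms. -/
def inter (N M : V → ℝ≥0∞) (f : V) : ℝ≥0∞ := max (N f) (M f)

/-- Continuous embedding of the space with quasi-norm `N` into the one with quasi-norm `M`. -/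
def Embeds (N M : V → ℝ≥0∞) : Prop :=
  ∃ C : ℝ≥0, ∀ f, N f < ∞ → M f < ∞ ∧ M f ≤ C * N f

/-- Equality of spaces: the same elements, with equivalent quasi-norms. -/
def SpaceEq (N M : V → ℝ≥0∞) : Prop := Embeds N M ∧ Embeds M N

/-- `χ₀(t) = ‖s^(-1/r₀) b₀(s) ‖u^(-1/q₀) a₀(u)‖_{q₀,(t,s)}‖_{r₀,(t,∞)}`. -/
def chi0 (r₀ : ℝ≥0∞) (b₀ : ℝ → ℝ) (q₀ : ℝ≥0∞) (a₀ : ℝ → ℝ) (t : ℝ) : ℝ :=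
  (wnorm r₀ (Ioi t) 0 b₀ fun s => wnorm q₀ (Ioo t s) 0 a₀ fun _ => 1).toReal

/-- `χ₁(t) = ‖s^(-1/r₁) b₁(s) ‖u^(-1/q₁) a₁(u)‖_{q₁,(0,s)}‖_{r₁,(0,t)}
  + ‖s^(-1/r₁) b₁(s)‖_{r₁,(t,∞)} ‖u^(-1/q₁) a₁(u)‖_{q₁,(0,t)}`. -/
def chi1 (r₁ : ℝ≥0∞) (b₁ : ℝ → ℝ) (q₁ : ℝ≥0∞) (a₁ : ℝ → ℝ) (t : ℝ) : ℝ :=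
  ((wnorm r₁ (Ioo 0 t) 0 b₁ fun s => wnorm q₁ (Ioo 0 s) 0 a₁ fun _ => 1)
    + (wnorm r₁ (Ioi t) 0 b₁ fun _ => 1) * (wnorm q₁ (Ioo 0 t) 0 a₁ fun _ => 1)).toReal

/-- `ρ(t) = t χ₀(t) / χ₁(t)`. -/
def rho (χ₀ χ₁ : ℝ → ℝ) (t : ℝ) : ℝ := t * χ₀ t / χ₁ t

/-- `a^# = χ₀^(1-θ) χ₁^θ (a ∘ ρ)`. -/
def aSharp (χ₀ χ₁ a : ℝ → ℝ) (θ t : ℝ) : ℝ :=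
  χ₀ t ^ (1 - θ) * χ₁ t ^ θ * a (rho χ₀ χ₁ t)

/-- `B₀(t) = ‖s^(-1/r₀) b₀(s)‖_{r₀,(t,∞)} a(ρ(t))`. -/
def B0 (r₀ : ℝ≥0∞) (b₀ a ρ : ℝ → ℝ) (t : ℝ) : ℝ :=
  (wnorm r₀ (Ioi t) 0 b₀ fun _ => 1).toReal * a (ρ t)

end RealInterp

end

/-!
In the logarithmic variable `x = log t`, with `k(x) = K(e^x, f)`, the space `X₀` has the quasi-norm
`Φ₀(k)` and `X₁` the quasi-norm `Φ₁(e^{-u} k(u))`, where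
`Φᵢ(g) = ‖bᵢ(s) ‖aᵢ g‖_{qᵢ, (-∞, s)}‖_{rᵢ, ℝ}` with weights that grow and decay slower than any
exponential (`Potter`). All that is used of `Φᵢ` is recorded in `Admissible`: it is a lattice
quasi-norm, its `p`-th power is countably subadditive up to a constant for a small common `p`, and
its translations grow subexponentially. The functions `χ₀(x)` and `χ₁(x)` are comparable to
`Φ₀(1_{(x, ∞)})` and `Φ₁(1_{(-∞, x)})`.

The heart of the matter is a formula of Holmstedt type (`Setting.logK_le_holmstedt`,
`Setting.exists_holmstedt_le`): with `ρ = e^x χ₀ / χ₁`,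
`K(ρ(x), f; X₀, X₁) ~ Φ₀(1_{(-∞, x)} k) + k(x) χ₀(x) + ρ(x) Φ₁(1_{(x, ∞)} e^{-u} k(u))`.
The upper bound splits `f` nearly optimally for `K(e^x, f)`; the lower bound uses
`k ≤ C (K(·, f₀) + K(·, f₁))` for an arbitrary decomposition of `f`.

Up to a bounded error `log ρ` is a bi-Lipschitz bijection of the line (`exists_bilipschitz_near`),
because it is the identity plus a function that is coarsely Lipschitz with small constant. A change
of variables (`exists_eLpNorm_comp_equiv`) therefore turns the quasi-norm of `(X₀, X₁)_{θ, r; a}`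
into a weighted `L_r` quasi-norm of the three terms of the formula (`Setting.reiteration`); the
weights are first replaced by step functions where their own measurability is not available.

The middle term gives `Ā_{θ, r; a^#}` for every `θ`. Hardy's inequality (`Admissible.hardy`),
proved by cutting the half-line into unit blocks, shows that the middle term dominates the left
one if `θ > 0` (`Setting.left_le_middle`) and the right one if `θ < 1` (`Setting.right_le_middle`).
For `θ = 1` the right term is by definition the quasi-norm of the `L, R` space; for `θ = 0` the left
term splits, at the outer variable `s = x`, into the quasi-norms of the `L` and the `L, L` spaces
(`exists_left_equiv`).
-/

noncomputable section

namespace RealInterp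

/-! ### Countable quasi-subadditivity of `L_q` quasi-norms -/

lemma eLpNorm_mono_ennreal {α : Type*} [MeasurableSpace α] {μ : Measure α} {q : ℝ≥0∞}
    {F G : α → ℝ≥0∞} (h : ∀ᵐ x ∂μ, F x ≤ G x) : eLpNorm F q μ ≤ eLpNorm G q μ :=
  eLpNorm_mono_enorm_ae h

lemma eLpNorm_le_const_mul {α : Type*} [MeasurableSpace α] {μ : Measure α} {q : ℝ≥0∞}
    {F G : α → ℝ≥0∞} {c : ℝ≥0∞} (hc : c ≠ ∞) (h : ∀ᵐ x ∂μ, F x ≤ c * G x) :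
    eLpNorm F q μ ≤ c * eLpNorm G q μ := by
  lift c to ℝ≥0 using hc
  exact eLpNorm_le_mul_eLpNorm_of_ae_le_mul' h q

lemma eLpNorm_const_mul_ennreal {α : Type*} [MeasurableSpace α] {μ : Measure α} {q : ℝ≥0∞}
    (F : α → ℝ≥0∞) {c : ℝ≥0∞} (hc : c ≠ ∞) (hc0 : c ≠ 0) :
    eLpNorm (fun x => c * F x) q μ = c * eLpNorm F q μ := by
  refine le_antisymm (eLpNorm_le_const_mul hc (.of_forall fun x => le_rfl)) ?_
  have h : eLpNorm F q μ ≤ c⁻¹ * eLpNorm (fun x => c * F x) q μ := by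
    refine eLpNorm_le_const_mul (ENNReal.inv_ne_top.2 hc0) (.of_forall fun x => ?_)
    rw [← mul_assoc, ENNReal.inv_mul_cancel hc0 hc, one_mul]
  calc c * eLpNorm F q μ ≤ c * (c⁻¹ * eLpNorm (fun x => c * F x) q μ) := by gcongr
    _ = _ := by rw [← mul_assoc, ENNReal.mul_inv_cancel hc0 hc, one_mul]

/-- Minkowski's inequality for countable sums. -/
lemma eLpNorm_tsum_le {α : Type*} [MeasurableSpace α] {μ : Measure α} {s : ℝ≥0∞} (hs : 1 ≤ s)
    {F : ℕ → α → ℝ≥0∞} (hF : ∀ m, AEMeasurable (F m) μ) :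
    eLpNorm (fun x => ∑' m, F m x) s μ ≤ ∑' m, eLpNorm (F m) s μ := by
  have hs0 : s ≠ 0 := fun h => by simp [h] at hs
  by_cases htop : s = ∞
  · subst htop
    simp only [eLpNorm_exponent_top, eLpNormEssSup_eq_essSup_enorm, enorm_eq_self]
    refine essSup_le_of_ae_le _ ?_
    have : ∀ᵐ x ∂μ, ∀ m, F m x ≤ essSup (F m) μ := ae_all_iff.2 fun m => ENNReal.ae_le_essSup _
    filter_upwards [this] with x hx
    exact ENNReal.tsum_le_tsum hx
  have hsr : 0 < s.toReal := ENNReal.toReal_pos hs0 htop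
  set B := ∑' m, eLpNorm (F m) s μ
  set S : ℕ → α → ℝ≥0∞ := fun n => ∑ m ∈ Finset.range n, F m with hS
  have hSn : ∀ n, ∫⁻ x, S n x ^ s.toReal ∂μ ≤ B ^ s.toReal := by
    intro n
    have h1 : eLpNorm (S n) s μ ≤ B :=
      (eLpNorm_sum_le (fun i _ => (hF i).aestronglyMeasurable) hs).trans (ENNReal.sum_le_tsum _)
    rw [eLpNorm_eq_lintegral_rpow_enorm_toReal hs0 htop, one_div,
      ENNReal.rpow_inv_le_iff hsr] at h1
    exact h1
  rw [eLpNorm_eq_lintegral_rpow_enorm_toReal hs0 htop, one_div, ENNReal.rpow_inv_le_iff hsr]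
  have heq : ∀ x, ‖∑' m, F m x‖ₑ ^ s.toReal = ⨆ n, S n x ^ s.toReal := by
    intro x
    rw [enorm_eq_self, ENNReal.tsum_eq_iSup_nat]
    simp only [hS, Finset.sum_apply]
    exact (ENNReal.orderIsoRpow s.toReal hsr).map_iSup (fun n => ∑ m ∈ Finset.range n, F m x)
  simp_rw [heq]
  rw [lintegral_iSup' ?_ ?_]
  · exact iSup_le hSn
  · intro n
    have : AEMeasurable (S n) μ := Finset.aemeasurable_sum _ fun i _ => hF i
    exact this.pow_const _
  · refine .of_forall fun x => ?_
    intro m n hmn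
    simp only [hS, Finset.sum_apply]
    gcongr

/-- For `p ≤ q` the `p`-th power of the quasi-norm of `L_q` is countably subadditive, even with
respect to `p`-th powers of the summands. -/
lemma eLpNorm_rpow_le_tsum {α : Type*} [MeasurableSpace α] {μ : Measure α} {p : ℝ} (hp : 0 < p)
    {q : ℝ≥0∞} (hpq : ENNReal.ofReal p ≤ q) {G : α → ℝ≥0∞} {F : ℕ → α → ℝ≥0∞}
    (hF : ∀ m, AEMeasurable (F m) μ) (D : ℝ≥0)
    (h : ∀ᵐ x ∂μ, G x ^ p ≤ D * ∑' m, F m x ^ p) :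
    eLpNorm G q μ ^ p ≤ D * ∑' m, eLpNorm (F m) q μ ^ p := by
  have hp0 : ENNReal.ofReal p ≠ 0 := by simpa using hp
  set s := q / ENNReal.ofReal p
  have hsq : s * ENNReal.ofReal p = q := ENNReal.div_mul_cancel hp0 ENNReal.ofReal_ne_top
  have hs : 1 ≤ s := by
    rw [ENNReal.le_div_iff_mul_le (.inl hp0) (.inl ENNReal.ofReal_ne_top), one_mul]; exact hpq
  have key : ∀ H : α → ℝ≥0∞, eLpNorm H q μ ^ p = eLpNorm (fun x => H x ^ p) s μ := by
    intro H
    rw [← hsq]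
    exact (eLpNorm_enorm_rpow H hp).symm
  simp_rw [key]
  calc eLpNorm (fun x => G x ^ p) s μ
      ≤ D * eLpNorm (fun x => ∑' m, F m x ^ p) s μ :=
        eLpNorm_le_const_mul ENNReal.coe_ne_top h
    _ ≤ D * ∑' m, eLpNorm (fun x => F m x ^ p) s μ := by
        gcongr
        exact eLpNorm_tsum_le hs fun m => (hF m).pow_const _

lemma le_mul_of_rpow_le {p : ℝ} (hp : 0 < p) {D : ℝ≥0} {x y : ℝ≥0∞} (h : x ^ p ≤ D * y ^ p) :
    x ≤ ((D ^ (1 / p) : ℝ≥0) : ℝ≥0∞) * y := by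
  have h2 : (D : ℝ≥0∞) * y ^ p = (((D ^ (1 / p) : ℝ≥0) : ℝ≥0∞) * y) ^ p := by
    rw [ENNReal.mul_rpow_of_nonneg _ _ hp.le, ENNReal.coe_rpow_of_nonneg _ (by positivity),
      ← ENNReal.rpow_mul, one_div, inv_mul_cancel₀ hp.ne', ENNReal.rpow_one]
  rw [h2] at h
  exact (ENNReal.rpow_le_rpow_iff hp).1 h

/-! ### Exponential weights and controlled functions on the line -/

/-- The exponential function with values in `[0, ∞]`. -/
def E (x : ℝ) : ℝ≥0∞ := ENNReal.ofReal (Real.exp x)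

lemma E_ne_top (x : ℝ) : E x ≠ ∞ := ENNReal.ofReal_ne_top
lemma E_ne_zero (x : ℝ) : E x ≠ 0 := by simp [E, Real.exp_pos]
@[simp] lemma E_zero : E 0 = 1 := by simp [E]
lemma E_add (x y : ℝ) : E (x + y) = E x * E y := by
  rw [E, Real.exp_add, ENNReal.ofReal_mul (Real.exp_pos _).le]; rfl
lemma E_mono : Monotone E := fun _ _ h => ENNReal.ofReal_le_ofReal (Real.exp_le_exp.2 h)
lemma one_le_E {x : ℝ} (h : 0 ≤ x) : 1 ≤ E x := by rw [← E_zero]; exact E_mono h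
lemma E_mul_neg (x : ℝ) : E x * E (-x) = 1 := by rw [← E_add]; simp
lemma E_rpow (x p : ℝ) : E x ^ p = E (x * p) := by
  rw [E, E, ENNReal.ofReal_rpow_of_pos (Real.exp_pos _), Real.exp_mul]
lemma measurable_E : Measurable E := E_mono.measurable
lemma coe_toNNReal_E (x : ℝ) : ((E x).toNNReal : ℝ≥0∞) = E x := ENNReal.coe_toNNReal (E_ne_top x)

/-- A function on the line that changes at most by a bounded factor over bounded distances. -/
def Controlled (w : ℝ → ℝ≥0∞) : Prop :=
  ∀ L : ℝ, ∃ C : ℝ≥0, ∀ x y, |x - y| ≤ L → w x ≤ C * w y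

/-- Slow variation in the logarithmic variable, as a two-sided Potter bound; the function is
required to be positive and finite. -/
structure Potter (w : ℝ → ℝ≥0∞) : Prop where
  ne_zero : ∀ x, w x ≠ 0
  ne_top : ∀ x, w x ≠ ∞
  bound : ∀ ε : ℝ, 0 < ε → ∃ C : ℝ≥0, ∀ x y, w x ≤ C * E (ε * |x - y|) * w y

lemma Potter.controlled {w : ℝ → ℝ≥0∞} (hw : Potter w) : Controlled w := by
  intro L
  obtain ⟨C, hC⟩ := hw.bound 1 one_pos
  refine ⟨C * (E L).toNNReal, fun x y h => (hC x y).trans ?_⟩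
  push_cast
  rw [coe_toNNReal_E]
  gcongr
  exact E_mono (by linarith)

lemma Controlled.mul {w v : ℝ → ℝ≥0∞} (hw : Controlled w) (hv : Controlled v) :
    Controlled fun x => w x * v x := by
  intro L
  obtain ⟨C, hC⟩ := hw L
  obtain ⟨D, hD⟩ := hv L
  refine ⟨C * D, fun x y h => ?_⟩
  calc w x * v x ≤ (C * w y) * (D * v y) := by gcongr; exacts [hC x y h, hD x y h]
    _ = _ := by push_cast; ring

lemma controlled_E (c : ℝ) : Controlled fun x => E (c * x) := by
  intro L
  refine ⟨(E (|c| * L)).toNNReal, fun x y h => ?_⟩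
  rw [coe_toNNReal_E, ← E_add]
  apply E_mono
  have : c * (x - y) ≤ |c| * |x - y| := by rw [← abs_mul]; exact le_abs_self _
  have h2 : |c| * |x - y| ≤ |c| * L := by gcongr
  linarith

lemma Potter.inv {w : ℝ → ℝ≥0∞} (hw : Potter w) : Potter fun x => (w x)⁻¹ where
  ne_zero x := ENNReal.inv_ne_zero.2 (hw.ne_top x)
  ne_top x := ENNReal.inv_ne_top.2 (hw.ne_zero x)
  bound ε hε := by
    obtain ⟨C, hC⟩ := hw.bound ε hε
    refine ⟨C, fun x y => ?_⟩
    rw [ENNReal.inv_le_iff_inv_le, ENNReal.mul_inv (.inr (by simp [hw.ne_zero]))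
      (.inr (by simp [hw.ne_top])), inv_inv]
    have h := hC y x
    rw [abs_sub_comm] at h
    rw [mul_comm, ← div_eq_mul_inv]
    exact ENNReal.div_le_of_le_mul (by rwa [mul_comm])

lemma Potter.mul {w v : ℝ → ℝ≥0∞} (hw : Potter w) (hv : Potter v) :
    Potter fun x => w x * v x where
  ne_zero x := mul_ne_zero (hw.ne_zero x) (hv.ne_zero x)
  ne_top x := ENNReal.mul_ne_top (hw.ne_top x) (hv.ne_top x)
  bound ε hε := by
    obtain ⟨C, hC⟩ := hw.bound (ε / 2) (by positivity)
    obtain ⟨D, hD⟩ := hv.bound (ε / 2) (by positivity)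
    refine ⟨C * D, fun x y => ?_⟩
    calc w x * v x ≤ (C * E (ε / 2 * |x - y|) * w y) * (D * E (ε / 2 * |x - y|) * v y) := by
          gcongr; exacts [hC x y, hD x y]
      _ = C * D * (E (ε / 2 * |x - y|) * E (ε / 2 * |x - y|)) * (w y * v y) := by ring
      _ = _ := by rw [← E_add]; push_cast; ring_nf

/-- A function comparable with a slowly varying one is slowly varying. -/
lemma Potter.of_equiv {w v : ℝ → ℝ≥0∞} (hw : Potter w) {C D : ℝ≥0} (h1 : ∀ x, v x ≤ C * w x)
    (h2 : ∀ x, w x ≤ D * v x) : Potter v where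
  ne_zero x h := hw.ne_zero x (by simpa [h] using h2 x)
  ne_top x h := by
    have := h1 x
    rw [h, top_le_iff] at this
    exact ENNReal.mul_ne_top ENNReal.coe_ne_top (hw.ne_top x) this
  bound ε hε := by
    obtain ⟨K, hK⟩ := hw.bound ε hε
    refine ⟨C * K * D, fun x y => ?_⟩
    calc v x ≤ C * (K * E (ε * |x - y|) * (D * v y)) := by
          refine (h1 x).trans ?_
          gcongr
          refine (hK x y).trans ?_
          gcongr
          exact h2 y
      _ = _ := by push_cast; ring

lemma eLpNorm_le_of_weight_le {w v : ℝ → ℝ≥0∞} {c : ℝ≥0} (h : ∀ x, w x ≤ c * v x)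
    (F : ℝ → ℝ≥0∞) {q : ℝ≥0∞} {μ : Measure ℝ} :
    eLpNorm (fun x => w x * F x) q μ ≤ c * eLpNorm (fun x => v x * F x) q μ :=
  eLpNorm_le_const_mul ENNReal.coe_ne_top (.of_forall fun x => by
    rw [← mul_assoc]; gcongr; exact h x)

lemma eLpNorm_weight_mul_le {w F G : ℝ → ℝ≥0∞} {c : ℝ≥0} (h : ∀ x, F x ≤ c * G x)
    {q : ℝ≥0∞} {μ : Measure ℝ} :
    eLpNorm (fun x => w x * F x) q μ ≤ c * eLpNorm (fun x => w x * G x) q μ :=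
  eLpNorm_le_const_mul ENNReal.coe_ne_top (.of_forall fun x => by
    rw [mul_left_comm]; gcongr; exact h x)

/-- Rounding down gives a measurable function comparable with a controlled one. No measurability
of `w` itself is needed, which matters for compositions of weights. -/
lemma exists_measurable_of_unit_le {w : ℝ → ℝ≥0∞} {C : ℝ≥0}
    (hC : ∀ x y, |x - y| ≤ 1 → w x ≤ C * w y) :
    ∃ v : ℝ → ℝ≥0∞, Measurable v ∧ ∀ x, w x ≤ C * v x ∧ v x ≤ C * w x := by
  refine ⟨fun x => w ⌊x⌋, ?_, fun x => ⟨hC _ _ ?_, hC _ _ ?_⟩⟩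
  · exact (measurable_from_top (f := fun n : ℤ => w n)).comp Int.measurable_floor
  · rw [abs_of_nonneg (by linarith [Int.floor_le x])]; linarith [Int.lt_floor_add_one x]
  · rw [abs_sub_comm, abs_of_nonneg (by linarith [Int.floor_le x])]
    linarith [Int.lt_floor_add_one x]

lemma Controlled.exists_measurable {w : ℝ → ℝ≥0∞} (hw : Controlled w) :
    ∃ v : ℝ → ℝ≥0∞, Measurable v ∧ ∃ C : ℝ≥0, ∀ x, w x ≤ C * v x ∧ v x ≤ C * w x := by
  obtain ⟨C, hC⟩ := hw 1
  obtain ⟨v, hv, h⟩ := exists_measurable_of_unit_le hC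
  exact ⟨v, hv, C, h⟩

/-- Countable quasi-subadditivity of weighted `L_q` quasi-norms, uniformly in the measure. -/
lemma Controlled.eLpNorm_rpow_le_tsum {w : ℝ → ℝ≥0∞} (hw : Controlled w) {p : ℝ} (hp : 0 < p)
    {q : ℝ≥0∞} (hpq : ENNReal.ofReal p ≤ q) : ∃ C : ℝ≥0, ∀ (μ : Measure ℝ) (D : ℝ≥0)
      (G : ℝ → ℝ≥0∞) (F : ℕ → ℝ → ℝ≥0∞), (∀ m, Measurable (F m)) →
      (∀ᵐ x ∂μ, G x ^ p ≤ D * ∑' m, F m x ^ p) →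
      eLpNorm (fun x => w x * G x) q μ ^ p ≤
        C * D * ∑' m, eLpNorm (fun x => w x * F m x) q μ ^ p := by
  obtain ⟨v, hv, c, hc⟩ := hw.exists_measurable
  refine ⟨c ^ p * c ^ p, fun μ D G F hF h => ?_⟩
  have e1 : eLpNorm (fun x => w x * G x) q μ ≤ c * eLpNorm (fun x => v x * G x) q μ :=
    eLpNorm_le_of_weight_le (fun x => (hc x).1) _
  have e2 : ∀ m, eLpNorm (fun x => v x * F m x) q μ ≤ c * eLpNorm (fun x => w x * F m x) q μ :=
    fun m => eLpNorm_le_of_weight_le (fun x => (hc x).2) _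
  have e3 : eLpNorm (fun x => v x * G x) q μ ^ p ≤
      D * ∑' m, eLpNorm (fun x => v x * F m x) q μ ^ p := by
    refine RealInterp.eLpNorm_rpow_le_tsum hp hpq (F := fun m x => v x * F m x)
      (fun m => (hv.mul (hF m)).aemeasurable) D ?_
    filter_upwards [h] with x hx
    simp_rw [ENNReal.mul_rpow_of_nonneg _ _ hp.le, ENNReal.tsum_mul_left]
    calc v x ^ p * G x ^ p ≤ v x ^ p * (D * ∑' m, F m x ^ p) := by gcongr
      _ = _ := by ring
  have hcp : (c : ℝ≥0∞) ^ p = ((c ^ p : ℝ≥0) : ℝ≥0∞) :=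
    (ENNReal.coe_rpow_of_nonneg _ hp.le).symm
  calc eLpNorm (fun x => w x * G x) q μ ^ p
      ≤ (c * eLpNorm (fun x => v x * G x) q μ) ^ p := by gcongr
    _ = c ^ p * eLpNorm (fun x => v x * G x) q μ ^ p := ENNReal.mul_rpow_of_nonneg _ _ hp.le
    _ ≤ c ^ p * (D * ∑' m, (c * eLpNorm (fun x => w x * F m x) q μ) ^ p) := by
        gcongr
        refine e3.trans ?_
        gcongr with m
        exact e2 m
    _ = _ := by
        simp_rw [ENNReal.mul_rpow_of_nonneg _ _ hp.le, ENNReal.tsum_mul_left]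
        rw [hcp]
        push_cast
        ring

/-- The quasi-triangle inequality of weighted `L_q` quasi-norms, uniformly in the measure. -/
lemma Controlled.eLpNorm_add_le {w : ℝ → ℝ≥0∞} (hw : Controlled w) (q : ℝ≥0∞) :
    ∃ C : ℝ≥0, ∀ (μ : Measure ℝ) (F G : ℝ → ℝ≥0∞), Measurable F → Measurable G →
      eLpNorm (fun x => w x * (F x + G x)) q μ ≤
        C * (eLpNorm (fun x => w x * F x) q μ + eLpNorm (fun x => w x * G x) q μ) := by
  obtain ⟨v, hv, c, hc⟩ := hw.exists_measurable
  have hL : ENNReal.LpAddConst q ≠ ∞ := (ENNReal.LpAddConst_lt_top q).ne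
  refine ⟨c * (ENNReal.LpAddConst q).toNNReal * c, fun μ F G hF hG => ?_⟩
  have e1 : ∀ H : ℝ → ℝ≥0∞,
      eLpNorm (fun x => w x * H x) q μ ≤ c * eLpNorm (fun x => v x * H x) q μ := fun H =>
    eLpNorm_le_of_weight_le (fun x => (hc x).1) _
  have e2 : ∀ H : ℝ → ℝ≥0∞,
      eLpNorm (fun x => v x * H x) q μ ≤ c * eLpNorm (fun x => w x * H x) q μ :=
    fun m => eLpNorm_le_of_weight_le (fun x => (hc x).2) _
  have e3 : eLpNorm (fun x => v x * (F x + G x)) q μ ≤ ENNReal.LpAddConst q *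
      (eLpNorm (fun x => v x * F x) q μ + eLpNorm (fun x => v x * G x) q μ) := by
    have := eLpNorm_add_le' (μ := μ) (hv.mul hF).aestronglyMeasurable
      (hv.mul hG).aestronglyMeasurable q
    simp only [mul_add] at this ⊢
    exact this
  calc eLpNorm (fun x => w x * (F x + G x)) q μ
      ≤ c * (ENNReal.LpAddConst q * (c * eLpNorm (fun x => w x * F x) q μ
          + c * eLpNorm (fun x => w x * G x) q μ)) := by
        refine (e1 _).trans ?_
        gcongr
        refine e3.trans ?_
        gcongr <;> exact e2 _
    _ = _ := by push_cast [ENNReal.coe_toNNReal hL]; ring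

/-- A weighted quasi-norm with positive weight vanishes only on functions vanishing almost
everywhere. -/
lemma Controlled.ae_eq_zero {w : ℝ → ℝ≥0∞} (hw : Controlled w) (hw0 : ∀ x, w x ≠ 0)
    {q : ℝ≥0∞} (hq : q ≠ 0) {μ : Measure ℝ} {F : ℝ → ℝ≥0∞} (hF : Measurable F)
    (h : eLpNorm (fun x => w x * F x) q μ = 0) : ∀ᵐ x ∂μ, F x = 0 := by
  obtain ⟨v, hv, c, hc⟩ := hw.exists_measurable
  have e2 : eLpNorm (fun x => v x * F x) q μ ≤ c * eLpNorm (fun x => w x * F x) q μ :=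
    eLpNorm_le_of_weight_le (fun x => (hc x).2) _
  rw [h, mul_zero, nonpos_iff_eq_zero] at e2
  filter_upwards [(eLpNorm_eq_zero_iff (hv.mul hF).aestronglyMeasurable hq).1 e2] with x hx
  refine (mul_eq_zero.1 hx).resolve_left fun h0 => hw0 x ?_
  simpa [h0] using (hc x).1

/-- A finite weighted quasi-norm forces finiteness almost everywhere. -/
lemma Controlled.ae_lt_top {w : ℝ → ℝ≥0∞} (hw : Controlled w) (hw0 : ∀ x, w x ≠ 0)
    {q : ℝ≥0∞} (hq : q ≠ 0) {μ : Measure ℝ} {F : ℝ → ℝ≥0∞} (hF : Measurable F)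
    (h : eLpNorm (fun x => w x * F x) q μ ≠ ∞) : ∀ᵐ x ∂μ, F x ≠ ∞ := by
  obtain ⟨v, hv, c, hc⟩ := hw.exists_measurable
  have e2 : eLpNorm (fun x => v x * F x) q μ ≤ c * eLpNorm (fun x => w x * F x) q μ :=
    eLpNorm_le_of_weight_le (fun x => (hc x).2) _
  have e3 : eLpNorm (fun x => v x * F x) q μ ≠ ∞ :=
    ne_top_of_le_ne_top (ENNReal.mul_ne_top ENNReal.coe_ne_top h) e2
  have e4 : ∀ᵐ x ∂μ, v x * F x < ∞ := by
    by_cases htop : q = ∞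
    · subst htop
      simp only [eLpNorm_exponent_top, eLpNormEssSup_eq_essSup_enorm, enorm_eq_self] at e3
      filter_upwards [ENNReal.ae_le_essSup (fun x => v x * F x)] with x hx
      exact hx.trans_lt e3.lt_top
    · have h5 := lintegral_rpow_enorm_lt_top_of_eLpNorm_lt_top hq htop e3.lt_top
      have h6 := ae_lt_top' (((hv.mul hF).aemeasurable).pow_const q.toReal) h5.ne
      filter_upwards [h6] with x hx
      by_contra hcon
      rw [not_lt, top_le_iff] at hcon
      simp only [Pi.mul_apply, hcon, ENNReal.top_rpow_of_pos (ENNReal.toReal_pos hq htop)] at hx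
      exact lt_irrefl _ hx
  filter_upwards [e4] with x hx h0
  rw [h0, ENNReal.mul_top] at hx
  · exact lt_irrefl _ hx
  · intro h1; exact hw0 x (by simpa [h1] using (hc x).1)

lemma eLpNorm_translate (F : ℝ → ℝ≥0∞) (q : ℝ≥0∞) (S : Set ℝ) (d : ℝ) :
    eLpNorm (fun x => F (x + d)) q (volume.restrict ((· + d) ⁻¹' S)) =
      eLpNorm F q (volume.restrict S) := by
  have he : MeasurableEmbedding (fun x : ℝ => x + d) := measurableEmbedding_addRight d
  have h := he.eLpNorm_map_measure (g := F) (p := q)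
    (μ := volume.restrict ((· + d) ⁻¹' S))
  rw [← he.restrict_map, map_add_right_eq_self] at h
  exact h.symm

/-! ### Translation-quasi-invariant lattice quasi-norms -/

/-- The properties of the quasi-norms `g ↦ ‖b(s) ‖a(u) g(u)‖_{q, (-∞, s)}‖_{r, ℝ}` with slowly
varying weights on which the whole argument rests: a lattice quasi-norm whose `p`-th power is
countably subadditive up to a constant, and whose translations grow subexponentially. -/
structure Admissible (p : ℝ) (Φ : (ℝ → ℝ≥0∞) → ℝ≥0∞) : Prop where
  mono_ae : ∀ g h : ℝ → ℝ≥0∞, (∀ᵐ u, g u ≤ h u) → Φ g ≤ Φ h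
  const_mul_le : ∀ (c : ℝ≥0∞) (g : ℝ → ℝ≥0∞), c ≠ ∞ → Φ (fun u => c * g u) ≤ c * Φ g
  add_le : ∃ C : ℝ≥0, ∀ g h : ℝ → ℝ≥0∞, Measurable g → Measurable h →
    Φ (fun u => g u + h u) ≤ C * (Φ g + Φ h)
  rpow_le_tsum : ∃ C : ℝ≥0, ∀ (g : ℝ → ℝ≥0∞) (F : ℕ → ℝ → ℝ≥0∞), (∀ m, Measurable (F m)) →
    (∀ u, g u ^ p ≤ ∑' m, F m u ^ p) → Φ g ^ p ≤ C * ∑' m, Φ (F m) ^ p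
  translate : ∀ ε : ℝ, 0 < ε → ∃ C : ℝ≥0, ∀ (d : ℝ) (g : ℝ → ℝ≥0∞),
    Φ (fun u => g (u - d)) ≤ C * E (ε * |d|) * Φ g

variable {p : ℝ} {Φ : (ℝ → ℝ≥0∞) → ℝ≥0∞}

lemma Admissible.mono (hΦ : Admissible p Φ) {g h : ℝ → ℝ≥0∞} (H : ∀ u, g u ≤ h u) : Φ g ≤ Φ h :=
  hΦ.mono_ae g h (.of_forall H)

lemma Admissible.zero (hΦ : Admissible p Φ) : Φ (fun _ => 0) = 0 := by
  simpa using hΦ.const_mul_le 0 (fun _ => 0) ENNReal.zero_ne_top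

/-- The quasi-norms of the translates of a fixed function are slowly varying. -/
lemma Admissible.potter (hΦ : Admissible p Φ) (g : ℝ → ℝ≥0∞)
    (hpos : ∀ t, Φ (fun u => g (u - t)) ≠ 0) (hfin : ∃ t, Φ (fun u => g (u - t)) ≠ ∞) :
    Potter fun t => Φ (fun u => g (u - t)) := by
  have key : ∀ ε : ℝ, 0 < ε → ∃ C : ℝ≥0, ∀ x y, Φ (fun u => g (u - x)) ≤
      C * E (ε * |x - y|) * Φ (fun u => g (u - y)) := by
    intro ε hε
    obtain ⟨C, hC⟩ := hΦ.translate ε hε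
    refine ⟨C, fun x y => ?_⟩
    have := hC (x - y) (fun u => g (u - y))
    simpa only [sub_sub, sub_add_cancel] using this
  refine ⟨hpos, fun x => ?_, key⟩
  obtain ⟨t, ht⟩ := hfin
  obtain ⟨C, hC⟩ := key 1 one_pos
  exact ne_top_of_le_ne_top
    (ENNReal.mul_ne_top (ENNReal.mul_ne_top ENNReal.coe_ne_top (E_ne_top _)) ht) (hC x t)

/-! ### Summation over unit blocks and Hardy-type inequalities -/

/-- The open half-line to the left (`σ = 1`) or to the right (`σ = -1`) of `t`. -/
def side (σ t : ℝ) : Set ℝ := {u | 0 < σ * (t - u)}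

lemma side_one (t : ℝ) : side 1 t = Iio t := by ext u; simp [side]
lemma side_neg_one (t : ℝ) : side (-1) t = Ioi t := by ext u; simp [side]

/-- The quasi-norm over a half-line is dominated by the `ℓ_p` sum over unit blocks. -/
lemma Admissible.rpow_side_le (hΦ : Admissible p Φ) (hp : 0 < p) {σ : ℝ} (hσ : |σ| = 1)
    {X : ℝ → ℝ≥0∞} {A : ℝ≥0}
    (hX : ∀ t, Φ ((Icc (t - 1) (t + 1)).indicator fun _ => 1) ≤ A * X t) (D : ℝ≥0) :
    ∃ C : ℝ≥0, ∀ h : ℝ → ℝ≥0∞, (∀ u v, |u - v| ≤ 1 → h u ≤ D * h v) → (∀ u, h u ≠ ∞) →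
      ∀ t, Φ ((side σ t).indicator h) ^ p ≤
        C * ∑' m : ℕ, (h (t - σ * m) * X (t - σ * m)) ^ p := by
  obtain ⟨C, hC⟩ := hΦ.rpow_le_tsum
  refine ⟨C * (D * A) ^ p, fun h hD htop t => ?_⟩
  set F : ℕ → ℝ → ℝ≥0∞ := fun m u => (D * h (t - σ * m)) *
    (Icc (t - σ * m - 1) (t - σ * m + 1)).indicator (fun _ => 1) u with hF
  have hσσ : σ * σ = 1 := by
    have := congrArg (fun x => x * x) hσ
    simpa [abs_mul_abs_self] using this
  have h1 := hC ((side σ t).indicator h) F ?_ ?_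
  · calc Φ ((side σ t).indicator h) ^ p ≤ C * ∑' m, Φ (F m) ^ p := h1
      _ ≤ C * ∑' m : ℕ, ((D * A : ℝ≥0) * (h (t - σ * m) * X (t - σ * m))) ^ p := by
          gcongr with m
          calc Φ (F m) ≤ (D * h (t - σ * m)) * Φ _ :=
                hΦ.const_mul_le _ _ (ENNReal.mul_ne_top ENNReal.coe_ne_top (htop _))
            _ ≤ (D * h (t - σ * m)) * (A * X (t - σ * m)) := by gcongr; exact hX _
            _ = _ := by push_cast; ring
      _ = _ := by
          simp_rw [ENNReal.mul_rpow_of_nonneg _ _ hp.le, ENNReal.tsum_mul_left]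
          rw [← mul_assoc, ← ENNReal.coe_rpow_of_nonneg _ hp.le]
          push_cast; rfl
  · intro m
    exact (measurable_const.indicator measurableSet_Icc).const_mul _
  · intro u
    by_cases hu : u ∈ side σ t
    · rw [indicator_of_mem hu]
      have hu' : 0 < σ * (t - u) := hu
      -- `u` lies in the block of index `m`
      set m := ⌊σ * (t - u)⌋₊
      have hm1 : (m : ℝ) ≤ σ * (t - u) := Nat.floor_le hu'.le
      have hm2 : σ * (t - u) < m + 1 := Nat.lt_floor_add_one _
      have hdist : |u - (t - σ * m)| ≤ 1 := by
        have : u - (t - σ * m) = -σ * (σ * (t - u) - m) := by linear_combination (t - u) * hσσ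
        rw [this, abs_mul, abs_neg, hσ, one_mul, abs_of_nonneg (by linarith)]
        linarith
      refine le_trans ?_ (ENNReal.le_tsum m)
      have hmem : u ∈ Icc (t - σ * m - 1) (t - σ * m + 1) := by
        rw [abs_le] at hdist; constructor <;> linarith [hdist.1, hdist.2]
      simp only [hF, indicator_of_mem hmem, mul_one]
      gcongr
      exact hD _ _ hdist
    · rw [indicator_of_notMem hu, ENNReal.zero_rpow_of_pos hp]
      exact zero_le

lemma exists_tsum_geometric {p δ : ℝ} (hp : 0 < p) (hδ : 0 < δ) :
    ∃ S : ℝ≥0, ∑' m : ℕ, E (-(δ * m)) ^ p ≤ S := by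
  have h : ∀ m : ℕ, E (-(δ * m)) ^ p = E (-(δ * p)) ^ m := by
    intro m
    rw [E_rpow, ← ENNReal.rpow_natCast, E_rpow]
    congr 1; ring
  simp_rw [h]
  rw [ENNReal.tsum_geometric]
  have hlt : E (-(δ * p)) < 1 := by
    rw [E, ENNReal.ofReal_lt_one, Real.exp_lt_one_iff]
    linarith [mul_pos hδ hp]
  have hne : (1 - E (-(δ * p)))⁻¹ ≠ ∞ := ENNReal.inv_ne_top.2 (tsub_pos_of_lt hlt).ne'
  exact ⟨_, (ENNReal.coe_toNNReal hne).ge⟩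

/-- If `h X` decays geometrically when moving into the half-line, its quasi-norm over the half-line
is controlled by the value at the end point. -/
lemma Admissible.side_le_of_decay (hΦ : Admissible p Φ) (hp : 0 < p) {σ : ℝ} (hσ : |σ| = 1)
    {X : ℝ → ℝ≥0∞} {A : ℝ≥0}
    (hX : ∀ t, Φ ((Icc (t - 1) (t + 1)).indicator fun _ => 1) ≤ A * X t)
    {h : ℝ → ℝ≥0∞} (hh : Controlled h) (htop : ∀ u, h u ≠ ∞) {B : ℝ≥0} {δ : ℝ} (hδ : 0 < δ)
    (hdecay : ∀ (t : ℝ) (m : ℕ),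
      h (t - σ * m) * X (t - σ * m) ≤ B * E (-(δ * m)) * (h t * X t)) :
    ∃ C : ℝ≥0, ∀ t, Φ ((side σ t).indicator h) ≤ C * (h t * X t) := by
  obtain ⟨D, hD⟩ := hh 1
  obtain ⟨C, hC⟩ := hΦ.rpow_side_le hp hσ hX D
  obtain ⟨S, hS⟩ := exists_tsum_geometric hp hδ
  refine ⟨(C * (B ^ p * S)) ^ (1 / p), fun t => le_mul_of_rpow_le hp ?_⟩
  calc Φ ((side σ t).indicator h) ^ p
      ≤ C * ∑' m : ℕ, (h (t - σ * m) * X (t - σ * m)) ^ p := hC h hD htop t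
    _ ≤ C * ∑' m : ℕ, (B * E (-(δ * m)) * (h t * X t)) ^ p := by
        refine mul_le_mul_right (ENNReal.tsum_le_tsum fun m => ?_) _
        exact ENNReal.rpow_le_rpow (hdecay t m) hp.le
    _ = C * (B ^ p * (∑' m : ℕ, E (-(δ * m)) ^ p) * (h t * X t) ^ p) := by
        simp_rw [ENNReal.mul_rpow_of_nonneg _ _ hp.le, ENNReal.tsum_mul_right,
          ENNReal.tsum_mul_left]
    _ ≤ C * (B ^ p * S * (h t * X t) ^ p) := by gcongr
    _ = _ := by rw [← ENNReal.coe_rpow_of_nonneg _ hp.le]; push_cast; ring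

/-- Hardy's inequality: for a weight decaying geometrically away from the half-lines, the weighted
norm of the quasi-norms over half-lines is bounded by the weighted norm of the integrand. -/
lemma Admissible.hardy (hΦ : Admissible p Φ) (hp : 0 < p) {σ : ℝ} (hσ : |σ| = 1)
    {X : ℝ → ℝ≥0∞} {A : ℝ≥0}
    (hX : ∀ t, Φ ((Icc (t - 1) (t + 1)).indicator fun _ => 1) ≤ A * X t) (hXm : Measurable X)
    {r : ℝ≥0∞} (hpr : ENNReal.ofReal p ≤ r)
    {w : ℝ → ℝ≥0∞} (hw : Controlled w) {B : ℝ≥0} {δ : ℝ} (hδ : 0 < δ)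
    (hdecay : ∀ (x : ℝ) (m : ℕ), w x ≤ B * E (-(δ * m)) * w (x - σ * m)) (D : ℝ≥0) :
    ∃ C : ℝ≥0, ∀ h : ℝ → ℝ≥0∞, Measurable h → (∀ u v, |u - v| ≤ 1 → h u ≤ D * h v) →
      (∀ u, h u ≠ ∞) →
      eLpNorm (fun x => w x * Φ ((side σ x).indicator h)) r volume ≤
        C * eLpNorm (fun x => w x * (h x * X x)) r volume := by
  obtain ⟨C, hC⟩ := hΦ.rpow_side_le hp hσ hX D
  obtain ⟨S, hS⟩ := exists_tsum_geometric hp hδ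
  obtain ⟨M, hM⟩ := hw.eLpNorm_rpow_le_tsum hp hpr
  refine ⟨(M * C * (B ^ p * S)) ^ (1 / p), fun h hm hD htop => le_mul_of_rpow_le hp ?_⟩
  have hshift : ∀ m : ℕ,
      eLpNorm (fun x => w x * (h (x - σ * m) * X (x - σ * m))) r volume ≤
        B * E (-(δ * m)) * eLpNorm (fun x => w x * (h x * X x)) r volume := by
    intro m
    have h2 := eLpNorm_translate (fun x => w x * (h x * X x)) r univ (-(σ * m))
    simp only [preimage_univ, Measure.restrict_univ, ← sub_eq_add_neg] at h2
    rw [← h2]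
    refine eLpNorm_le_const_mul (ENNReal.mul_ne_top ENNReal.coe_ne_top (E_ne_top _))
      (.of_forall fun x => ?_)
    rw [← mul_assoc (B * E (-(δ * m)))]
    exact mul_le_mul_left (hdecay x m) _
  calc eLpNorm (fun x => w x * Φ ((side σ x).indicator h)) r volume ^ p
      ≤ M * C * ∑' m : ℕ,
          eLpNorm (fun x => w x * (h (x - σ * m) * X (x - σ * m))) r volume ^ p :=
        hM volume C _ (fun m x => h (x - σ * m) * X (x - σ * m))
          (fun m => (hm.comp (measurable_id.sub_const _)).mul
            (hXm.comp (measurable_id.sub_const _)))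
          (.of_forall fun x => hC h hD htop x)
    _ ≤ M * C * ∑' m : ℕ,
          (B * E (-(δ * m)) * eLpNorm (fun x => w x * (h x * X x)) r volume) ^ p := by
        gcongr with m; exact hshift m
    _ = M * C * (B ^ p * (∑' m : ℕ, E (-(δ * m)) ^ p) *
          eLpNorm (fun x => w x * (h x * X x)) r volume ^ p) := by
        simp_rw [ENNReal.mul_rpow_of_nonneg _ _ hp.le, ENNReal.tsum_mul_right,
          ENNReal.tsum_mul_left]
    _ ≤ M * C * (B ^ p * S * eLpNorm (fun x => w x * (h x * X x)) r volume ^ p) := by gcongr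
    _ = _ := by rw [← ENNReal.coe_rpow_of_nonneg _ hp.le]; push_cast; ring

/-! ### The iterated quasi-norms -/

/-- The quasi-norm `‖b(s) ‖a(u) g(u)‖_{q, (-∞, s)}‖_{r, ℝ}`, which is the quasi-norm of the limiting
`L`-spaces in the logarithmic variable. -/
def iterNorm (r : ℝ≥0∞) (b : ℝ → ℝ≥0∞) (q : ℝ≥0∞) (a : ℝ → ℝ≥0∞) (g : ℝ → ℝ≥0∞) : ℝ≥0∞ :=
  eLpNorm (fun s => b s * eLpNorm (fun u => a u * g u) q (volume.restrict (Iio s))) r volume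

lemma measurable_eLpNorm_Iio (q : ℝ≥0∞) (F : ℝ → ℝ≥0∞) :
    Measurable fun s => eLpNorm F q (volume.restrict (Iio s)) :=
  Monotone.measurable fun _ _ h =>
    eLpNorm_mono_measure _ (Measure.restrict_mono (Iio_subset_Iio h) le_rfl)

lemma iterNorm_admissible {p : ℝ} (hp : 0 < p) {r q : ℝ≥0∞} (hr : ENNReal.ofReal p ≤ r)
    (hq : ENNReal.ofReal p ≤ q) {b a : ℝ → ℝ≥0∞} (hb : Potter b) (ha : Potter a) :
    Admissible p (iterNorm r b q a) where
  mono_ae g h H := by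
    refine eLpNorm_mono_ennreal (.of_forall fun s => ?_)
    gcongr
    refine eLpNorm_mono_ennreal (ae_restrict_of_ae ?_)
    filter_upwards [H] with u hu
    gcongr
  const_mul_le c g hc := by
    refine eLpNorm_le_const_mul hc (.of_forall fun s => ?_)
    rw [mul_left_comm]
    gcongr
    exact eLpNorm_le_const_mul hc (.of_forall fun u => by rw [mul_left_comm])
  add_le := by
    obtain ⟨C, hC⟩ := ha.controlled.eLpNorm_add_le q
    obtain ⟨D, hD⟩ := hb.controlled.eLpNorm_add_le r
    refine ⟨C * D, fun g h hg hh => ?_⟩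
    calc iterNorm r b q a (fun u => g u + h u)
        ≤ C * eLpNorm (fun s => b s *
            (eLpNorm (fun u => a u * g u) q (volume.restrict (Iio s)) +
              eLpNorm (fun u => a u * h u) q (volume.restrict (Iio s)))) r volume := by
          refine eLpNorm_le_const_mul ENNReal.coe_ne_top (.of_forall fun s => ?_)
          rw [mul_left_comm]
          gcongr
          exact hC _ g h hg hh
      _ ≤ C * (D * (iterNorm r b q a g + iterNorm r b q a h)) := by
          gcongr
          exact hD _ _ _ (measurable_eLpNorm_Iio _ _) (measurable_eLpNorm_Iio _ _)
      _ = _ := by push_cast; ring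
  rpow_le_tsum := by
    obtain ⟨C, hC⟩ := ha.controlled.eLpNorm_rpow_le_tsum hp hq
    obtain ⟨D, hD⟩ := hb.controlled.eLpNorm_rpow_le_tsum hp hr
    refine ⟨D * C, fun g F hF h => ?_⟩
    have := hD volume C _ (fun m s => eLpNorm (fun u => a u * F m u) q (volume.restrict (Iio s)))
      (fun m => measurable_eLpNorm_Iio _ _) (.of_forall fun s => by
        simpa using hC (volume.restrict (Iio s)) 1 g F hF (.of_forall fun u => by simpa using h u))
    push_cast
    exact this
  translate ε hε := by
    obtain ⟨C, hC⟩ := ha.bound (ε / 2) (by positivity)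
    obtain ⟨D, hD⟩ := hb.bound (ε / 2) (by positivity)
    refine ⟨D * C, fun d g => ?_⟩
    have hinner : ∀ s, eLpNorm (fun u => a u * g (u - d)) q (volume.restrict (Iio (s + d))) ≤
        C * E (ε / 2 * |d|) * eLpNorm (fun u => a u * g u) q (volume.restrict (Iio s)) := by
      intro s
      have h := eLpNorm_translate (fun u => a u * g (u - d)) q (Iio (s + d)) d
      rw [← h]
      have : (fun x => x + d) ⁻¹' Iio (s + d) = Iio s := by ext u; simp
      rw [this]
      refine eLpNorm_le_const_mul (ENNReal.mul_ne_top ENNReal.coe_ne_top (E_ne_top _))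
        (.of_forall fun u => ?_)
      rw [add_sub_cancel_right, ← mul_assoc]
      gcongr
      simpa using hC (u + d) u
    have h := eLpNorm_translate (fun s => b s * eLpNorm (fun u => a u * g (u - d)) q
      (volume.restrict (Iio s))) r univ d
    simp only [preimage_univ, Measure.restrict_univ] at h
    rw [iterNorm, ← h]
    have e : (↑(D * C) : ℝ≥0∞) * E (ε * |d|) =
        (D * E (ε / 2 * |d|)) * (C * E (ε / 2 * |d|)) := by
      rw [show ε * |d| = ε / 2 * |d| + ε / 2 * |d| by ring, E_add]; push_cast; ring
    rw [e]
    refine eLpNorm_le_const_mul (ENNReal.mul_ne_top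
      (ENNReal.mul_ne_top ENNReal.coe_ne_top (E_ne_top _))
      (ENNReal.mul_ne_top ENNReal.coe_ne_top (E_ne_top _))) (.of_forall fun s => ?_)
    calc b (s + d) * eLpNorm (fun u => a u * g (u - d)) q (volume.restrict (Iio (s + d)))
        ≤ (D * E (ε / 2 * |d|) * b s) * (C * E (ε / 2 * |d|) *
            eLpNorm (fun u => a u * g u) q (volume.restrict (Iio s))) := by
          gcongr
          · simpa using hD (s + d) s
          · exact hinner s
      _ = _ := by ring

/-! ### Change of variables along almost-translations -/

/-- A function that differs from the identity by a coarsely `1/2`-Lipschitz function is within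
bounded distance of a bi-Lipschitz bijection of the line. The `1/2`-Lipschitz part is the
inf-convolution with `|·| / 2`. -/
lemma exists_bilipschitz_near {φ : ℝ → ℝ} {c : ℝ}
    (hφ : ∀ x y, |φ x - φ y - (x - y)| ≤ 1 / 2 * |x - y| + c) :
    ∃ T : ℝ → ℝ, LipschitzWith 2 T ∧ AntilipschitzWith 2 T ∧ Function.Surjective T ∧
      ∀ x, |T x - φ x| ≤ c := by
  set η : ℝ → ℝ := fun x => φ x - x with hη
  have hηd : ∀ x y, |η x - η y| ≤ 1 / 2 * |x - y| + c := by
    intro x y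
    have := hφ x y
    rwa [show φ x - φ y - (x - y) = η x - η y by simp only [hη]; ring] at this
  set ζ : ℝ → ℝ := fun x => ⨅ y, (η y + 1 / 2 * |x - y|) with hζ
  have hlow : ∀ x y, η x - c ≤ η y + 1 / 2 * |x - y| := fun x y => by
    have := (abs_le.1 (hηd x y)).2; linarith
  have hbdd : ∀ x, BddBelow (range fun y => η y + 1 / 2 * |x - y|) := fun x =>
    ⟨η x - c, by rintro _ ⟨y, rfl⟩; exact hlow x y⟩
  have hge : ∀ x, η x - c ≤ ζ x := fun x => le_ciInf (hlow x)
  have hle : ∀ x, ζ x ≤ η x := fun x => (ciInf_le (hbdd x) x).trans (by simp)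
  have hlip : ∀ x y, ζ x - ζ y ≤ 1 / 2 * |x - y| := by
    intro x y
    have : ζ x - 1 / 2 * |x - y| ≤ ζ y := by
      refine le_ciInf fun z => ?_
      have h1 : ζ x ≤ η z + 1 / 2 * |x - z| := ciInf_le (hbdd x) z
      have h2 := abs_sub_le x y z
      linarith
    linarith
  have hlip' : ∀ x y, |ζ x - ζ y| ≤ 1 / 2 * |x - y| := fun x y => abs_le.2
    ⟨by have := hlip y x; rw [abs_sub_comm] at this; linarith, hlip x y⟩
  have hL : LipschitzWith 2 fun x => x + ζ x := by
    refine LipschitzWith.of_dist_le_mul fun x y => ?_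
    rw [Real.dist_eq, Real.dist_eq, show x + ζ x - (y + ζ y) = (x - y) + (ζ x - ζ y) by ring]
    have := abs_add_le (x - y) (ζ x - ζ y)
    have := hlip' x y
    have := abs_nonneg (x - y)
    norm_num
    linarith
  refine ⟨fun x => x + ζ x, hL, ?_, ?_, fun x => ?_⟩
  · refine AntilipschitzWith.of_le_mul_dist fun x y => ?_
    rw [Real.dist_eq, Real.dist_eq, show x + ζ x - (y + ζ y) = (x - y) + (ζ x - ζ y) by ring]
    have := abs_sub_abs_le_abs_sub (x - y) (-(ζ x - ζ y))
    rw [abs_neg, sub_neg_eq_add] at this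
    have := hlip' x y
    norm_num
    linarith
  · refine hL.continuous.surjective ?_ ?_
    · refine Filter.tendsto_atTop_mono' _ (f₁ := fun x => 1 / 2 * x + ζ 0) ?_ ?_
      · filter_upwards [Filter.eventually_ge_atTop 0] with x hx
        have := (abs_le.1 (hlip' x 0)).1
        rw [sub_zero, abs_of_nonneg hx] at this
        linarith
      · exact Filter.tendsto_atTop_add_const_right _ _
          (Filter.Tendsto.const_mul_atTop (by norm_num) Filter.tendsto_id)
    · refine Filter.tendsto_atBot_mono' _ (f₁ := fun x => 1 / 2 * x + ζ 0) ?_ ?_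
      · filter_upwards [Filter.eventually_le_atBot 0] with x hx
        have := (abs_le.1 (hlip' x 0)).2
        rw [sub_zero, abs_of_nonpos hx] at this
        linarith
      · exact Filter.tendsto_atBot_add_const_right _ _
          (Filter.Tendsto.const_mul_atBot (by norm_num) Filter.tendsto_id)
  · have h1 := hge x
    have h2 := hle x
    rw [show x + ζ x - φ x = ζ x - η x by simp only [hη]; ring, abs_le]
    -- the case `y = x` of the hypothesis gives `0 ≤ c`
    constructor <;> linarith [abs_nonneg (φ x - φ x - (x - x)), hφ x x]

lemma map_le_of_antilipschitz {T : ℝ → ℝ} {C : ℝ≥0} (hT : AntilipschitzWith C T)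
    (hm : Measurable T) : Measure.map T volume ≤ (C : ℝ≥0∞) • volume := by
  refine Measure.le_iff.2 fun s hs => ?_
  rw [Measure.map_apply hm hs, Measure.smul_apply, smul_eq_mul, ← hausdorffMeasure_real]
  simpa using hT.hausdorffMeasure_preimage_le zero_le_one s

lemma le_map_of_lipschitz {T : ℝ → ℝ} {C : ℝ≥0} (hT : LipschitzWith C T)
    (hs : Function.Surjective T) : volume ≤ (C : ℝ≥0∞) • Measure.map T volume := by
  refine Measure.le_iff.2 fun s hs' => ?_
  rw [Measure.smul_apply, Measure.map_apply hT.continuous.measurable hs', smul_eq_mul,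
    ← hausdorffMeasure_real]
  have := hT.hausdorffMeasure_image_le zero_le_one (T ⁻¹' s)
  rw [image_preimage_eq _ hs] at this
  simpa using this

/-- Substituting an almost-translation does not change the `L_r` quasi-norm of a controlled
function, up to a constant depending only on the control. -/
lemma exists_eLpNorm_comp_equiv {φ : ℝ → ℝ} {c : ℝ}
    (hφ : ∀ x y, |φ x - φ y - (x - y)| ≤ 1 / 2 * |x - y| + c) (r : ℝ≥0∞) (D : ℝ≥0) :
    ∃ C : ℝ≥0, ∀ F : ℝ → ℝ≥0∞, (∀ x y, |x - y| ≤ max c 1 → F x ≤ D * F y) →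
      eLpNorm (fun x => F (φ x)) r volume ≤ C * eLpNorm F r volume ∧
      eLpNorm F r volume ≤ C * eLpNorm (fun x => F (φ x)) r volume := by
  obtain ⟨T, hT1, hT2, hT3, hT4⟩ := exists_bilipschitz_near hφ
  have hTm := hT1.continuous.measurable
  have hK : ((2 : ℝ≥0) : ℝ≥0∞) ^ (1 / r).toReal ≠ ∞ :=
    ENNReal.rpow_ne_top_of_nonneg ENNReal.toReal_nonneg ENNReal.coe_ne_top
  set K : ℝ≥0 := (((2 : ℝ≥0) : ℝ≥0∞) ^ (1 / r).toReal).toNNReal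
  have hKc : (K : ℝ≥0∞) = ((2 : ℝ≥0) : ℝ≥0∞) ^ (1 / r).toReal := ENNReal.coe_toNNReal hK
  refine ⟨D * D * K * D, fun F hF => ?_⟩
  obtain ⟨G, hG, hFG⟩ := exists_measurable_of_unit_le
    fun x y h => hF x y (h.trans (le_max_right _ _))
  have hle : ∀ (μ : Measure ℝ) (A B : ℝ → ℝ≥0∞), (∀ x, A x ≤ D * B x) →
      eLpNorm A r μ ≤ D * eLpNorm B r μ := fun μ A B h =>
    eLpNorm_le_const_mul ENNReal.coe_ne_top (.of_forall h)
  have hmap : eLpNorm (fun x => G (T x)) r volume = eLpNorm G r (Measure.map T volume) :=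
    (eLpNorm_map_measure hG.aestronglyMeasurable hTm.aemeasurable).symm
  have hcmp : ∀ μ ν : Measure ℝ, μ ≤ ((2 : ℝ≥0) : ℝ≥0∞) • ν →
      eLpNorm G r μ ≤ K * eLpNorm G r ν := by
    intro μ ν h
    rw [hKc]
    exact (eLpNorm_mono_measure _ h).trans (eLpNorm_smul_measure_le _ _ _ _)
  have hTφ : ∀ x, |T x - φ x| ≤ max c 1 := fun x => (hT4 x).trans (le_max_left _ _)
  constructor
  · calc eLpNorm (fun x => F (φ x)) r volume
        ≤ D * (D * (K * (D * eLpNorm F r volume))) := by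
          refine (hle _ _ (fun x => F (T x)) fun x => hF _ _ ?_).trans ?_
          · rw [abs_sub_comm]; exact hTφ x
          gcongr
          refine (hle _ _ (fun x => G (T x)) fun x => (hFG _).1).trans ?_
          gcongr
          rw [hmap]
          refine (hcmp _ _ (map_le_of_antilipschitz hT2 hTm)).trans ?_
          gcongr
          exact hle _ _ _ fun x => (hFG _).2
      _ = _ := by push_cast; ring
  · calc eLpNorm F r volume
        ≤ D * (K * (D * (D * eLpNorm (fun x => F (φ x)) r volume))) := by
          refine (hle _ _ G fun x => (hFG _).1).trans ?_
          gcongr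
          refine (hcmp _ _ (le_map_of_lipschitz hT1 hT3)).trans ?_
          gcongr
          rw [← hmap]
          refine (hle _ _ (fun x => F (T x)) fun x => (hFG _).2).trans ?_
          gcongr
          exact hle _ _ _ fun x => hF _ _ (hTφ x)
      _ = _ := by push_cast; ring

/-! ### The logarithmic variable -/

/-- A weight on `(0, ∞)` in the logarithmic variable. -/
def lw (b : ℝ → ℝ) (x : ℝ) : ℝ≥0∞ := ENNReal.ofReal (b (Real.exp x))

lemma volume_preimage_exp_eq_zero_iff {S : Set ℝ} (hS : S ⊆ Ioi 0) :
    volume (Real.exp ⁻¹' S) = 0 ↔ volume S = 0 := by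
  have e1 : Real.exp ⁻¹' S = Real.log '' S := by
    ext x
    constructor
    · intro hx; exact ⟨Real.exp x, hx, Real.log_exp x⟩
    · rintro ⟨y, hy, rfl⟩
      simpa [Real.exp_log (hS hy)] using hy
  have e2 : S = Real.exp '' (Real.exp ⁻¹' S) := by
    rw [image_preimage_eq_of_subset]
    rw [Real.range_exp]; exact hS
  constructor
  · intro h
    rw [e2]
    exact addHaar_image_eq_zero_of_differentiableOn_of_addHaar_eq_zero volume
      Real.differentiable_exp.differentiableOn h
  · intro h
    rw [e1]
    refine addHaar_image_eq_zero_of_differentiableOn_of_addHaar_eq_zero volume ?_ h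
    exact Real.differentiableOn_log.mono fun x hx => (hS hx).ne'

lemma ae_restrict_exp_iff {I : Set ℝ} (hI : MeasurableSet I) (hI0 : I ⊆ Ioi 0) {P : ℝ → Prop} :
    (∀ᵐ x ∂volume.restrict (Real.exp ⁻¹' I), P (Real.exp x)) ↔ ∀ᵐ u ∂volume.restrict I, P u := by
  rw [ae_restrict_iff' hI, ae_restrict_iff' (Real.measurable_exp hI), ae_iff, ae_iff]
  have : {x | ¬(x ∈ Real.exp ⁻¹' I → P (Real.exp x))} = Real.exp ⁻¹' {u | ¬(u ∈ I → P u)} := rfl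
  rw [this]
  refine volume_preimage_exp_eq_zero_iff fun u hu => hI0 ?_
  by_contra h
  exact hu fun h' => absurd h' h

/-- The weighted norm on a subset of `(0, ∞)` in the logarithmic variable. -/
lemma wnorm_eq_log (q : ℝ≥0∞) {I : Set ℝ} (hI : MeasurableSet I) (hI0 : I ⊆ Ioi 0) (θ : ℝ)
    (b : ℝ → ℝ) (g : ℝ → ℝ≥0∞) :
    wnorm q I θ b g = eLpNorm (fun x => E (-θ * x) * lw b x * g (Real.exp x)) q
      (volume.restrict (Real.exp ⁻¹' I)) := by
  have hpow : ∀ x c : ℝ, ENNReal.ofReal (Real.exp x ^ c * b (Real.exp x)) = E (c * x) * lw b x := by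
    intro x c
    rw [ENNReal.ofReal_mul (by positivity), ← Real.exp_mul, mul_comm x c]
    rfl
  by_cases h0 : q = 0
  · simp [wnorm, h0]
  by_cases htop : q = ∞
  · subst htop
    have hF : ∀ x, E (-θ * x) * lw b x * g (Real.exp x) =
        ENNReal.ofReal (Real.exp x ^ (-θ - 1 / (∞ : ℝ≥0∞).toReal) * b (Real.exp x)) *
          g (Real.exp x) := by
      intro x
      rw [hpow]; simp
    simp only [wnorm, hF, eLpNorm_exponent_top, eLpNormEssSup_eq_essSup_enorm, enorm_eq_self]
    apply le_antisymm
    · refine essSup_le_of_ae_le _ ?_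
      exact (ae_restrict_exp_iff hI hI0 (P := fun u => ENNReal.ofReal
        (u ^ (-θ - 1 / (∞ : ℝ≥0∞).toReal) * b u) * g u ≤ _)).1 (ENNReal.ae_le_essSup _)
    · refine essSup_le_of_ae_le _ ?_
      exact (ae_restrict_exp_iff hI hI0 (P := fun u => ENNReal.ofReal
        (u ^ (-θ - 1 / (∞ : ℝ≥0∞).toReal) * b u) * g u ≤ _)).2 (ENNReal.ae_le_essSup _)
  · have hq : 0 < q.toReal := ENNReal.toReal_pos h0 htop
    rw [wnorm, eLpNorm_eq_lintegral_rpow_enorm_toReal h0 htop,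
      eLpNorm_eq_lintegral_rpow_enorm_toReal h0 htop]
    congr 1
    have himg : I = Real.exp '' (Real.exp ⁻¹' I) := by
      rw [image_preimage_eq_of_subset]
      rw [Real.range_exp]; exact hI0
    conv_lhs => rw [himg]
    rw [lintegral_image_eq_lintegral_abs_deriv_mul (Real.measurable_exp hI)
      (fun x _ => (Real.hasDerivAt_exp x).hasDerivWithinAt) Real.exp_injective.injOn]
    refine lintegral_congr fun x => ?_
    have hE : ENNReal.ofReal |Real.exp x| = E (1 / q.toReal * x) ^ q.toReal := by
      rw [E_rpow, abs_of_pos (Real.exp_pos x)]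
      rw [show 1 / q.toReal * x * q.toReal = x by field_simp]; rfl
    rw [hE, hpow, enorm_eq_self, enorm_eq_self, ← ENNReal.mul_rpow_of_nonneg _ _ hq.le,
      ← mul_assoc, ← mul_assoc, ← E_add]
    congr 4
    ring

lemma preimage_exp_Ioi_zero : Real.exp ⁻¹' Ioi 0 = univ := by ext x; simp [Real.exp_pos]
lemma preimage_exp_Ioi (t : ℝ) : Real.exp ⁻¹' Ioi (Real.exp t) = Ioi t := by ext x; simp
lemma preimage_exp_Ioo_zero (t : ℝ) : Real.exp ⁻¹' Ioo 0 (Real.exp t) = Iio t := by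
  ext x; simp [Real.exp_pos]
lemma preimage_exp_Ioo (s t : ℝ) : Real.exp ⁻¹' Ioo (Real.exp s) (Real.exp t) = Ioo s t := by
  ext x; simp

lemma wnorm_Ioi_zero (q : ℝ≥0∞) (θ : ℝ) (b : ℝ → ℝ) (g : ℝ → ℝ≥0∞) :
    wnorm q (Ioi 0) θ b g =
      eLpNorm (fun x => E (-θ * x) * lw b x * g (Real.exp x)) q volume := by
  rw [wnorm_eq_log q measurableSet_Ioi le_rfl, preimage_exp_Ioi_zero, Measure.restrict_univ]

lemma wnorm_Ioi_exp (q : ℝ≥0∞) (t θ : ℝ) (b : ℝ → ℝ) (g : ℝ → ℝ≥0∞) :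
    wnorm q (Ioi (Real.exp t)) θ b g =
      eLpNorm (fun x => E (-θ * x) * lw b x * g (Real.exp x)) q (volume.restrict (Ioi t)) := by
  rw [wnorm_eq_log q measurableSet_Ioi (Ioi_subset_Ioi (Real.exp_pos t).le), preimage_exp_Ioi]

lemma wnorm_Ioo_zero_exp (q : ℝ≥0∞) (t θ : ℝ) (b : ℝ → ℝ) (g : ℝ → ℝ≥0∞) :
    wnorm q (Ioo 0 (Real.exp t)) θ b g =
      eLpNorm (fun x => E (-θ * x) * lw b x * g (Real.exp x)) q (volume.restrict (Iio t)) := by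
  rw [wnorm_eq_log q measurableSet_Ioo Ioo_subset_Ioi_self, preimage_exp_Ioo_zero]

lemma wnorm_Ioo_exp (q : ℝ≥0∞) (s t θ : ℝ) (b : ℝ → ℝ) (g : ℝ → ℝ≥0∞) :
    wnorm q (Ioo (Real.exp s) (Real.exp t)) θ b g =
      eLpNorm (fun x => E (-θ * x) * lw b x * g (Real.exp x)) q (volume.restrict (Ioo s t)) := by
  rw [wnorm_eq_log q measurableSet_Ioo
    (Ioo_subset_Ioi_self.trans (Ioi_subset_Ioi (Real.exp_pos s).le)), preimage_exp_Ioo]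

lemma SlowlyVarying.potter_lw {b : ℝ → ℝ} (hb : SlowlyVarying b) : Potter (lw b) where
  ne_zero x := by simpa [lw] using hb.pos _ (Real.exp_pos x)
  ne_top x := ENNReal.ofReal_ne_top
  bound ε hε := by
    obtain ⟨g, hg, C, hC, hgC⟩ := hb.equiv_increasing ε hε
    obtain ⟨h, hh, D, hD, hhD⟩ := hb.equiv_decreasing ε hε
    refine ⟨(max (C * C) (D * D)).toNNReal, fun x y => ?_⟩
    rw [lw, lw, E, show ((max (C * C) (D * D)).toNNReal : ℝ≥0∞) =
      ENNReal.ofReal (max (C * C) (D * D)) from rfl,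
      ← ENNReal.ofReal_mul (by positivity), ← ENNReal.ofReal_mul (by positivity)]
    apply ENNReal.ofReal_le_ofReal
    have hby : 0 ≤ b (Real.exp y) := (hb.pos _ (Real.exp_pos y)).le
    have hex : ∀ z c : ℝ, Real.exp z ^ c = Real.exp (c * z) := fun z c => by
      rw [← Real.exp_mul, mul_comm]
    rcases le_total x y with hxy | hxy
    · have h1 := (hgC _ (Real.exp_pos x)).1
      have h2 := (hgC _ (Real.exp_pos y)).2
      have h3 := hg (Real.exp_pos x) (Real.exp_pos y) (Real.exp_le_exp.2 hxy)
      rw [hex] at h1 h2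
      have h4 : Real.exp (ε * x) * b (Real.exp x) ≤
          C * (C * (Real.exp (ε * y) * b (Real.exp y))) :=
        h1.trans (by gcongr; exact h3.trans h2)
      have h5 : Real.exp (ε * y) = Real.exp (ε * |x - y|) * Real.exp (ε * x) := by
        rw [← Real.exp_add, abs_of_nonpos (by linarith)]; ring_nf
      rw [h5] at h4
      have h6 : b (Real.exp x) ≤ C * C * Real.exp (ε * |x - y|) * b (Real.exp y) := by
        refine le_of_mul_le_mul_left ?_ (Real.exp_pos (ε * x))
        linarith
      refine h6.trans ?_
      gcongr
      exact le_max_left _ _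
    · have h1 := (hhD _ (Real.exp_pos x)).1
      have h2 := (hhD _ (Real.exp_pos y)).2
      have h3 := hh (Real.exp_pos y) (Real.exp_pos x) (Real.exp_le_exp.2 hxy)
      rw [hex] at h1 h2
      have h4 : Real.exp (-ε * x) * b (Real.exp x) ≤
          D * (D * (Real.exp (-ε * y) * b (Real.exp y))) :=
        h1.trans (by gcongr; exact h3.trans h2)
      have h5 : Real.exp (-ε * y) = Real.exp (ε * |x - y|) * Real.exp (-ε * x) := by
        rw [← Real.exp_add, abs_of_nonneg (by linarith)]; ring_nf
      rw [h5] at h4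
      have h6 : b (Real.exp x) ≤ D * D * Real.exp (ε * |x - y|) * b (Real.exp y) := by
        refine le_of_mul_le_mul_left ?_ (Real.exp_pos (-ε * x))
        linarith
      refine h6.trans ?_
      gcongr
      exact le_max_right _ _

/-! ### Half-line parts of the iterated quasi-norms -/

section iterNorm

variable {r q : ℝ≥0∞} {b a : ℝ → ℝ≥0∞}

lemma mul_indicator_eq (a g : ℝ → ℝ≥0∞) (S : Set ℝ) :
    (fun u => a u * S.indicator g u) = S.indicator fun u => a u * g u := by
  ext u
  by_cases hu : u ∈ S <;> simp [hu]

lemma eLpNorm_mul_indicator (a g : ℝ → ℝ≥0∞) (q : ℝ≥0∞) {S : Set ℝ} (hS : MeasurableSet S)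
    (T : Set ℝ) : eLpNorm (fun u => a u * S.indicator g u) q (volume.restrict T) =
      eLpNorm (fun u => a u * g u) q (volume.restrict (S ∩ T)) := by
  rw [mul_indicator_eq, eLpNorm_indicator_eq_eLpNorm_restrict hS, Measure.restrict_restrict hS]

lemma iterNorm_indicator_Ioi (g : ℝ → ℝ≥0∞) (x : ℝ) :
    iterNorm r b q a ((Ioi x).indicator g) = eLpNorm (fun s => b s *
      eLpNorm (fun u => a u * g u) q (volume.restrict (Ioo x s))) r (volume.restrict (Ioi x)) := by
  simp_rw [iterNorm, eLpNorm_mul_indicator a g q measurableSet_Ioi, Ioi_inter_Iio]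
  refine (eLpNorm_restrict_eq_of_support_subset fun s hs => ?_).symm
  by_contra h
  exact hs (by simp [Ioo_eq_empty (show ¬x < s from h)])

lemma Potter.eLpNorm_ne_zero {w : ℝ → ℝ≥0∞} (hw : Potter w) (hq : q ≠ 0) {S : Set ℝ}
    (hS : volume S ≠ 0) : eLpNorm w q (volume.restrict S) ≠ 0 := by
  intro h
  have := hw.controlled.ae_eq_zero hw.ne_zero hq (F := fun _ => 1) measurable_const
    (by simpa using h)
  simp only [one_ne_zero, Filter.eventually_false_iff_eq_bot, ae_eq_bot,
    Measure.restrict_eq_zero] at this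
  exact hS this

/-- The part of the iterated quasi-norm over a left half-line dominates the part of the outer
norm over the half-line. -/
lemma eLpNorm_Iio_le_iterNorm (g : ℝ → ℝ≥0∞) (x : ℝ) :
    eLpNorm (fun s => b s * eLpNorm (fun u => a u * g u) q (volume.restrict (Iio s))) r
      (volume.restrict (Iio x)) ≤ iterNorm r b q a ((Iio x).indicator g) := by
  refine le_trans ?_ (eLpNorm_mono_measure _ (Measure.restrict_le_self (s := Iio x)))
  refine eLpNorm_mono_ennreal ((ae_restrict_iff' measurableSet_Iio).2 (.of_forall fun s hs => ?_))
  rw [eLpNorm_mul_indicator a g q measurableSet_Iio, Iio_inter_Iio,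
    min_eq_right (le_of_lt hs)]

/-- The part of the iterated quasi-norm over a left half-line dominates the contribution of the
outer variable beyond the half-line, where the inner norm is constant. -/
lemma eLpNorm_Ioi_mul_le_iterNorm (g : ℝ → ℝ≥0∞) (x : ℝ) :
    eLpNorm b r (volume.restrict (Ioi x)) *
      eLpNorm (fun u => a u * g u) q (volume.restrict (Iio x)) ≤
        iterNorm r b q a ((Iio x).indicator g) := by
  refine ENNReal.mul_le_of_forall_lt fun β hβ c hc => ?_
  have hc' : c ≠ ∞ := (hc.trans_le le_top).ne
  have hmain : eLpNorm (fun s => c * b s) r (volume.restrict (Ioi x)) ≤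
      iterNorm r b q a ((Iio x).indicator g) := by
    refine le_trans ?_ (eLpNorm_mono_measure _ (Measure.restrict_le_self (s := Ioi x)))
    refine eLpNorm_mono_ennreal ((ae_restrict_iff' measurableSet_Ioi).2
      (.of_forall fun s hs => ?_))
    rw [eLpNorm_mul_indicator a g q measurableSet_Iio, Iio_inter_Iio, min_eq_left (le_of_lt hs),
      mul_comm]
    gcongr
  rcases eq_or_ne c 0 with rfl | h0
  · simp
  · rw [eLpNorm_const_mul_ennreal _ hc' h0] at hmain
    refine le_trans ?_ hmain
    rw [mul_comm]
    gcongr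

/-- Splitting the outer norm of the iterated quasi-norm over a left half-line. -/
lemma exists_iterNorm_Iio_le (hb : Potter b) (hr : r ≠ 0) : ∃ C : ℝ≥0,
    ∀ (g : ℝ → ℝ≥0∞) (x : ℝ), iterNorm r b q a ((Iio x).indicator g) ≤
      C * (eLpNorm (fun s => b s * eLpNorm (fun u => a u * g u) q (volume.restrict (Iio s))) r
          (volume.restrict (Iio x)) +
        eLpNorm b r (volume.restrict (Ioi x)) *
          eLpNorm (fun u => a u * g u) q (volume.restrict (Iio x))) := by
  obtain ⟨C, hC⟩ := hb.controlled.eLpNorm_add_le r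
  refine ⟨C + 1, fun g x => ?_⟩
  set I := eLpNorm (fun u => a u * g u) q (volume.restrict (Iio x)) with hI
  set J : ℝ → ℝ≥0∞ := fun s => eLpNorm (fun u => a u * g u) q (volume.restrict (Iio s)) with hJ
  have hJm : Measurable J := measurable_eLpNorm_Iio _ _
  have hβ := hb.eLpNorm_ne_zero hr (S := Ioi x) (by simp)
  by_cases htop : I = ∞
  · rw [htop, ENNReal.mul_top hβ, add_top, ENNReal.mul_top (by positivity)]
    exact le_top
  have h1 : iterNorm r b q a ((Iio x).indicator g) ≤
      eLpNorm (fun s => b s * ((Iic x).indicator J s + (Ioi x).indicator (fun _ => I) s)) r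
        volume := by
    refine eLpNorm_mono_ennreal (.of_forall fun s => ?_)
    rw [eLpNorm_mul_indicator a g q measurableSet_Iio, Iio_inter_Iio]
    gcongr
    rcases le_or_gt s x with h | h
    · rw [min_eq_right h, indicator_of_mem (show s ∈ Iic x from h)]
      exact le_self_add
    · rw [min_eq_left h.le, indicator_of_mem (show s ∈ Ioi x from h)]
      exact le_add_self
  refine h1.trans ((hC volume _ _ (hJm.indicator measurableSet_Iic)
    (measurable_const.indicator measurableSet_Ioi)).trans ?_)
  gcongr
  · simp
  · rw [mul_indicator_eq, eLpNorm_indicator_eq_eLpNorm_restrict measurableSet_Iic,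
      Measure.restrict_congr_set Iio_ae_eq_Iic]
  · rw [mul_indicator_eq, eLpNorm_indicator_eq_eLpNorm_restrict measurableSet_Ioi, mul_comm]
    exact eLpNorm_le_const_mul htop (.of_forall fun s => by rw [mul_comm])

lemma iterNorm_indicator_ne_zero (hb : Potter b) (ha : Potter a) (hr : r ≠ 0) (hq : q ≠ 0)
    {S : Set ℝ} (hS : MeasurableSet S) {t : ℝ} (ht : volume (S ∩ Iio t) ≠ 0) :
    iterNorm r b q a (S.indicator fun _ => 1) ≠ 0 := by
  intro h
  have h1 := hb.controlled.ae_eq_zero hb.ne_zero hr (measurable_eLpNorm_Iio _ _) h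
  have h2 : ∀ᵐ s, s ∉ Ioi t := by
    filter_upwards [h1] with s hs hst
    rw [eLpNorm_mul_indicator a _ q hS] at hs
    simp only [mul_one] at hs
    refine ha.eLpNorm_ne_zero hq (fun h0 => ht (measure_mono_null ?_ h0)) hs
    exact inter_subset_inter_right _ (Iio_subset_Iio (le_of_lt hst))
  have h3 : volume (Ioi t) = 0 := by
    simpa only [ae_iff, not_not, ofPred_mem_eq] using h2
  simp at h3

/-- Finiteness of the iterated quasi-norm of the indicator of a right half-line contains finiteness
of the outer weight at infinity. -/
lemma eLpNorm_Ioi_ne_top (ha : Potter a) (hq : q ≠ 0) {x : ℝ}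
    (h : iterNorm r b q a ((Ioi x).indicator fun _ => 1) ≠ ∞) :
    eLpNorm b r (volume.restrict (Ioi (x + 1))) ≠ ∞ := by
  rw [iterNorm_indicator_Ioi] at h
  simp only [mul_one] at h
  set c := min 1 (eLpNorm a q (volume.restrict (Ioo x (x + 1)))) with hc
  have hc0 : c ≠ 0 := by
    have := ha.eLpNorm_ne_zero hq (S := Ioo x (x + 1)) (by simp)
    rw [hc]
    simp only [ne_eq, min_eq_iff, not_or, not_and]
    exact ⟨fun h => absurd h one_ne_zero, fun h => absurd h this⟩
  have hctop : c ≠ ∞ := ne_top_of_le_ne_top ENNReal.one_ne_top (min_le_left _ _)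
  have h1 : eLpNorm b r (volume.restrict (Ioi (x + 1))) ≤ c⁻¹ *
      eLpNorm (fun s => b s * eLpNorm a q (volume.restrict (Ioo x s))) r
        (volume.restrict (Ioi (x + 1))) := by
    refine eLpNorm_le_const_mul (ENNReal.inv_ne_top.2 hc0)
      ((ae_restrict_iff' measurableSet_Ioi).2 (.of_forall fun s hs => ?_))
    calc b s = c⁻¹ * (b s * c) := by
          rw [mul_left_comm, ENNReal.inv_mul_cancel hc0 hctop, mul_one]
      _ ≤ _ := by
          gcongr
          refine (min_le_right _ _).trans (eLpNorm_mono_measure _ (Measure.restrict_mono ?_ le_rfl))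
          exact Ioo_subset_Ioo_right (le_of_lt hs)
  refine ne_top_of_le_ne_top (ENNReal.mul_ne_top (ENNReal.inv_ne_top.2 hc0) ?_) h1
  refine ne_top_of_le_ne_top h (eLpNorm_mono_measure _ (Measure.restrict_mono ?_ le_rfl))
  exact Ioi_subset_Ioi (by linarith)

lemma Potter.eLpNorm_Iio_ne_top {w : ℝ → ℝ≥0∞} (hw : Potter w) {s : ℝ}
    (h : eLpNorm w q (volume.restrict (Iio s)) ≠ ∞) (t : ℝ) :
    eLpNorm w q (volume.restrict (Iio t)) ≠ ∞ := by
  obtain ⟨C, hC⟩ := hw.controlled |t - s|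
  have h1 := eLpNorm_translate w q (Iio t) (t - s)
  have h2 : (fun x => x + (t - s)) ⁻¹' Iio t = Iio s := by ext u; simp
  rw [h2] at h1
  rw [← h1]
  refine ne_top_of_le_ne_top (ENNReal.mul_ne_top ENNReal.coe_ne_top h)
    (eLpNorm_le_const_mul ENNReal.coe_ne_top (c := C) (.of_forall fun x => ?_))
  exact hC _ _ (by simp)

/-- Finiteness of the iterated quasi-norm of the indicator of a left half-line. -/
lemma iterNorm_Iio_ne_top (hb : Potter b) (ha : Potter a) (hr : r ≠ 0) (x : ℝ)
    (h1 : eLpNorm b r (volume.restrict (Ioi x)) ≠ ∞)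
    (h2 : eLpNorm (fun s => b s * eLpNorm a q (volume.restrict (Iio s))) r
      (volume.restrict (Iio x)) ≠ ∞) :
    iterNorm r b q a ((Iio x).indicator fun _ => 1) ≠ ∞ := by
  obtain ⟨C, hC⟩ := exists_iterNorm_Iio_le (q := q) (a := a) hb hr
  have h3 := hb.controlled.ae_lt_top hb.ne_zero hr (measurable_eLpNorm_Iio _ _) h2
  have hne : (ae (volume.restrict (Iio x))).NeBot := by
    rw [ae_neBot]; simp
  obtain ⟨s, hs⟩ := h3.exists
  have h4 := ha.eLpNorm_Iio_ne_top hs x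
  refine ne_top_of_le_ne_top ?_ (hC _ x)
  simp only [mul_one]
  exact ENNReal.mul_ne_top ENNReal.coe_ne_top
    (ENNReal.add_ne_top.2 ⟨h2, ENNReal.mul_ne_top h1 h4⟩)

lemma iterNorm_potter_Ioi {p : ℝ} (hΦ : Admissible p (iterNorm r b q a)) (hb : Potter b)
    (ha : Potter a) (hr : r ≠ 0) (hq : q ≠ 0) {x : ℝ}
    (h : iterNorm r b q a ((Ioi x).indicator fun _ => 1) ≠ ∞) :
    Potter fun t => iterNorm r b q a ((Ioi t).indicator fun _ => 1) := by
  have e : ∀ t : ℝ, (fun u => (Ioi (0 : ℝ)).indicator (fun _ => (1 : ℝ≥0∞)) (u - t)) =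
      (Ioi t).indicator fun _ => 1 := fun t => by ext u; simp [indicator]
  have := hΦ.potter ((Ioi 0).indicator fun _ => 1)
  simp only [e] at this
  refine this (fun t => ?_) ⟨x, h⟩
  exact iterNorm_indicator_ne_zero hb ha hr hq measurableSet_Ioi (t := t + 1)
    (by simp [Ioi_inter_Iio])

lemma iterNorm_potter_Iio {p : ℝ} (hΦ : Admissible p (iterNorm r b q a)) (hb : Potter b)
    (ha : Potter a) (hr : r ≠ 0) (hq : q ≠ 0) {x : ℝ}
    (h : iterNorm r b q a ((Iio x).indicator fun _ => 1) ≠ ∞) :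
    Potter fun t => iterNorm r b q a ((Iio t).indicator fun _ => 1) := by
  have e : ∀ t : ℝ, (fun u => (Iio (0 : ℝ)).indicator (fun _ => (1 : ℝ≥0∞)) (u - t)) =
      (Iio t).indicator fun _ => 1 := fun t => by ext u; simp [indicator]
  have := hΦ.potter ((Iio 0).indicator fun _ => 1)
  simp only [e] at this
  refine this (fun t => ?_) ⟨x, h⟩
  exact iterNorm_indicator_ne_zero hb ha hr hq measurableSet_Iio (t := t)
    (by simp)

end iterNorm

/-! ### The `K`-functional -/

section KFunctional

variable {V : Type*} [AddCommGroup V]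

/-- The properties of an extended quasi-norm used for the `K`-functional. -/
structure IsQuasiNorm (N : V → ℝ≥0∞) : Prop where
  zero : N 0 = 0
  neg : ∀ f, N (-f) = N f
  add_le : ∃ C : ℝ≥0, ∀ f g, N (f + g) ≤ C * (N f + N g)

lemma QuasiBanachSubspace.isQuasiNorm {𝕜 V : Type*} [RCLike 𝕜] [AddCommGroup V] [Module 𝕜 V]
    [TopologicalSpace V] (A : QuasiBanachSubspace 𝕜 V) : IsQuasiNorm A.qnorm where
  zero := by simpa using A.qnorm_smul 0 0
  neg f := by simpa using A.qnorm_smul (-1) f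
  add_le := A.qnorm_add

/-- The `K`-functional in the logarithmic variable. -/
def logK (N₀ N₁ : V → ℝ≥0∞) (f : V) (x : ℝ) : ℝ≥0∞ := K N₀ N₁ (Real.exp x) f

variable {N₀ N₁ : V → ℝ≥0∞}

lemma logK_le (f₀ f₁ : V) (x : ℝ) : logK N₀ N₁ (f₀ + f₁) x ≤ N₀ f₀ + E x * N₁ f₁ :=
  iInf_le_of_le f₀ (iInf_le_of_le f₁ (iInf_le _ rfl))

lemma le_logK {f : V} {x : ℝ} {c : ℝ≥0∞} (h : ∀ f₀ f₁, f₀ + f₁ = f → c ≤ N₀ f₀ + E x * N₁ f₁) :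
    c ≤ logK N₀ N₁ f x :=
  le_iInf fun f₀ => le_iInf fun f₁ => le_iInf fun h' => h f₀ f₁ h'

lemma logK_mono (f : V) : Monotone (logK N₀ N₁ f) := fun x y hxy => le_logK fun f₀ f₁ h => by
  rw [← h]
  refine (logK_le f₀ f₁ x).trans ?_
  gcongr
  exact E_mono hxy

lemma logK_le_mul (f : V) {x y : ℝ} (h : y ≤ x) : logK N₀ N₁ f x ≤ E (x - y) * logK N₀ N₁ f y := by
  have : E (y - x) * logK N₀ N₁ f x ≤ logK N₀ N₁ f y := le_logK fun f₀ f₁ h' => by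
    rw [← h']
    calc E (y - x) * logK N₀ N₁ (f₀ + f₁) x ≤ E (y - x) * (N₀ f₀ + E x * N₁ f₁) := by
          gcongr; exact logK_le _ _ _
      _ = E (y - x) * N₀ f₀ + E y * N₁ f₁ := by
          rw [mul_add, ← mul_assoc, ← E_add]; simp
      _ ≤ 1 * N₀ f₀ + E y * N₁ f₁ := by
          gcongr; rw [← E_zero]; exact E_mono (by linarith)
      _ = _ := by rw [one_mul]
  calc logK N₀ N₁ f x = E (x - y) * (E (y - x) * logK N₀ N₁ f x) := by
        rw [← mul_assoc, ← E_add]; simp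
    _ ≤ _ := by gcongr

lemma logK_le_of_dist_le (f : V) {L x y : ℝ} (h : |x - y| ≤ L) :
    logK N₀ N₁ f x ≤ E L * logK N₀ N₁ f y := by
  have hL : 0 ≤ L := (abs_nonneg _).trans h
  rcases le_total x y with hxy | hxy
  · calc logK N₀ N₁ f x ≤ 1 * logK N₀ N₁ f y := by rw [one_mul]; exact logK_mono f hxy
      _ ≤ _ := by gcongr; exact one_le_E hL
  · refine (logK_le_mul f hxy).trans ?_
    gcongr
    exact E_mono ((le_abs_self _).trans h)

lemma logK_ne_top {f : V} {x : ℝ} (h : logK N₀ N₁ f x ≠ ∞) (y : ℝ) : logK N₀ N₁ f y ≠ ∞ :=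
  ne_top_of_le_ne_top (ENNReal.mul_ne_top (E_ne_top _) h) (logK_le_of_dist_le f le_rfl)

lemma E_neg_mul_logK_anti (f : V) {x y : ℝ} (h : y ≤ x) :
    E (-x) * logK N₀ N₁ f x ≤ E (-y) * logK N₀ N₁ f y := by
  calc E (-x) * logK N₀ N₁ f x ≤ E (-x) * (E (x - y) * logK N₀ N₁ f y) := by
        gcongr; exact logK_le_mul f h
    _ = _ := by rw [← mul_assoc, ← E_add]; ring_nf

lemma measurable_logK (f : V) : Measurable (logK N₀ N₁ f) := (logK_mono f).measurable

lemma measurable_E_neg_mul_logK (f : V) : Measurable fun u => E (-u) * logK N₀ N₁ f u :=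
  (measurable_E.comp measurable_neg).mul (measurable_logK f)

lemma logK_le_left (h₁ : IsQuasiNorm N₁) (f : V) (x : ℝ) : logK N₀ N₁ f x ≤ N₀ f := by
  have := logK_le (N₀ := N₀) (N₁ := N₁) f 0 x
  simpa [h₁.zero] using this

lemma logK_le_right (h₀ : IsQuasiNorm N₀) (f : V) (x : ℝ) : logK N₀ N₁ f x ≤ E x * N₁ f := by
  have := logK_le (N₀ := N₀) (N₁ := N₁) 0 f x
  simpa [h₀.zero] using this

lemma logK_zero (h₀ : IsQuasiNorm N₀) (h₁ : IsQuasiNorm N₁) : logK N₀ N₁ 0 = fun _ => 0 := by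
  ext x
  have := logK_le_left (N₀ := N₀) h₁ 0 x
  rw [h₀.zero] at this
  simpa using this

lemma logK_neg (h₀ : IsQuasiNorm N₀) (h₁ : IsQuasiNorm N₁) (f : V) (x : ℝ) :
    logK N₀ N₁ (-f) x ≤ logK N₀ N₁ f x := le_logK fun f₀ f₁ h => by
  rw [← h, neg_add]
  refine (logK_le _ _ x).trans ?_
  rw [h₀.neg, h₁.neg]

lemma exists_logK_add_le (h₀ : IsQuasiNorm N₀) (h₁ : IsQuasiNorm N₁) :
    ∃ C : ℝ≥0, ∀ f g x, logK N₀ N₁ (f + g) x ≤ C * (logK N₀ N₁ f x + logK N₀ N₁ g x) := by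
  obtain ⟨C₀, hC₀⟩ := h₀.add_le
  obtain ⟨C₁, hC₁⟩ := h₁.add_le
  set C : ℝ≥0 := max (max C₀ C₁) 1
  have hC0 : (C : ℝ≥0∞) ≠ 0 := by
    have : (0 : ℝ≥0) < C := lt_of_lt_of_le one_pos (le_max_right _ _)
    exact_mod_cast this.ne'
  have hle₀ : (C₀ : ℝ≥0∞) ≤ C := by
    exact_mod_cast (le_max_left C₀ C₁).trans (le_max_left _ _)
  have hle₁ : (C₁ : ℝ≥0∞) ≤ C := by
    exact_mod_cast (le_max_right C₀ C₁).trans (le_max_left _ _)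
  refine ⟨C, fun f g x => ?_⟩
  have key : ∀ f₀ f₁ g₀ g₁, f₀ + f₁ = f → g₀ + g₁ = g → logK N₀ N₁ (f + g) x ≤
      C * ((N₀ f₀ + E x * N₁ f₁) + (N₀ g₀ + E x * N₁ g₁)) := by
    rintro f₀ f₁ g₀ g₁ rfl rfl
    rw [show f₀ + f₁ + (g₀ + g₁) = (f₀ + g₀) + (f₁ + g₁) by abel]
    calc _ ≤ N₀ (f₀ + g₀) + E x * N₁ (f₁ + g₁) := logK_le _ _ _
      _ ≤ C * (N₀ f₀ + N₀ g₀) + E x * (C * (N₁ f₁ + N₁ g₁)) := by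
          gcongr
          · exact (hC₀ _ _).trans (by gcongr)
          · exact (hC₁ _ _).trans (by gcongr)
      _ = _ := by ring
  rw [mul_comm, ← ENNReal.div_le_iff_le_mul (.inl hC0) (.inl ENNReal.coe_ne_top)]
  have h1 : ∀ f₀ f₁, f₀ + f₁ = f → logK N₀ N₁ (f + g) x / C - (N₀ f₀ + E x * N₁ f₁) ≤
      logK N₀ N₁ g x := fun f₀ f₁ hf => le_logK fun g₀ g₁ hg => by
    rw [tsub_le_iff_left]
    exact ENNReal.div_le_of_le_mul' (key f₀ f₁ g₀ g₁ hf hg)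
  have h2 : logK N₀ N₁ (f + g) x / C - logK N₀ N₁ g x ≤ logK N₀ N₁ f x :=
    le_logK fun f₀ f₁ hf => by
      rw [tsub_le_iff_left, ← tsub_le_iff_right]
      exact h1 f₀ f₁ hf
  rwa [tsub_le_iff_right] at h2

lemma exists_near_optimal {f : V} {x : ℝ} (h0 : logK N₀ N₁ f x ≠ 0) (h : logK N₀ N₁ f x ≠ ∞) :
    ∃ f₀ f₁, f₀ + f₁ = f ∧ N₀ f₀ + E x * N₁ f₁ ≤ 2 * logK N₀ N₁ f x := by
  by_contra hcon
  push Not at hcon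
  have : 2 * logK N₀ N₁ f x ≤ logK N₀ N₁ f x := le_logK fun f₀ f₁ hf => (hcon f₀ f₁ hf).le
  rw [two_mul] at this
  exact absurd this (not_le.2 (ENNReal.lt_add_right h h0))

/-- The sum of a compatible couple embeds into the ambient Hausdorff space, so the `K`-functional
vanishes only at zero. -/
lemma QuasiBanachSubspace.eq_zero_of_logK {𝕜 V : Type*} [RCLike 𝕜] [AddCommGroup V] [Module 𝕜 V]
    [TopologicalSpace V] [IsTopologicalAddGroup V] [T2Space V] (A₀ A₁ : QuasiBanachSubspace 𝕜 V)
    {f : V} {x : ℝ} (h : logK A₀.qnorm A₁.qnorm f x = 0) : f = 0 := by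
  by_contra hf
  have hW : ({f}ᶜ : Set V) ∈ 𝓝 (0 : V) :=
    isOpen_compl_singleton.mem_nhds (by simpa using Ne.symm hf)
  obtain ⟨U, hU, hUW⟩ := exists_nhds_zero_half hW
  obtain ⟨ε₀, hε₀, h₀⟩ := A₀.continuous_embedding U hU
  obtain ⟨ε₁, hε₁, h₁⟩ := A₁.continuous_embedding U hU
  have hlt : logK A₀.qnorm A₁.qnorm f x < min ε₀ (E x * ε₁) := by
    rw [h]
    exact lt_min hε₀ (ENNReal.mul_pos (E_ne_zero x) hε₁.ne')
  refine absurd hlt (not_lt.2 (le_logK fun f₀ f₁ hf' => ?_))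
  by_contra hcon
  rw [not_le] at hcon
  have e₀ : f₀ ∈ U := h₀ _ ((le_self_add.trans_lt hcon).trans_le (min_le_left _ _))
  have e₁ : f₁ ∈ U := by
    refine h₁ _ ?_
    have h2 := (le_add_self.trans_lt hcon).trans_le (min_le_right _ _)
    exact lt_of_mul_lt_mul_left' h2
  exact hUW f₀ e₀ f₁ e₁ hf'

end KFunctional

/-! ### A Holmstedt-type formula -/

/-- Unlike in `Admissible.const_mul_le`, the constant may be infinite. -/
lemma Admissible.mul_le_const {p : ℝ} {Φ : (ℝ → ℝ≥0∞) → ℝ≥0∞} (hΦ : Admissible p Φ)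
    (c : ℝ≥0∞) (g : ℝ → ℝ≥0∞) : c * Φ g ≤ Φ fun u => c * g u := by
  refine ENNReal.mul_le_of_forall_lt fun d hd G hG => ?_
  have hd' : d ≠ ∞ := (hd.trans_le le_top).ne
  rcases eq_or_ne d 0 with rfl | h0
  · simp
  calc d * G ≤ d * Φ (fun u => d⁻¹ * (d * g u)) := by
        gcongr
        refine hG.le.trans (hΦ.mono fun u => ?_)
        rw [← mul_assoc, ENNReal.inv_mul_cancel h0 hd', one_mul]
    _ ≤ d * (d⁻¹ * Φ fun u => d * g u) := by
        gcongr
        exact hΦ.const_mul_le _ _ (ENNReal.inv_ne_top.2 h0)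
    _ = Φ fun u => d * g u := by rw [← mul_assoc, ENNReal.mul_inv_cancel h0 hd', one_mul]
    _ ≤ _ := hΦ.mono fun u => by gcongr

/-- Two quasi-norms `Φ₀` and `Φ₁` on functions on the line, playing the roles of the norms of the
two spaces of a reiterated couple, together with functions `χ₀` and `χ₁` comparable with their
values on indicators of right and left half-lines, respectively. -/
structure Setting (p : ℝ) (Φ₀ Φ₁ : (ℝ → ℝ≥0∞) → ℝ≥0∞) (χ₀ χ₁ : ℝ → ℝ≥0∞) : Prop where
  hp : 0 < p
  adm₀ : Admissible p Φ₀
  adm₁ : Admissible p Φ₁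
  potter₀ : Potter χ₀
  potter₁ : Potter χ₁
  meas₀ : Measurable χ₀
  meas₁ : Measurable χ₁
  equiv₀ : ∃ A : ℝ≥0, ∀ x, Φ₀ ((Ioi x).indicator fun _ => 1) ≤ A * χ₀ x ∧
    χ₀ x ≤ A * Φ₀ ((Ioi x).indicator fun _ => 1)
  equiv₁ : ∃ A : ℝ≥0, ∀ x, Φ₁ ((Iio x).indicator fun _ => 1) ≤ A * χ₁ x ∧
    χ₁ x ≤ A * Φ₁ ((Iio x).indicator fun _ => 1)

/-- The function `ρ` of the reiteration formula in the logarithmic variable. -/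
def logRho (χ₀ χ₁ : ℝ → ℝ≥0∞) (x : ℝ) : ℝ≥0∞ := E x * (χ₀ x * (χ₁ x)⁻¹)

section Setting

variable {p : ℝ} {Φ₀ Φ₁ : (ℝ → ℝ≥0∞) → ℝ≥0∞} {χ₀ χ₁ : ℝ → ℝ≥0∞}

lemma Setting.local₀ (S : Setting p Φ₀ Φ₁ χ₀ χ₁) : ∃ A : ℝ≥0, ∀ t,
    Φ₀ ((Icc (t - 1) (t + 1)).indicator fun _ => 1) ≤ A * χ₀ t := by
  obtain ⟨A, hA⟩ := S.equiv₀
  obtain ⟨C, hC⟩ := S.potter₀.controlled 2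
  refine ⟨A * C, fun t => ?_⟩
  calc Φ₀ ((Icc (t - 1) (t + 1)).indicator fun _ => 1)
      ≤ Φ₀ ((Ioi (t - 2)).indicator fun _ => 1) := S.adm₀.mono fun u =>
        indicator_le_indicator_of_subset
          (fun v hv => show t - 2 < v by linarith [hv.1]) (fun _ => zero_le) u
    _ ≤ A * (C * χ₀ t) := by
        refine (hA _).1.trans ?_
        gcongr
        exact hC _ _ (by norm_num)
    _ = _ := by push_cast; ring

lemma Setting.local₁ (S : Setting p Φ₀ Φ₁ χ₀ χ₁) : ∃ A : ℝ≥0, ∀ t,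
    Φ₁ ((Icc (t - 1) (t + 1)).indicator fun _ => 1) ≤ A * χ₁ t := by
  obtain ⟨A, hA⟩ := S.equiv₁
  obtain ⟨C, hC⟩ := S.potter₁.controlled 2
  refine ⟨A * C, fun t => ?_⟩
  calc Φ₁ ((Icc (t - 1) (t + 1)).indicator fun _ => 1)
      ≤ Φ₁ ((Iio (t + 2)).indicator fun _ => 1) := S.adm₁.mono fun u =>
        indicator_le_indicator_of_subset
          (fun v hv => show v < t + 2 by linarith [hv.2]) (fun _ => zero_le) u
    _ ≤ A * (C * χ₁ t) := by
        refine (hA _).1.trans ?_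
        gcongr
        exact hC _ _ (by norm_num)
    _ = _ := by push_cast; ring

lemma Setting.logRho_ne_zero (S : Setting p Φ₀ Φ₁ χ₀ χ₁) (x : ℝ) : logRho χ₀ χ₁ x ≠ 0 :=
  mul_ne_zero (E_ne_zero x) ((S.potter₀.mul S.potter₁.inv).ne_zero x)

lemma Setting.logRho_mul (S : Setting p Φ₀ Φ₁ χ₀ χ₁) (x : ℝ) :
    logRho χ₀ χ₁ x * (E (-x) * χ₁ x) = χ₀ x := by
  calc logRho χ₀ χ₁ x * (E (-x) * χ₁ x)
      = (E x * E (-x)) * χ₀ x * ((χ₁ x)⁻¹ * χ₁ x) := by rw [logRho]; ring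
    _ = χ₀ x := by
        rw [E_mul_neg, ENNReal.inv_mul_cancel (S.potter₁.ne_zero x) (S.potter₁.ne_top x)]; simp

/-- The explicit expression equivalent to the `K`-functional of the reiterated couple at
`ρ(e ^ x)`; here `k` is the `K`-functional of the original couple. -/
def holmstedt (Φ₀ Φ₁ : (ℝ → ℝ≥0∞) → ℝ≥0∞) (χ₀ χ₁ k : ℝ → ℝ≥0∞) (x : ℝ) : ℝ≥0∞ :=
  Φ₀ ((Iio x).indicator k) + k x * χ₀ x +
    logRho χ₀ χ₁ x * Φ₁ ((Ioi x).indicator fun u => E (-u) * k u)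

variable {V : Type*} [AddCommGroup V] {N₀ N₁ : V → ℝ≥0∞}

/-- The space with quasi-norm `Φ₀(K(·, f))`. -/
def space₀ (Φ₀ : (ℝ → ℝ≥0∞) → ℝ≥0∞) (N₀ N₁ : V → ℝ≥0∞) (f : V) : ℝ≥0∞ := Φ₀ (logK N₀ N₁ f)

/-- The space with quasi-norm `Φ₁(u⁻¹ K(u, f))`, in the logarithmic variable. -/
def space₁ (Φ₁ : (ℝ → ℝ≥0∞) → ℝ≥0∞) (N₀ N₁ : V → ℝ≥0∞) (f : V) : ℝ≥0∞ :=
  Φ₁ fun u => E (-u) * logK N₀ N₁ f u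

/-- Upper estimate: a nearly optimal decomposition of `f` at `e ^ x` for the original couple is used
for the reiterated couple at `ρ(e ^ x)`. -/
lemma Setting.logK_le_holmstedt (S : Setting p Φ₀ Φ₁ χ₀ χ₁) (h₀ : IsQuasiNorm N₀)
    (h₁ : IsQuasiNorm N₁) (hK : ∀ f x, logK N₀ N₁ f x = 0 → f = 0) {φ : ℝ → ℝ}
    (hφ : ∀ x, E (φ x) = logRho χ₀ χ₁ x) :
    ∃ C : ℝ≥0, ∀ f x, logK (space₀ Φ₀ N₀ N₁) (space₁ Φ₁ N₀ N₁) f (φ x) ≤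
      C * holmstedt Φ₀ Φ₁ χ₀ χ₁ (logK N₀ N₁ f) x := by
  obtain ⟨Q, hQ⟩ := exists_logK_add_le h₀ h₁
  obtain ⟨C₀, hC₀⟩ := S.adm₀.add_le
  obtain ⟨C₁, hC₁⟩ := S.adm₁.add_le
  obtain ⟨A₀, hA₀⟩ := S.equiv₀
  obtain ⟨A₁, hA₁⟩ := S.equiv₁
  refine ⟨C₀ * (3 * Q + 2 * A₀) + C₁ * (2 * A₁ + 3 * Q) + 1, fun f x => ?_⟩
  set k := logK N₀ N₁ f with hk
  by_cases htop : k x = ∞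
  · have : holmstedt Φ₀ Φ₁ χ₀ χ₁ k x = ∞ := by
      rw [holmstedt, htop, ENNReal.top_mul (S.potter₀.ne_zero x)]; simp
    rw [this, ENNReal.mul_top (by push_cast; positivity)]
    exact le_top
  -- For `k x = 0` the infimum need not be nearly attained, but then `f = 0`.
  by_cases hzero : k x = 0
  · have hf := hK f x hzero
    have : logK (space₀ Φ₀ N₀ N₁) (space₁ Φ₁ N₀ N₁) f (φ x) ≤ 0 := by
      have := logK_le (N₀ := space₀ Φ₀ N₀ N₁) (N₁ := space₁ Φ₁ N₀ N₁) 0 0 (φ x)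
      rw [hf]
      simpa [space₀, space₁, logK_zero h₀ h₁, S.adm₀.zero, S.adm₁.zero] using this
    exact this.trans zero_le
  obtain ⟨f₀, f₁, hf, hopt⟩ := exists_near_optimal hzero htop
  have ho₀ : N₀ f₀ ≤ 2 * k x := le_self_add.trans hopt
  have ho₁ : N₁ f₁ ≤ 2 * (E (-x) * k x) := by
    calc N₁ f₁ = E (-x) * (E x * N₁ f₁) := by rw [← mul_assoc, ← E_add]; simp
      _ ≤ E (-x) * (2 * k x) := mul_le_mul_right (le_add_self.trans hopt) _
      _ = _ := by ring
  have hk₀ : ∀ u, logK N₀ N₁ f₀ u ≤ 2 * k x := fun u => (logK_le_left h₁ f₀ u).trans ho₀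
  have hk₁ : ∀ u, E (-u) * logK N₀ N₁ f₁ u ≤ 2 * (E (-x) * k x) := fun u => by
    calc E (-u) * logK N₀ N₁ f₁ u ≤ E (-u) * (E u * N₁ f₁) := by
          gcongr; exact logK_le_right h₀ f₁ u
      _ = N₁ f₁ := by rw [← mul_assoc, ← E_add]; simp
      _ ≤ _ := ho₁
  have hk₀' : ∀ u, u ≤ x → logK N₀ N₁ f₀ u ≤ 3 * Q * k u := fun u hu => by
    calc logK N₀ N₁ f₀ u = logK N₀ N₁ (f + -f₁) u := by rw [← hf]; simp
      _ ≤ Q * (k u + logK N₀ N₁ f₁ u) := (hQ _ _ _).trans (by gcongr; exact logK_neg h₀ h₁ f₁ u)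
      _ ≤ Q * (k u + 2 * k u) := by
          gcongr
          calc logK N₀ N₁ f₁ u = E u * (E (-u) * logK N₀ N₁ f₁ u) := by
                rw [← mul_assoc, E_mul_neg, one_mul]
            _ ≤ E u * (2 * (E (-u) * k u)) :=
                mul_le_mul_right
                  ((hk₁ u).trans (mul_le_mul_right (E_neg_mul_logK_anti f hu) _)) _
            _ = E u * E (-u) * (2 * k u) := by ring
            _ = 2 * k u := by rw [E_mul_neg, one_mul]
      _ = _ := by ring
  have hk₁' : ∀ u, x ≤ u → E (-u) * logK N₀ N₁ f₁ u ≤ 3 * Q * (E (-u) * k u) := fun u hu => by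
    calc E (-u) * logK N₀ N₁ f₁ u = E (-u) * logK N₀ N₁ (f + -f₀) u := by rw [← hf]; simp
      _ ≤ E (-u) * (Q * (k u + 2 * k u)) := by
          gcongr
          refine (hQ _ _ _).trans ?_
          gcongr
          refine (logK_neg h₀ h₁ f₀ u).trans ((hk₀ u).trans ?_)
          gcongr
          exact logK_mono f hu
      _ = _ := by ring
  have hne : ∀ᵐ u : ℝ, u ≠ x := by simp [ae_iff]
  have b₀ : space₀ Φ₀ N₀ N₁ f₀ ≤
      C₀ * (3 * Q * Φ₀ ((Iio x).indicator k) + 2 * k x * (A₀ * χ₀ x)) := by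
    calc space₀ Φ₀ N₀ N₁ f₀
        ≤ Φ₀ (fun u => 3 * Q * (Iio x).indicator k u +
            2 * k x * (Ioi x).indicator (fun _ => 1) u) := by
          refine S.adm₀.mono_ae _ _ ?_
          filter_upwards [hne] with u hu
          rcases lt_or_gt_of_ne hu with h | h
          · rw [indicator_of_mem (show u ∈ Iio x from h)]
            exact (hk₀' u h.le).trans le_self_add
          · rw [indicator_of_mem (show u ∈ Ioi x from h), mul_one]
            exact (hk₀ u).trans le_add_self
      _ ≤ C₀ * (Φ₀ (fun u => 3 * Q * (Iio x).indicator k u) +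
            Φ₀ (fun u => 2 * k x * (Ioi x).indicator (fun _ => 1) u)) :=
          hC₀ _ _ (((measurable_logK f).indicator measurableSet_Iio).const_mul _)
            ((measurable_const.indicator measurableSet_Ioi).const_mul _)
      _ ≤ _ := by
          gcongr
          · exact S.adm₀.const_mul_le _ _ (by finiteness)
          · refine (S.adm₀.const_mul_le _ _ (by finiteness)).trans ?_
            gcongr
            exact (hA₀ x).1
  have b₁ : space₁ Φ₁ N₀ N₁ f₁ ≤ C₁ * (2 * (E (-x) * k x) * (A₁ * χ₁ x) +
      3 * Q * Φ₁ ((Ioi x).indicator fun u => E (-u) * k u)) := by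
    have hfin : 2 * (E (-x) * k x) ≠ ∞ :=
      ENNReal.mul_ne_top (by simp) (ENNReal.mul_ne_top (E_ne_top _) htop)
    calc space₁ Φ₁ N₀ N₁ f₁
        ≤ Φ₁ (fun u => 2 * (E (-x) * k x) * (Iio x).indicator (fun _ => 1) u +
            3 * Q * (Ioi x).indicator (fun u => E (-u) * k u) u) := by
          refine S.adm₁.mono_ae _ _ ?_
          filter_upwards [hne] with u hu
          rcases lt_or_gt_of_ne hu with h | h
          · rw [indicator_of_mem (show u ∈ Iio x from h), mul_one]
            exact (hk₁ u).trans le_self_add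
          · rw [indicator_of_mem (show u ∈ Ioi x from h)]
            exact (hk₁' u h.le).trans le_add_self
      _ ≤ C₁ * (Φ₁ (fun u => 2 * (E (-x) * k x) * (Iio x).indicator (fun _ => 1) u) +
            Φ₁ (fun u => 3 * Q * (Ioi x).indicator (fun u => E (-u) * k u) u)) :=
          hC₁ _ _ ((measurable_const.indicator measurableSet_Iio).const_mul _)
            (((measurable_E_neg_mul_logK f).indicator measurableSet_Ioi).const_mul _)
      _ ≤ _ := by
          gcongr
          · refine (S.adm₁.const_mul_le _ _ hfin).trans ?_
            gcongr
            exact (hA₁ x).1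
          · exact S.adm₁.const_mul_le _ _ (by finiteness)
  have hρ := S.logRho_mul x
  set a := Φ₀ ((Iio x).indicator k)
  set c := Φ₁ ((Ioi x).indicator fun u => E (-u) * k u)
  calc logK (space₀ Φ₀ N₀ N₁) (space₁ Φ₁ N₀ N₁) f (φ x)
      ≤ space₀ Φ₀ N₀ N₁ f₀ + logRho χ₀ χ₁ x * space₁ Φ₁ N₀ N₁ f₁ := by
        rw [← hf, ← hφ]; exact logK_le _ _ _
    _ ≤ C₀ * (3 * Q * a + 2 * k x * (A₀ * χ₀ x)) +
          logRho χ₀ χ₁ x * (C₁ * (2 * (E (-x) * k x) * (A₁ * χ₁ x) + 3 * Q * c)) := by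
        gcongr
    _ = C₀ * (3 * Q * a + 2 * A₀ * (k x * χ₀ x)) + C₁ * (2 * A₁ *
          (k x * (logRho χ₀ χ₁ x * (E (-x) * χ₁ x))) + 3 * Q * (logRho χ₀ χ₁ x * c)) := by ring
    _ = C₀ * (3 * Q * a + 2 * A₀ * (k x * χ₀ x)) + C₁ * (2 * A₁ *
          (k x * χ₀ x) + 3 * Q * (logRho χ₀ χ₁ x * c)) := by rw [hρ]
    _ ≤ C₀ * (3 * Q * holmstedt Φ₀ Φ₁ χ₀ χ₁ k x + 2 * A₀ * holmstedt Φ₀ Φ₁ χ₀ χ₁ k x) +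
          C₁ * (2 * A₁ * holmstedt Φ₀ Φ₁ χ₀ χ₁ k x + 3 * Q * holmstedt Φ₀ Φ₁ χ₀ χ₁ k x) := by
        have e1 : a ≤ holmstedt Φ₀ Φ₁ χ₀ χ₁ k x := le_self_add.trans le_self_add
        have e2 : k x * χ₀ x ≤ holmstedt Φ₀ Φ₁ χ₀ χ₁ k x := le_add_self.trans le_self_add
        have e3 : logRho χ₀ χ₁ x * c ≤ holmstedt Φ₀ Φ₁ χ₀ χ₁ k x := le_add_self
        gcongr
    _ ≤ C₀ * (3 * Q * holmstedt Φ₀ Φ₁ χ₀ χ₁ k x + 2 * A₀ * holmstedt Φ₀ Φ₁ χ₀ χ₁ k x) +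
          C₁ * (2 * A₁ * holmstedt Φ₀ Φ₁ χ₀ χ₁ k x + 3 * Q * holmstedt Φ₀ Φ₁ χ₀ χ₁ k x) +
          holmstedt Φ₀ Φ₁ χ₀ χ₁ k x := le_self_add
    _ = _ := by push_cast; ring

/-- Elements of the first space: `K(u, f) χ₀(u)` is bounded by the quasi-norm. -/
lemma Setting.logK_mul_le₀ (S : Setting p Φ₀ Φ₁ χ₀ χ₁) : ∃ A : ℝ≥0, ∀ (f : V) x,
    logK N₀ N₁ f x * χ₀ x ≤ A * space₀ Φ₀ N₀ N₁ f := by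
  obtain ⟨A, hA⟩ := S.equiv₀
  refine ⟨A, fun f x => ?_⟩
  calc logK N₀ N₁ f x * χ₀ x ≤ logK N₀ N₁ f x * (A * Φ₀ ((Ioi x).indicator fun _ => 1)) := by
        gcongr; exact (hA x).2
    _ = A * (logK N₀ N₁ f x * Φ₀ ((Ioi x).indicator fun _ => 1)) := by ring
    _ ≤ A * space₀ Φ₀ N₀ N₁ f := by
        gcongr
        refine (S.adm₀.mul_le_const _ _).trans (S.adm₀.mono fun u => ?_)
        by_cases hu : u ∈ Ioi x
        · rw [indicator_of_mem hu, mul_one]; exact logK_mono f (le_of_lt hu)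
        · simp [indicator_of_notMem hu]

/-- Elements of the second space: `u⁻¹ K(u, f) χ₁(u)` is bounded by the quasi-norm. -/
lemma Setting.logK_mul_le₁ (S : Setting p Φ₀ Φ₁ χ₀ χ₁) : ∃ A : ℝ≥0, ∀ (f : V) x,
    E (-x) * logK N₀ N₁ f x * χ₁ x ≤ A * space₁ Φ₁ N₀ N₁ f := by
  obtain ⟨A, hA⟩ := S.equiv₁
  refine ⟨A, fun f x => ?_⟩
  calc E (-x) * logK N₀ N₁ f x * χ₁ x
      ≤ E (-x) * logK N₀ N₁ f x * (A * Φ₁ ((Iio x).indicator fun _ => 1)) := by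
        gcongr; exact (hA x).2
    _ = A * (E (-x) * logK N₀ N₁ f x * Φ₁ ((Iio x).indicator fun _ => 1)) := by ring
    _ ≤ A * space₁ Φ₁ N₀ N₁ f := by
        gcongr
        refine (S.adm₁.mul_le_const _ _).trans (S.adm₁.mono fun u => ?_)
        by_cases hu : u ∈ Iio x
        · rw [indicator_of_mem hu, mul_one]; exact E_neg_mul_logK_anti f (le_of_lt hu)
        · simp [indicator_of_notMem hu]

/-- The extremal function `u / χ₁(u)` of the second space, cut off at `e ^ x`, has quasi-norm at
most `ρ` in the first space. -/
lemma Setting.cut_left_le (S : Setting p Φ₀ Φ₁ χ₀ χ₁) : ∃ C : ℝ≥0, ∀ x,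
    Φ₀ ((Iio x).indicator fun u => E u * (χ₁ u)⁻¹) ≤ C * logRho χ₀ χ₁ x := by
  obtain ⟨A, hA⟩ := S.local₀
  have hP := S.potter₀.mul S.potter₁.inv
  obtain ⟨B, hB⟩ := hP.bound (1 / 2) (by norm_num)
  have hctrl : Controlled fun u => E u * (χ₁ u)⁻¹ := by
    simpa using (controlled_E 1).mul S.potter₁.inv.controlled
  obtain ⟨C, hC⟩ := S.adm₀.side_le_of_decay S.hp (σ := 1) (by simp) hA hctrl
    (fun u => ENNReal.mul_ne_top (E_ne_top u) (S.potter₁.inv.ne_top u)) (B := B) (δ := 1 / 2)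
    (by norm_num) (fun t m => by
      have h := hB (t - 1 * m) t
      rw [show t - 1 * (m : ℝ) - t = -m by ring, abs_neg, abs_of_nonneg (Nat.cast_nonneg m)] at h
      calc E (t - 1 * m) * (χ₁ (t - 1 * m))⁻¹ * χ₀ (t - 1 * m)
          = E (t - 1 * m) * (χ₀ (t - 1 * m) * (χ₁ (t - 1 * m))⁻¹) := by ring
        _ ≤ E (t - 1 * m) * (B * E (1 / 2 * m) * (χ₀ t * (χ₁ t)⁻¹)) := by gcongr
        _ = B * (E (t - 1 * m) * E (1 / 2 * m)) * (χ₀ t * (χ₁ t)⁻¹) := by ring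
        _ = B * (E (-(1 / 2 * m)) * E t) * (χ₀ t * (χ₁ t)⁻¹) := by
            rw [← E_add, ← E_add]; ring_nf
        _ = _ := by ring)
  refine ⟨C, fun x => ?_⟩
  have := hC x
  rw [side_one] at this
  rw [logRho]
  refine this.trans_eq ?_
  ring

/-- The extremal function `1 / χ₀(u)` of the first space, cut off to the right of `e ^ x`, has
quasi-norm at most `1 / ρ` in the second space. -/
lemma Setting.cut_right_le (S : Setting p Φ₀ Φ₁ χ₀ χ₁) : ∃ C : ℝ≥0, ∀ x,
    logRho χ₀ χ₁ x * Φ₁ ((Ioi x).indicator fun u => E (-u) * (χ₀ u)⁻¹) ≤ C := by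
  obtain ⟨A, hA⟩ := S.local₁
  have hP := S.potter₁.mul S.potter₀.inv
  obtain ⟨B, hB⟩ := hP.bound (1 / 2) (by norm_num)
  have hctrl : Controlled fun u => E (-u) * (χ₀ u)⁻¹ := by
    simpa using (controlled_E (-1)).mul S.potter₀.inv.controlled
  obtain ⟨C, hC⟩ := S.adm₁.side_le_of_decay S.hp (σ := -1) (by simp) hA hctrl
    (fun u => ENNReal.mul_ne_top (E_ne_top _) (S.potter₀.inv.ne_top u)) (B := B) (δ := 1 / 2)
    (by norm_num) (fun t m => by
      have h := hB (t - -1 * m) t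
      rw [show t - -1 * (m : ℝ) - t = m by ring, abs_of_nonneg (Nat.cast_nonneg m)] at h
      calc E (-(t - -1 * m)) * (χ₀ (t - -1 * m))⁻¹ * χ₁ (t - -1 * m)
          = E (-(t - -1 * m)) * (χ₁ (t - -1 * m) * (χ₀ (t - -1 * m))⁻¹) := by ring
        _ ≤ E (-(t - -1 * m)) * (B * E (1 / 2 * m) * (χ₁ t * (χ₀ t)⁻¹)) := by gcongr
        _ = B * (E (-(t - -1 * m)) * E (1 / 2 * m)) * (χ₁ t * (χ₀ t)⁻¹) := by ring
        _ = B * (E (-(1 / 2 * m)) * E (-t)) * (χ₁ t * (χ₀ t)⁻¹) := by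
            rw [← E_add, ← E_add]; ring_nf
        _ = _ := by ring)
  refine ⟨C, fun x => ?_⟩
  have := hC x
  rw [side_neg_one] at this
  calc logRho χ₀ χ₁ x * Φ₁ ((Ioi x).indicator fun u => E (-u) * (χ₀ u)⁻¹)
      ≤ logRho χ₀ χ₁ x * (C * (E (-x) * (χ₀ x)⁻¹ * χ₁ x)) := by gcongr
    _ = C * (E x * E (-x)) * (χ₀ x * (χ₀ x)⁻¹) * ((χ₁ x)⁻¹ * χ₁ x) := by rw [logRho]; ring
    _ = C := by
        rw [E_mul_neg, ENNReal.inv_mul_cancel (S.potter₁.ne_zero x) (S.potter₁.ne_top x),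
          ENNReal.mul_inv_cancel (S.potter₀.ne_zero x) (S.potter₀.ne_top x)]
        simp

/-- Lower estimate for an arbitrary decomposition in the reiterated couple. -/
lemma Setting.exists_holmstedt_le (S : Setting p Φ₀ Φ₁ χ₀ χ₁) (h₀ : IsQuasiNorm N₀)
    (h₁ : IsQuasiNorm N₁) : ∃ C : ℝ≥0, C ≠ 0 ∧ ∀ (g₀ g₁ : V) x,
      holmstedt Φ₀ Φ₁ χ₀ χ₁ (logK N₀ N₁ (g₀ + g₁)) x ≤
        C * (space₀ Φ₀ N₀ N₁ g₀ + logRho χ₀ χ₁ x * space₁ Φ₁ N₀ N₁ g₁) := by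
  obtain ⟨Q, hQ⟩ := exists_logK_add_le h₀ h₁
  obtain ⟨C₀, hC₀⟩ := S.adm₀.add_le
  obtain ⟨C₁, hC₁⟩ := S.adm₁.add_le
  obtain ⟨A₀, hA₀⟩ := S.logK_mul_le₀ (N₀ := N₀) (N₁ := N₁)
  obtain ⟨A₁, hA₁⟩ := S.logK_mul_le₁ (N₀ := N₀) (N₁ := N₁)
  obtain ⟨D₀, hD₀⟩ := S.cut_left_le
  obtain ⟨D₁, hD₁⟩ := S.cut_right_le
  refine ⟨Q * C₀ * (1 + A₁ * D₀) + Q * (A₀ + A₁) + Q * C₁ * (A₀ * D₁ + 1) + 1, by positivity,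
    fun g₀ g₁ x => ?_⟩
  set M₀ := space₀ Φ₀ N₀ N₁ g₀ with hM₀
  set M₁ := space₁ Φ₁ N₀ N₁ g₁ with hM₁
  set k := logK N₀ N₁ (g₀ + g₁)
  set k₀ := logK N₀ N₁ g₀ with hk₀
  set k₁ := logK N₀ N₁ g₁ with hk₁
  have hρ0 := S.logRho_ne_zero x
  by_cases ht₀ : M₀ = ∞
  · rw [ht₀, top_add, ENNReal.mul_top (by push_cast; positivity)]; exact le_top
  by_cases ht₁ : M₁ = ∞
  · rw [ht₁, ENNReal.mul_top hρ0, add_top, ENNReal.mul_top (by push_cast; positivity)]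
    exact le_top
  have hk : ∀ u, k u ≤ Q * (k₀ u + k₁ u) := fun u => hQ _ _ _
  have hb₀ : ∀ u, k₀ u ≤ A₀ * M₀ * (χ₀ u)⁻¹ := fun u => by
    rw [← div_eq_mul_inv, ENNReal.le_div_iff_mul_le (.inl (S.potter₀.ne_zero u))
      (.inl (S.potter₀.ne_top u))]
    exact hA₀ g₀ u
  have hb₁ : ∀ u, k₁ u ≤ A₁ * M₁ * (E u * (χ₁ u)⁻¹) := fun u => by
    have h : E (-u) * k₁ u ≤ A₁ * M₁ * (χ₁ u)⁻¹ := by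
      rw [← div_eq_mul_inv, ENNReal.le_div_iff_mul_le (.inl (S.potter₁.ne_zero u))
        (.inl (S.potter₁.ne_top u))]
      exact hA₁ g₁ u
    calc k₁ u = E u * (E (-u) * k₁ u) := by rw [← mul_assoc, E_mul_neg, one_mul]
      _ ≤ E u * (A₁ * M₁ * (χ₁ u)⁻¹) := by gcongr
      _ = _ := by ring
  set ρ := logRho χ₀ χ₁ x with hρ
  have t₁ : Φ₀ ((Iio x).indicator k) ≤ Q * (C₀ * (M₀ + A₁ * M₁ * (D₀ * ρ))) := by
    calc Φ₀ ((Iio x).indicator k)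
        ≤ Φ₀ (fun u => Q * (k₀ u + (Iio x).indicator k₁ u)) := S.adm₀.mono fun u => by
          by_cases hu : u ∈ Iio x
          · rw [indicator_of_mem hu, indicator_of_mem hu]; exact hk u
          · simp [indicator_of_notMem hu]
      _ ≤ Q * (C₀ * (M₀ + Φ₀ ((Iio x).indicator k₁))) := by
          refine (S.adm₀.const_mul_le _ _ ENNReal.coe_ne_top).trans ?_
          gcongr
          exact hC₀ _ _ (measurable_logK g₀) ((measurable_logK g₁).indicator measurableSet_Iio)
      _ ≤ Q * (C₀ * (M₀ + A₁ * M₁ * (D₀ * ρ))) := by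
          gcongr
          calc Φ₀ ((Iio x).indicator k₁)
              ≤ Φ₀ (fun u => A₁ * M₁ * (Iio x).indicator (fun u => E u * (χ₁ u)⁻¹) u) :=
                S.adm₀.mono fun u => by
                  by_cases hu : u ∈ Iio x
                  · rw [indicator_of_mem hu, indicator_of_mem hu]; exact hb₁ u
                  · simp [indicator_of_notMem hu]
            _ ≤ A₁ * M₁ * Φ₀ ((Iio x).indicator fun u => E u * (χ₁ u)⁻¹) :=
                S.adm₀.const_mul_le _ _ (ENNReal.mul_ne_top ENNReal.coe_ne_top ht₁)
            _ ≤ _ := by gcongr; exact hD₀ x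
  have t₂ : k x * χ₀ x ≤ Q * (A₀ * M₀ + A₁ * M₁ * ρ) := by
    calc k x * χ₀ x ≤ Q * (k₀ x + k₁ x) * χ₀ x := by gcongr; exact hk x
      _ = Q * (k₀ x * χ₀ x + k₁ x * χ₀ x) := by ring
      _ ≤ Q * (A₀ * M₀ + A₁ * M₁ * (E x * (χ₁ x)⁻¹) * χ₀ x) := by
          refine mul_le_mul_right (add_le_add (hA₀ g₀ x) ?_) _
          exact mul_le_mul_left (hb₁ x) _
      _ = _ := by rw [hρ, logRho]; ring
  have t₃ : ρ * Φ₁ ((Ioi x).indicator fun u => E (-u) * k u) ≤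
      Q * (C₁ * (A₀ * M₀ * D₁ + ρ * M₁)) := by
    calc ρ * Φ₁ ((Ioi x).indicator fun u => E (-u) * k u)
        ≤ ρ * Φ₁ (fun u => Q * ((Ioi x).indicator (fun u => E (-u) * k₀ u) u +
            E (-u) * k₁ u)) := by
          gcongr
          refine S.adm₁.mono fun u => ?_
          by_cases hu : u ∈ Ioi x
          · rw [indicator_of_mem hu, indicator_of_mem hu]
            calc E (-u) * k u ≤ E (-u) * (Q * (k₀ u + k₁ u)) := by gcongr; exact hk u
              _ = _ := by ring
          · simp [indicator_of_notMem hu]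
      _ ≤ ρ * (Q * (C₁ * (Φ₁ ((Ioi x).indicator fun u => E (-u) * k₀ u) + M₁))) := by
          gcongr
          refine (S.adm₁.const_mul_le _ _ ENNReal.coe_ne_top).trans ?_
          gcongr
          exact hC₁ _ _ ((measurable_E_neg_mul_logK g₀).indicator measurableSet_Ioi)
            (measurable_E_neg_mul_logK g₁)
      _ ≤ ρ * (Q * (C₁ * (A₀ * M₀ * Φ₁ ((Ioi x).indicator fun u => E (-u) * (χ₀ u)⁻¹) + M₁))) := by
          gcongr
          refine le_trans (S.adm₁.mono fun u => ?_) (S.adm₁.const_mul_le _ _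
            (ENNReal.mul_ne_top ENNReal.coe_ne_top ht₀))
          by_cases hu : u ∈ Ioi x
          · rw [indicator_of_mem hu, indicator_of_mem hu]
            calc E (-u) * k₀ u ≤ E (-u) * (A₀ * M₀ * (χ₀ u)⁻¹) := by gcongr; exact hb₀ u
              _ = _ := by ring
          · simp [indicator_of_notMem hu]
      _ = Q * (C₁ * (A₀ * M₀ * (ρ * Φ₁ ((Ioi x).indicator fun u => E (-u) * (χ₀ u)⁻¹)) +
            ρ * M₁)) := by ring
      _ ≤ _ := by gcongr; exact hD₁ x
  have e₁ : M₀ ≤ M₀ + ρ * M₁ := le_self_add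
  have e₂ : ρ * M₁ ≤ M₀ + ρ * M₁ := le_add_self
  set T := M₀ + ρ * M₁
  calc holmstedt Φ₀ Φ₁ χ₀ χ₁ k x
      ≤ Q * (C₀ * (M₀ + A₁ * M₁ * (D₀ * ρ))) + Q * (A₀ * M₀ + A₁ * M₁ * ρ) +
          Q * (C₁ * (A₀ * M₀ * D₁ + ρ * M₁)) := by
        rw [holmstedt]; gcongr
    _ = Q * (C₀ * (M₀ + A₁ * D₀ * (ρ * M₁))) + Q * (A₀ * M₀ + A₁ * (ρ * M₁)) +
          Q * (C₁ * (A₀ * D₁ * M₀ + ρ * M₁)) := by ring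
    _ ≤ Q * (C₀ * (T + A₁ * D₀ * T)) + Q * (A₀ * T + A₁ * T) +
          Q * (C₁ * (A₀ * D₁ * T + T)) := by gcongr
    _ ≤ Q * (C₀ * (T + A₁ * D₀ * T)) + Q * (A₀ * T + A₁ * T) +
          Q * (C₁ * (A₀ * D₁ * T + T)) + T := le_self_add
    _ = _ := by push_cast; ring

/-- The lower estimate in terms of the `K`-functional of the reiterated couple. -/
lemma Setting.holmstedt_le_logK (S : Setting p Φ₀ Φ₁ χ₀ χ₁) (h₀ : IsQuasiNorm N₀)
    (h₁ : IsQuasiNorm N₁) {φ : ℝ → ℝ} (hφ : ∀ x, E (φ x) = logRho χ₀ χ₁ x) :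
    ∃ C : ℝ≥0, ∀ f x, holmstedt Φ₀ Φ₁ χ₀ χ₁ (logK N₀ N₁ f) x ≤
      C * logK (space₀ Φ₀ N₀ N₁) (space₁ Φ₁ N₀ N₁) f (φ x) := by
  obtain ⟨C, hC0, hC⟩ := S.exists_holmstedt_le h₀ h₁
  refine ⟨C, fun f x => ?_⟩
  have hC0' : (C : ℝ≥0∞) ≠ 0 := by exact_mod_cast hC0
  rw [mul_comm, ← ENNReal.div_le_iff_le_mul (.inl hC0') (.inl ENNReal.coe_ne_top)]
  refine le_logK fun g₀ g₁ hg => ?_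
  rw [hφ]
  refine ENNReal.div_le_of_le_mul' ?_
  rw [← hg]
  exact hC g₀ g₁ x

end Setting

/-! ### The reiterated space in terms of the original couple -/

lemma E_le_E {x y : ℝ} : E x ≤ E y ↔ x ≤ y := by
  rw [E, E, ENNReal.ofReal_le_ofReal_iff (Real.exp_pos _).le, Real.exp_le_exp]

/-- The logarithm of `e ^ x` times a slowly varying function is an almost-translation. -/
lemma Potter.exists_almost_translation {P : ℝ → ℝ≥0∞} (hP : Potter P) {φ : ℝ → ℝ}
    (hφ : ∀ x, E (φ x) = E x * P x) :
    ∃ c : ℝ, ∀ x y, |φ x - φ y - (x - y)| ≤ 1 / 2 * |x - y| + c := by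
  obtain ⟨C, hC⟩ := hP.bound (1 / 2) (by norm_num)
  have hC0 : C ≠ 0 := by
    rintro rfl
    exact hP.ne_zero 0 (by simpa using hC 0 0)
  have hCE : (C : ℝ≥0∞) = E (Real.log C) := by
    rw [E, Real.exp_log (by positivity), ENNReal.ofReal_coe_nnreal]
  have hPE : ∀ x, P x = E (φ x - x) := fun x => by
    rw [sub_eq_add_neg, E_add, hφ, mul_right_comm, E_mul_neg, one_mul]
  have key : ∀ x y, φ x - x ≤ Real.log C + 1 / 2 * |x - y| + (φ y - y) := fun x y => by
    have := hC x y
    rwa [hPE, hPE, hCE, ← E_add, ← E_add, E_le_E] at this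
  refine ⟨Real.log C, fun x y => abs_le.2 ⟨?_, ?_⟩⟩
  · have := key y x
    rw [abs_sub_comm] at this
    linarith
  · linarith [key x y]

lemma abs_sub_le_of_almost_translation {φ : ℝ → ℝ} {c : ℝ}
    (hφ : ∀ x y, |φ x - φ y - (x - y)| ≤ 1 / 2 * |x - y| + c) (x y : ℝ) :
    |φ x - φ y| ≤ 3 / 2 * |x - y| + c := by
  have h1 := abs_add_le (φ x - φ y - (x - y)) (x - y)
  rw [sub_add_cancel] at h1
  linarith [hφ x y]

lemma Controlled.comp_almost_translation {w : ℝ → ℝ≥0∞} (hw : Controlled w) {φ : ℝ → ℝ} {c : ℝ}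
    (hφ : ∀ x y, |φ x - φ y - (x - y)| ≤ 1 / 2 * |x - y| + c) :
    Controlled fun x => w (φ x) := by
  intro L
  obtain ⟨C, hC⟩ := hw (3 / 2 * L + c)
  refine ⟨C, fun x y h => hC _ _ ((abs_sub_le_of_almost_translation hφ x y).trans ?_)⟩
  linarith

/-- For `l ≠ 0` the weight `ρ ^ (-l) v(ρ)` with `v` slowly varying decays geometrically in the
direction given by the sign of `l`. -/
lemma Potter.exists_decay {v : ℝ → ℝ≥0∞} (hv : Potter v) {φ : ℝ → ℝ} {c : ℝ}
    (hφ : ∀ x y, |φ x - φ y - (x - y)| ≤ 1 / 2 * |x - y| + c) {l : ℝ} (hl : l ≠ 0) :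
    ∃ B : ℝ≥0, ∀ x y, 0 ≤ l * (x - y) →
      E (-l * φ x) * v (φ x) ≤ B * E (-(|l| / 4 * |x - y|)) * (E (-l * φ y) * v (φ y)) := by
  have hl' : 0 < |l| := abs_pos.2 hl
  obtain ⟨C, hC⟩ := hv.bound (|l| / 6) (by positivity)
  refine ⟨C * (E (7 / 6 * |l| * c)).toNNReal, fun x y hxy => ?_⟩
  have h1 := abs_sub_le_of_almost_translation hφ x y
  have h2 : l * (x - y) = |l| * |x - y| := by rw [← abs_mul, abs_of_nonneg hxy]
  have h3 : -(l * (φ x - φ y - (x - y))) ≤ |l| * (1 / 2 * |x - y| + c) := by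
    refine (neg_le_abs _).trans ?_
    rw [abs_mul]
    exact mul_le_mul_of_nonneg_left (hφ x y) hl'.le
  have h4 : |l| / 6 * |φ x - φ y| ≤ |l| / 6 * (3 / 2 * |x - y| + c) := by gcongr
  have h5 : -l * φ x + |l| / 6 * |φ x - φ y| ≤
      7 / 6 * |l| * c + -(|l| / 4 * |x - y|) + -l * φ y := by nlinarith
  calc E (-l * φ x) * v (φ x)
      ≤ E (-l * φ x) * (C * E (|l| / 6 * |φ x - φ y|) * v (φ y)) := by gcongr; exact hC _ _
    _ = C * E (-l * φ x + |l| / 6 * |φ x - φ y|) * v (φ y) := by rw [E_add]; ring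
    _ ≤ C * E (7 / 6 * |l| * c + -(|l| / 4 * |x - y|) + -l * φ y) * v (φ y) := by
        gcongr; exact E_mono h5
    _ = _ := by rw [E_add, E_add]; push_cast; rw [coe_toNNReal_E]; ring

section Setting

variable {p : ℝ} {Φ₀ Φ₁ : (ℝ → ℝ≥0∞) → ℝ≥0∞} {χ₀ χ₁ : ℝ → ℝ≥0∞}
  {V : Type*} [AddCommGroup V] {N₀ N₁ : V → ℝ≥0∞}

lemma Setting.exists_almost_translation (S : Setting p Φ₀ Φ₁ χ₀ χ₁) {φ : ℝ → ℝ}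
    (hφ : ∀ x, E (φ x) = logRho χ₀ χ₁ x) :
    ∃ c : ℝ, ∀ x y, |φ x - φ y - (x - y)| ≤ 1 / 2 * |x - y| + c :=
  (S.potter₀.mul S.potter₁.inv).exists_almost_translation hφ

lemma Admissible.measurable_Iio {Φ : (ℝ → ℝ≥0∞) → ℝ≥0∞} (hΦ : Admissible p Φ) (g : ℝ → ℝ≥0∞) :
    Measurable fun x => Φ ((Iio x).indicator g) :=
  Monotone.measurable fun _ _ h => hΦ.mono fun u =>
    indicator_le_indicator_of_subset (Iio_subset_Iio h) (fun _ => zero_le) u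

lemma Admissible.measurable_Ioi {Φ : (ℝ → ℝ≥0∞) → ℝ≥0∞} (hΦ : Admissible p Φ) (g : ℝ → ℝ≥0∞) :
    Measurable fun x => Φ ((Ioi x).indicator g) :=
  Antitone.measurable fun _ _ h => hΦ.mono fun u =>
    indicator_le_indicator_of_subset (Ioi_subset_Ioi h) (fun _ => zero_le) u

/-- The quasi-norm of the reiterated space is equivalent to the sum of the weighted norms of the
three terms of the Holmstedt-type formula. -/
lemma Setting.reiteration (S : Setting p Φ₀ Φ₁ χ₀ χ₁) (h₀ : IsQuasiNorm N₀)
    (h₁ : IsQuasiNorm N₁) (hK : ∀ f x, logK N₀ N₁ f x = 0 → f = 0) {φ : ℝ → ℝ}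
    (hφ : ∀ x, E (φ x) = logRho χ₀ χ₁ x) {v : ℝ → ℝ≥0∞} (hv : Potter v) (θ : ℝ) (r : ℝ≥0∞) :
    ∃ C : ℝ≥0, ∀ f : V,
      eLpNorm (fun y => E (-θ * y) * v y * logK (space₀ Φ₀ N₀ N₁) (space₁ Φ₁ N₀ N₁) f y)
          r volume ≤
        C * (eLpNorm (fun x => E (-θ * φ x) * v (φ x) * Φ₀ ((Iio x).indicator (logK N₀ N₁ f)))
            r volume +
          eLpNorm (fun x => E (-θ * φ x) * v (φ x) * (logK N₀ N₁ f x * χ₀ x)) r volume +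
          eLpNorm (fun x => E (-θ * φ x) * v (φ x) * (logRho χ₀ χ₁ x *
            Φ₁ ((Ioi x).indicator fun u => E (-u) * logK N₀ N₁ f u))) r volume) ∧
      eLpNorm (fun x => E (-θ * φ x) * v (φ x) * holmstedt Φ₀ Φ₁ χ₀ χ₁ (logK N₀ N₁ f) x)
          r volume ≤
        C * eLpNorm (fun y => E (-θ * y) * v y *
          logK (space₀ Φ₀ N₀ N₁) (space₁ Φ₁ N₀ N₁) f y) r volume := by
  obtain ⟨c, hc⟩ := S.exists_almost_translation hφ
  have hw : Controlled fun y => E (-θ * y) * v y := (controlled_E (-θ)).mul hv.controlled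
  obtain ⟨D, hD⟩ := hw (max c 1)
  obtain ⟨M, hM⟩ := exists_eLpNorm_comp_equiv hc r (D * (E (max c 1)).toNNReal)
  have hW := hw.comp_almost_translation hc
  obtain ⟨B, hB⟩ := hW.eLpNorm_add_le r
  obtain ⟨C, hC⟩ := S.logK_le_holmstedt h₀ h₁ hK hφ
  obtain ⟨C', hC'⟩ := S.holmstedt_le_logK h₀ h₁ hφ
  have hctrl : ∀ (f : V) x y, |x - y| ≤ max c 1 →
      E (-θ * x) * v x * logK (space₀ Φ₀ N₀ N₁) (space₁ Φ₁ N₀ N₁) f x ≤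
        (D * (E (max c 1)).toNNReal : ℝ≥0) *
          (E (-θ * y) * v y * logK (space₀ Φ₀ N₀ N₁) (space₁ Φ₁ N₀ N₁) f y) := fun f x y h => by
    calc _ ≤ D * (E (-θ * y) * v y) *
          (E (max c 1) * logK (space₀ Φ₀ N₀ N₁) (space₁ Φ₁ N₀ N₁) f y) :=
        mul_le_mul' (hD x y h) (logK_le_of_dist_le f h)
      _ = _ := by push_cast; rw [coe_toNNReal_E]; ring
  refine ⟨M * C * (B * B + B) + C' * M, fun f => ⟨?_, ?_⟩⟩
  · have hρm : Measurable (logRho χ₀ χ₁) := measurable_E.mul (S.meas₀.mul S.meas₁.inv)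
    have m₁ := S.adm₀.measurable_Iio (logK N₀ N₁ f)
    have m₂ := (measurable_logK (N₀ := N₀) (N₁ := N₁) f).mul S.meas₀
    have m₃ := hρm.mul (S.adm₁.measurable_Ioi fun u => E (-u) * logK N₀ N₁ f u)
    set T₁ := eLpNorm (fun x => E (-θ * φ x) * v (φ x) *
      Φ₀ ((Iio x).indicator (logK N₀ N₁ f))) r volume
    set T₂ := eLpNorm (fun x => E (-θ * φ x) * v (φ x) * (logK N₀ N₁ f x * χ₀ x)) r volume
    set T₃ := eLpNorm (fun x => E (-θ * φ x) * v (φ x) * (logRho χ₀ χ₁ x *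
            Φ₁ ((Ioi x).indicator fun u => E (-u) * logK N₀ N₁ f u))) r volume
    calc _ ≤ M * (C * (B * (B * (T₁ + T₂) + T₃))) := by
          refine ((hM _ (hctrl f)).2).trans ?_
          gcongr
          refine (eLpNorm_weight_mul_le (hC f)).trans ?_
          gcongr
          refine (hB volume _ _ (m₁.add m₂) m₃).trans ?_
          exact mul_le_mul_right (add_le_add (hB volume _ _ m₁ m₂) le_rfl) _
      _ = M * C * (B * B) * (T₁ + T₂) + M * C * B * T₃ := by ring
      _ ≤ M * C * (B * B + B) * (T₁ + T₂) + M * C * (B * B + B) * T₃ := by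
          gcongr
          · exact le_self_add
          · exact le_add_self
      _ = (M * C * (B * B + B)) * (T₁ + T₂ + T₃) := by ring
      _ ≤ _ := by
          push_cast
          gcongr
          exact le_self_add
  · calc _ ≤ C' * (M * eLpNorm (fun y => E (-θ * y) * v y *
          logK (space₀ Φ₀ N₀ N₁) (space₁ Φ₁ N₀ N₁) f y) r volume) := by
          refine (eLpNorm_weight_mul_le (hC' f)).trans ?_
          gcongr
          exact (hM _ (hctrl f)).1
      _ = (C' * M) * _ := by rw [mul_assoc]
      _ ≤ _ := by
          push_cast
          gcongr
          exact le_add_self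

/-- If the `K`-functional is infinite, so is every weighted norm of it. -/
lemma eLpNorm_eq_top_of_logK {w : ℝ → ℝ≥0∞} (hw : Controlled w) (hw0 : ∀ x, w x ≠ 0)
    {r : ℝ≥0∞} (hr : r ≠ 0) (S : Setting p Φ₀ Φ₁ χ₀ χ₁) {f : V} {u : ℝ}
    (hf : logK N₀ N₁ f u = ∞) :
    eLpNorm (fun x => w x * (logK N₀ N₁ f x * χ₀ x)) r volume = ∞ := by
  by_contra hcon
  obtain ⟨x, hx⟩ := (hw.ae_lt_top hw0 hr ((measurable_logK f).mul S.meas₀) hcon).exists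
  refine hx ?_
  have : logK N₀ N₁ f x = ∞ := by
    by_contra h
    exact logK_ne_top h u hf
  simp [this, ENNReal.top_mul (S.potter₀.ne_zero x)]

/-- For `θ > 0` the left part of the Holmstedt-type formula is dominated by the middle term. -/
lemma Setting.left_le_middle (S : Setting p Φ₀ Φ₁ χ₀ χ₁) {φ : ℝ → ℝ}
    (hφ : ∀ x, E (φ x) = logRho χ₀ χ₁ x) {v : ℝ → ℝ≥0∞} (hv : Potter v) {θ : ℝ} (hθ : 0 < θ)
    {r : ℝ≥0∞} (hr : ENNReal.ofReal p ≤ r) : ∃ C : ℝ≥0, ∀ f : V,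
      eLpNorm (fun x => E (-θ * φ x) * v (φ x) * Φ₀ ((Iio x).indicator (logK N₀ N₁ f)))
          r volume ≤
        C * eLpNorm (fun x => E (-θ * φ x) * v (φ x) * (logK N₀ N₁ f x * χ₀ x)) r volume := by
  obtain ⟨c, hc⟩ := S.exists_almost_translation hφ
  have hW := ((controlled_E (-θ)).mul hv.controlled).comp_almost_translation hc
  obtain ⟨A, hA⟩ := S.local₀
  obtain ⟨B, hB⟩ := hv.exists_decay hc hθ.ne'
  have hr0 : r ≠ 0 := (lt_of_lt_of_le (by simpa using S.hp) hr).ne'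
  obtain ⟨C, hC⟩ := S.adm₀.hardy S.hp (σ := 1) (by simp) hA S.meas₀ hr hW (B := B)
    (δ := |θ| / 4) (by positivity) (fun x m => by
      have := hB x (x - 1 * m) (by
        rw [show x - (x - 1 * (m : ℝ)) = m by ring]; positivity)
      rwa [show x - (x - 1 * (m : ℝ)) = m by ring,
        abs_of_nonneg (Nat.cast_nonneg m : (0 : ℝ) ≤ m)] at this)
    (E 1).toNNReal
  -- a non-zero constant keeps the right-hand side infinite when the `K`-functional is
  refine ⟨C + 1, fun f => ?_⟩
  by_cases htop : ∃ u, logK N₀ N₁ f u = ∞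
  · obtain ⟨u, hu⟩ := htop
    rw [eLpNorm_eq_top_of_logK hW (fun x => mul_ne_zero (E_ne_zero _) (hv.ne_zero _)) hr0 S hu,
      ENNReal.mul_top (by push_cast; positivity)]
    exact le_top
  · push Not at htop
    have := hC (logK N₀ N₁ f) (measurable_logK f) (fun u w h => by
      rw [coe_toNNReal_E]; exact logK_le_of_dist_le f h) htop
    simp only [side_one] at this
    refine this.trans ?_
    gcongr
    simp

/-- For `θ < 1` the right part of the Holmstedt-type formula is dominated by the middle term. -/
lemma Setting.right_le_middle (S : Setting p Φ₀ Φ₁ χ₀ χ₁) {φ : ℝ → ℝ}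
    (hφ : ∀ x, E (φ x) = logRho χ₀ χ₁ x) {v : ℝ → ℝ≥0∞} (hv : Potter v) {θ : ℝ} (hθ : θ < 1)
    {r : ℝ≥0∞} (hr : ENNReal.ofReal p ≤ r) : ∃ C : ℝ≥0, ∀ f : V,
      eLpNorm (fun x => E (-θ * φ x) * v (φ x) * (logRho χ₀ χ₁ x *
          Φ₁ ((Ioi x).indicator fun u => E (-u) * logK N₀ N₁ f u))) r volume ≤
        C * eLpNorm (fun x => E (-θ * φ x) * v (φ x) * (logK N₀ N₁ f x * χ₀ x)) r volume := by
  obtain ⟨c, hc⟩ := S.exists_almost_translation hφ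
  have hW := ((controlled_E (-(θ - 1))).mul hv.controlled).comp_almost_translation hc
  have hW' := ((controlled_E (-θ)).mul hv.controlled).comp_almost_translation hc
  obtain ⟨A, hA⟩ := S.local₁
  obtain ⟨B, hB⟩ := hv.exists_decay hc (sub_ne_zero.2 hθ.ne)
  have hr0 : r ≠ 0 := (lt_of_lt_of_le (by simpa using S.hp) hr).ne'
  have hpos : 0 < |θ - 1| := abs_pos.2 (sub_ne_zero.2 hθ.ne)
  obtain ⟨C, hC⟩ := S.adm₁.hardy S.hp (σ := -1) (by simp) hA S.meas₁ hr hW (B := B)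
    (δ := |θ - 1| / 4) (by positivity) (fun x m => by
      have := hB x (x - -1 * m) (by
        rw [show x - (x - -1 * (m : ℝ)) = -m by ring]
        have : (0 : ℝ) ≤ m := Nat.cast_nonneg m
        nlinarith)
      rwa [show x - (x - -1 * (m : ℝ)) = -m by ring, abs_neg,
        abs_of_nonneg (Nat.cast_nonneg m : (0 : ℝ) ≤ m)] at this)
    (E 1 * E 1).toNNReal
  have hE : ∀ x, E (-θ * φ x) * v (φ x) * logRho χ₀ χ₁ x = E (-(θ - 1) * φ x) * v (φ x) :=
    fun x => by
      rw [← hφ, mul_right_comm, ← E_add]; ring_nf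
  -- a non-zero constant keeps the right-hand side infinite when the `K`-functional is
  refine ⟨C + 1, fun f => ?_⟩
  by_cases htop : ∃ u, logK N₀ N₁ f u = ∞
  · obtain ⟨u, hu⟩ := htop
    rw [eLpNorm_eq_top_of_logK hW' (fun x => mul_ne_zero (E_ne_zero _) (hv.ne_zero _)) hr0 S hu,
      ENNReal.mul_top (by push_cast; positivity)]
    exact le_top
  · push Not at htop
    have := hC (fun u => E (-u) * logK N₀ N₁ f u) (measurable_E_neg_mul_logK f) (fun u w h => by
      rw [ENNReal.coe_toNNReal (ENNReal.mul_ne_top (E_ne_top _) (E_ne_top _))]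
      calc E (-u) * logK N₀ N₁ f u ≤ E (1 + -w) * (E 1 * logK N₀ N₁ f w) := by
            gcongr
            · exact E_mono (by linarith [(abs_le.1 h).1])
            · exact logK_le_of_dist_le f h
        _ = _ := by rw [E_add]; ring) (fun u => ENNReal.mul_ne_top (E_ne_top _) (htop u))
    simp only [side_neg_one] at this
    have e1 : (fun x => E (-θ * φ x) * v (φ x) * (logRho χ₀ χ₁ x *
          Φ₁ ((Ioi x).indicator fun u => E (-u) * logK N₀ N₁ f u))) = fun x =>
        E (-(θ - 1) * φ x) * v (φ x) * Φ₁ ((Ioi x).indicator fun u => E (-u) * logK N₀ N₁ f u) := by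
      ext x; rw [← mul_assoc, hE]
    have e2 : (fun x => E (-θ * φ x) * v (φ x) * (logK N₀ N₁ f x * χ₀ x)) = fun x =>
        E (-(θ - 1) * φ x) * v (φ x) * (E (-x) * logK N₀ N₁ f x * χ₁ x) := by
      ext x; rw [← hE, ← S.logRho_mul x]; ring
    rw [e1, e2]
    refine this.trans ?_
    gcongr
    simp

end Setting

/-! ### The spaces and weights of the theorem in the logarithmic variable -/

lemma stdSpace_eq_log {V : Type*} [AddCommGroup V] (N₀ N₁ : V → ℝ≥0∞) (θ : ℝ) (q : ℝ≥0∞)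
    (b : ℝ → ℝ) (f : V) : stdSpace N₀ N₁ θ q b f =
      eLpNorm (fun x => E (-θ * x) * lw b x * logK N₀ N₁ f x) q volume :=
  wnorm_Ioi_zero q θ b _

lemma LSpace_zero_eq {V : Type*} [AddCommGroup V] (N₀ N₁ : V → ℝ≥0∞) (r : ℝ≥0∞) (b : ℝ → ℝ)
    (q : ℝ≥0∞) (a : ℝ → ℝ) :
    LSpace N₀ N₁ 0 r b q a = space₀ (iterNorm r (lw b) q (lw a)) N₀ N₁ := by
  funext f
  simp only [LSpace, wnorm_Ioi_zero, wnorm_Ioo_zero_exp, neg_zero, zero_mul, E_zero, one_mul]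
  rfl

lemma LSpace_one_eq {V : Type*} [AddCommGroup V] (N₀ N₁ : V → ℝ≥0∞) (r : ℝ≥0∞) (b : ℝ → ℝ)
    (q : ℝ≥0∞) (a : ℝ → ℝ) :
    LSpace N₀ N₁ 1 r b q a = space₁ (iterNorm r (lw b) q (lw a)) N₀ N₁ := by
  funext f
  have h : ∀ x c, E (-x) * lw a x * c = lw a x * (E (-x) * c) := fun x c => by ring
  simp only [LSpace, wnorm_Ioi_zero, wnorm_Ioo_zero_exp, neg_zero, zero_mul, E_zero, one_mul,
    neg_one_mul, h]
  rfl

lemma wnorm_Ioi_Ioo_eq (r : ℝ≥0∞) (b : ℝ → ℝ) (q : ℝ≥0∞) (a : ℝ → ℝ) (θ x : ℝ)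
    (g : ℝ → ℝ≥0∞) :
    (wnorm r (Ioi (Real.exp x)) 0 b fun s => wnorm q (Ioo (Real.exp x) s) θ a g) =
      iterNorm r (lw b) q (lw a)
        ((Ioi x).indicator fun u => E (-θ * u) * g (Real.exp u)) := by
  simp only [iterNorm_indicator_Ioi, wnorm_Ioi_exp, wnorm_Ioo_exp, neg_zero, zero_mul, E_zero,
    one_mul, mul_comm (E _), mul_assoc]

lemma wnorm_Ioi_one_eq (r : ℝ≥0∞) (b : ℝ → ℝ) (q : ℝ≥0∞) (a : ℝ → ℝ) :
    (wnorm r (Ioi 1) 0 b fun s => wnorm q (Ioo 1 s) 0 a fun _ => 1) =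
      iterNorm r (lw b) q (lw a) ((Ioi 0).indicator fun _ => 1) := by
  simpa using wnorm_Ioi_Ioo_eq r b q a 0 0 fun _ => 1

lemma lw_chi0 {r q : ℝ≥0∞} {b a : ℝ → ℝ} {x : ℝ}
    (h : iterNorm r (lw b) q (lw a) ((Ioi x).indicator fun _ => 1) ≠ ∞) :
    lw (chi0 r b q a) x = iterNorm r (lw b) q (lw a) ((Ioi x).indicator fun _ => 1) := by
  rw [lw, chi0, wnorm_Ioi_Ioo_eq]
  simpa using ENNReal.ofReal_toReal h

/-- `χ₁` in the logarithmic variable, before taking real values. -/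
lemma chi1_exp (r : ℝ≥0∞) (b : ℝ → ℝ) (q : ℝ≥0∞) (a : ℝ → ℝ) (x : ℝ) :
    chi1 r b q a (Real.exp x) =
      (eLpNorm (fun s => lw b s * eLpNorm (fun u => lw a u * 1) q (volume.restrict (Iio s))) r
          (volume.restrict (Iio x)) +
        eLpNorm (lw b) r (volume.restrict (Ioi x)) *
          eLpNorm (fun u => lw a u * 1) q (volume.restrict (Iio x))).toReal := by
  simp only [chi1, wnorm_Ioo_zero_exp, wnorm_Ioi_exp, neg_zero, zero_mul, E_zero, one_mul, mul_one]

lemma measurable_eLpNorm_Ioi (q : ℝ≥0∞) (F : ℝ → ℝ≥0∞) :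
    Measurable fun s => eLpNorm F q (volume.restrict (Ioi s)) :=
  Antitone.measurable fun _ _ h =>
    eLpNorm_mono_measure _ (Measure.restrict_mono (Ioi_subset_Ioi h) le_rfl)

/-- The weights of the theorem fit the abstract setting. -/
lemma setting_of_slowlyVarying {p : ℝ} (hp : 0 < p) {r₀ q₀ r₁ q₁ : ℝ≥0∞}
    (hr₀ : ENNReal.ofReal p ≤ r₀) (hq₀ : ENNReal.ofReal p ≤ q₀) (hr₁ : ENNReal.ofReal p ≤ r₁)
    (hq₁ : ENNReal.ofReal p ≤ q₁) {a₀ b₀ a₁ b₁ : ℝ → ℝ} (ha₀ : SlowlyVarying a₀)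
    (hb₀ : SlowlyVarying b₀) (ha₁ : SlowlyVarying a₁) (hb₁ : SlowlyVarying b₁)
    (h₀ : wnorm r₀ (Ioi 1) 0 b₀ (fun s => wnorm q₀ (Ioo 1 s) 0 a₀ fun _ => 1) < ∞)
    (h₁ : wnorm r₁ (Ioi 1) 0 b₁ (fun _ => 1) < ∞)
    (h₁' : wnorm r₁ (Ioo 0 1) 0 b₁ (fun s => wnorm q₁ (Ioo 0 s) 0 a₁ fun _ => 1) < ∞) :
    Setting p (iterNorm r₀ (lw b₀) q₀ (lw a₀)) (iterNorm r₁ (lw b₁) q₁ (lw a₁))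
      (lw (chi0 r₀ b₀ q₀ a₀)) (lw (chi1 r₁ b₁ q₁ a₁)) := by
  have hne : ∀ {s : ℝ≥0∞}, ENNReal.ofReal p ≤ s → s ≠ 0 := fun h =>
    (lt_of_lt_of_le (by simpa using hp) h).ne'
  have adm₀ := iterNorm_admissible hp hr₀ hq₀ hb₀.potter_lw ha₀.potter_lw
  have adm₁ := iterNorm_admissible hp hr₁ hq₁ hb₁.potter_lw ha₁.potter_lw
  have f₀ : iterNorm r₀ (lw b₀) q₀ (lw a₀) ((Ioi 0).indicator fun _ => 1) ≠ ∞ := by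
    rw [← wnorm_Ioi_one_eq]
    exact h₀.ne
  have P₀ := iterNorm_potter_Ioi adm₀ hb₀.potter_lw ha₀.potter_lw (hne hr₀) (hne hq₀) f₀
  have e₀ : lw (chi0 r₀ b₀ q₀ a₀) =
      fun x => iterNorm r₀ (lw b₀) q₀ (lw a₀) ((Ioi x).indicator fun _ => 1) := by
    funext x; exact lw_chi0 (P₀.ne_top x)
  have f₁ : iterNorm r₁ (lw b₁) q₁ (lw a₁) ((Iio 0).indicator fun _ => 1) ≠ ∞ := by
    refine iterNorm_Iio_ne_top hb₁.potter_lw ha₁.potter_lw (hne hr₁) 0 ?_ ?_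
    · have := wnorm_Ioi_exp r₁ 0 0 b₁ fun _ => 1
      simp only [Real.exp_zero, neg_zero, zero_mul, E_zero, mul_one, one_mul] at this
      rw [← this]
      exact h₁.ne
    · have := wnorm_Ioo_zero_exp r₁ 0 0 b₁ fun s => wnorm q₁ (Ioo 0 s) 0 a₁ fun _ => 1
      rw [Real.exp_zero] at this
      simp only [wnorm_Ioo_zero_exp, neg_zero, zero_mul, E_zero, mul_one, one_mul] at this
      rw [← this]
      exact h₁'.ne
  have P₁ := iterNorm_potter_Iio adm₁ hb₁.potter_lw ha₁.potter_lw (hne hr₁) (hne hq₁) f₁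
  obtain ⟨C, hC⟩ := exists_iterNorm_Iio_le (q := q₁) (a := lw a₁) hb₁.potter_lw (hne hr₁)
  set J : ℝ → ℝ≥0∞ := fun x => eLpNorm (fun s => lw b₁ s *
    eLpNorm (fun u => lw a₁ u * 1) q₁ (volume.restrict (Iio s))) r₁ (volume.restrict (Iio x)) +
      eLpNorm (lw b₁) r₁ (volume.restrict (Ioi x)) *
        eLpNorm (fun u => lw a₁ u * 1) q₁ (volume.restrict (Iio x)) with hJ
  have hJle : ∀ x, J x ≤ 2 * iterNorm r₁ (lw b₁) q₁ (lw a₁) ((Iio x).indicator fun _ => 1) :=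
    fun x => by
      rw [two_mul]
      exact add_le_add (eLpNorm_Iio_le_iterNorm _ _) (eLpNorm_Ioi_mul_le_iterNorm _ _)
  have e₁ : lw (chi1 r₁ b₁ q₁ a₁) = J := by
    funext x
    rw [lw, chi1_exp]
    exact ENNReal.ofReal_toReal
      (ne_top_of_le_ne_top (ENNReal.mul_ne_top (by simp) (P₁.ne_top x)) (hJle x))
  have hCx : ∀ x, iterNorm r₁ (lw b₁) q₁ (lw a₁) ((Iio x).indicator fun _ => 1) ≤ C * J x :=
    fun x => hC _ x
  refine ⟨hp, adm₀, adm₁, ?_, ?_, ?_, ?_, ⟨1, fun x => ?_⟩, ⟨max C 2, fun x => ⟨?_, ?_⟩⟩⟩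
  · rw [e₀]; exact P₀
  · rw [e₁]; exact P₁.of_equiv (C := 2) (D := C) (by simpa using hJle) hCx
  · rw [e₀]; exact adm₀.measurable_Ioi _
  · rw [e₁]
    exact (measurable_eLpNorm_Iio _ _).add
      ((measurable_eLpNorm_Ioi _ _).mul (measurable_eLpNorm_Iio _ _))
  · rw [e₀]; simp
  · rw [e₁]
    refine (hCx x).trans ?_
    gcongr
    exact le_max_left _ _
  · rw [e₁]
    refine (hJle x).trans ?_
    gcongr
    exact_mod_cast le_max_right C 2

lemma Embeds.of_le {V : Type*} {N M : V → ℝ≥0∞} {C : ℝ≥0} (h : ∀ f, M f ≤ C * N f) :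
    Embeds N M :=
  ⟨C, fun f hf => ⟨(h f).trans_lt (ENNReal.mul_lt_top ENNReal.coe_lt_top hf), h f⟩⟩

lemma exists_common_exponent {r r₀ q₀ r₁ q₁ : ℝ≥0∞} (hr : 0 < r) (hr₀ : 0 < r₀) (hq₀ : 0 < q₀)
    (hr₁ : 0 < r₁) (hq₁ : 0 < q₁) : ∃ p : ℝ, 0 < p ∧ ENNReal.ofReal p ≤ r ∧
      ENNReal.ofReal p ≤ r₀ ∧ ENNReal.ofReal p ≤ q₀ ∧ ENNReal.ofReal p ≤ r₁ ∧
      ENNReal.ofReal p ≤ q₁ := by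
  set m := min 1 (min r (min r₀ (min q₀ (min r₁ q₁)))) with hm
  have hm0 : 0 < m := by simp [hm, hr, hr₀, hq₀, hr₁, hq₁]
  have hmt : m ≠ ∞ := ne_top_of_le_ne_top ENNReal.one_ne_top (min_le_left _ _)
  refine ⟨m.toReal, ENNReal.toReal_pos hm0.ne' hmt, ?_⟩
  rw [ENNReal.ofReal_toReal hmt]
  have h := le_refl m
  simp only [hm, le_min_iff] at h
  obtain ⟨-, h1, h2, h3, h4, h5⟩ := h
  exact ⟨h1, h2, h3, h4, h5⟩

section Weights

variable {χ₀ χ₁ a : ℝ → ℝ}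

lemma rho_pos (h₀ : ∀ x, lw χ₀ x ≠ 0) (h₁ : ∀ x, lw χ₁ x ≠ 0) (x : ℝ) :
    0 < rho χ₀ χ₁ (Real.exp x) := by
  have p₀ : 0 < χ₀ (Real.exp x) := by simpa [lw] using h₀ x
  have p₁ : 0 < χ₁ (Real.exp x) := by simpa [lw] using h₁ x
  exact div_pos (mul_pos (Real.exp_pos x) p₀) p₁

lemma E_log_rho (h₀ : ∀ x, lw χ₀ x ≠ 0) (h₁ : ∀ x, lw χ₁ x ≠ 0) (x : ℝ) :
    E (Real.log (rho χ₀ χ₁ (Real.exp x))) = logRho (lw χ₀) (lw χ₁) x := by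
  have p₁ : 0 < χ₁ (Real.exp x) := by simpa [lw] using h₁ x
  rw [E, Real.exp_log (rho_pos h₀ h₁ x), rho, ENNReal.ofReal_div_of_pos p₁,
    ENNReal.ofReal_mul (Real.exp_pos x).le, div_eq_mul_inv, mul_assoc]
  rfl

lemma lw_log_rho (h₀ : ∀ x, lw χ₀ x ≠ 0) (h₁ : ∀ x, lw χ₁ x ≠ 0) (a : ℝ → ℝ) (x : ℝ) :
    lw a (Real.log (rho χ₀ χ₁ (Real.exp x))) = lw (a ∘ rho χ₀ χ₁) x := by
  rw [lw, Real.exp_log (rho_pos h₀ h₁ x)]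
  rfl

/-- The identity `t ^ (-θ) a^#(t) = ρ ^ (-θ) a(ρ) χ₀`. -/
lemma E_mul_lw_aSharp (h₀ : ∀ x, lw χ₀ x ≠ 0) (h₁ : ∀ x, lw χ₁ x ≠ 0) (a : ℝ → ℝ) (θ x : ℝ) :
    E (-θ * x) * lw (aSharp χ₀ χ₁ a θ) x =
      E (-θ * Real.log (rho χ₀ χ₁ (Real.exp x))) *
        lw a (Real.log (rho χ₀ χ₁ (Real.exp x))) * lw χ₀ x := by
  have p₀ : 0 < χ₀ (Real.exp x) := by simpa [lw] using h₀ x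
  have p₁ : 0 < χ₁ (Real.exp x) := by simpa [lw] using h₁ x
  have hlog : Real.log (rho χ₀ χ₁ (Real.exp x)) =
      x + Real.log (χ₀ (Real.exp x)) - Real.log (χ₁ (Real.exp x)) := by
    rw [rho, Real.log_div (by positivity) p₁.ne', Real.log_mul (by positivity) p₀.ne',
      Real.log_exp]
  rw [lw_log_rho h₀ h₁, hlog]
  set l₀ := Real.log (χ₀ (Real.exp x)) with hl₀
  set l₁ := Real.log (χ₁ (Real.exp x)) with hl₁
  have e₀ : χ₀ (Real.exp x) = Real.exp l₀ := (Real.exp_log p₀).symm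
  have e₁ : χ₁ (Real.exp x) = Real.exp l₁ := (Real.exp_log p₁).symm
  have hS : lw (aSharp χ₀ χ₁ a θ) x =
      E ((1 - θ) * l₀) * E (θ * l₁) * lw (a ∘ rho χ₀ χ₁) x := by
    rw [lw, aSharp, e₀, e₁, ← Real.exp_mul, ← Real.exp_mul, ENNReal.ofReal_mul (by positivity),
      ENNReal.ofReal_mul (by positivity), mul_comm l₀, mul_comm l₁]
    rfl
  have hX : lw χ₀ x = E l₀ := by rw [lw, e₀]; rfl
  rw [hS, hX, mul_right_comm (E (-θ * _)), ← E_add, ← mul_assoc, ← E_add, ← E_add]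
  ring_nf

end Weights

/-! ### The limiting cases -/

lemma LLSpace_zero_eq {V : Type*} [AddCommGroup V] (N₀ N₁ : V → ℝ≥0∞) (s : ℝ≥0∞) (c : ℝ → ℝ)
    (r : ℝ≥0∞) (b : ℝ → ℝ) (q : ℝ≥0∞) (a : ℝ → ℝ) (f : V) :
    LLSpace N₀ N₁ 0 s c r b q a f = eLpNorm (fun x => lw c x * eLpNorm (fun s => lw b s *
      eLpNorm (fun u => lw a u * logK N₀ N₁ f u) q (volume.restrict (Iio s))) r
        (volume.restrict (Iio x))) s volume := by
  simp only [LLSpace, wnorm_Ioi_zero, wnorm_Ioo_zero_exp, neg_zero, zero_mul, E_zero, one_mul]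
  rfl

lemma LRSpace_one_eq {V : Type*} [AddCommGroup V] (N₀ N₁ : V → ℝ≥0∞) (s : ℝ≥0∞) (c : ℝ → ℝ)
    (r : ℝ≥0∞) (b : ℝ → ℝ) (q : ℝ≥0∞) (a : ℝ → ℝ) (f : V) :
    LRSpace N₀ N₁ 1 s c r b q a f = eLpNorm (fun x => lw c x * iterNorm r (lw b) q (lw a)
      ((Ioi x).indicator fun u => E (-u) * logK N₀ N₁ f u)) s volume := by
  simp only [LRSpace, wnorm_Ioi_zero, wnorm_Ioi_Ioo_eq, neg_zero, zero_mul, E_zero, one_mul,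
    neg_one_mul]
  rfl

/-- For `θ = 0` the left part of the Holmstedt-type formula gives the two extremal spaces. -/
lemma exists_left_equiv {r₀ q₀ : ℝ≥0∞} (hr₀ : r₀ ≠ 0) (hq₀ : q₀ ≠ 0) {b₀ a₀ : ℝ → ℝ}
    (hb₀ : Potter (lw b₀)) (ha₀ : Potter (lw a₀))
    (hfin : ∀ x, iterNorm r₀ (lw b₀) q₀ (lw a₀) ((Ioi x).indicator fun _ => 1) ≠ ∞)
    {a ρ : ℝ → ℝ} (hw : Controlled (lw (a ∘ ρ))) (r : ℝ≥0∞)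
    {V : Type*} [AddCommGroup V] (N₀ N₁ : V → ℝ≥0∞) :
    ∃ C : ℝ≥0, ∀ f : V,
      eLpNorm (fun x => lw (a ∘ ρ) x * iterNorm r₀ (lw b₀) q₀ (lw a₀)
          ((Iio x).indicator (logK N₀ N₁ f))) r volume ≤
        C * (LSpace N₀ N₁ 0 r (B0 r₀ b₀ a ρ) q₀ a₀ f +
          LLSpace N₀ N₁ 0 r (a ∘ ρ) r₀ b₀ q₀ a₀ f) ∧
      LSpace N₀ N₁ 0 r (B0 r₀ b₀ a ρ) q₀ a₀ f ≤
        eLpNorm (fun x => lw (a ∘ ρ) x * iterNorm r₀ (lw b₀) q₀ (lw a₀)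
          ((Iio x).indicator (logK N₀ N₁ f))) r volume ∧
      LLSpace N₀ N₁ 0 r (a ∘ ρ) r₀ b₀ q₀ a₀ f ≤
        eLpNorm (fun x => lw (a ∘ ρ) x * iterNorm r₀ (lw b₀) q₀ (lw a₀)
          ((Iio x).indicator (logK N₀ N₁ f))) r volume := by
  obtain ⟨C, hC⟩ := exists_iterNorm_Iio_le (q := q₀) (a := lw a₀) hb₀ hr₀
  obtain ⟨D, hD⟩ := hw.eLpNorm_add_le r
  have hβ : ∀ x, eLpNorm (lw b₀) r₀ (volume.restrict (Ioi x)) ≠ ∞ := fun x => by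
    have := eLpNorm_Ioi_ne_top ha₀ hq₀ (hfin (x - 1))
    rwa [sub_add_cancel] at this
  have hB : ∀ x, lw (B0 r₀ b₀ a ρ) x =
      lw (a ∘ ρ) x * eLpNorm (lw b₀) r₀ (volume.restrict (Ioi x)) := fun x => by
    simp only [lw, B0, wnorm_Ioi_exp, neg_zero, zero_mul, E_zero, one_mul, mul_one]
    rw [ENNReal.ofReal_mul ENNReal.toReal_nonneg, mul_comm]
    congr 1
    exact ENNReal.ofReal_toReal (hβ x)
  have hL : ∀ f, LSpace N₀ N₁ 0 r (B0 r₀ b₀ a ρ) q₀ a₀ f =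
      eLpNorm (fun x => lw (a ∘ ρ) x * (eLpNorm (lw b₀) r₀ (volume.restrict (Ioi x)) *
        eLpNorm (fun u => lw a₀ u * logK N₀ N₁ f u) q₀ (volume.restrict (Iio x)))) r volume :=
    fun f => by
      rw [LSpace_zero_eq, space₀, iterNorm]
      simp only [hB, mul_assoc]
  refine ⟨C * D, fun f => ⟨?_, ?_, ?_⟩⟩
  · rw [hL, LLSpace_zero_eq]
    have hm : Measurable fun x => eLpNorm (fun s => lw b₀ s *
        eLpNorm (fun u => lw a₀ u * logK N₀ N₁ f u) q₀ (volume.restrict (Iio s))) r₀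
          (volume.restrict (Iio x)) := measurable_eLpNorm_Iio _ _
    have hm' : Measurable fun x => eLpNorm (lw b₀) r₀ (volume.restrict (Ioi x)) *
        eLpNorm (fun u => lw a₀ u * logK N₀ N₁ f u) q₀ (volume.restrict (Iio x)) :=
      (measurable_eLpNorm_Ioi _ _).mul (measurable_eLpNorm_Iio _ _)
    refine (eLpNorm_weight_mul_le (hC (logK N₀ N₁ f))).trans ?_
    refine (mul_le_mul_right (hD volume _ _ hm hm') _).trans_eq ?_
    push_cast
    ring
  · rw [hL]
    refine eLpNorm_mono_ennreal (.of_forall fun x => ?_)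
    gcongr
    exact eLpNorm_Ioi_mul_le_iterNorm _ _
  · rw [LLSpace_zero_eq]
    refine eLpNorm_mono_ennreal (.of_forall fun x => ?_)
    gcongr
    exact eLpNorm_Iio_le_iterNorm _ _

end RealInterp

end

open RealInterp in
theorem theorem31 {𝕜 V : Type*} [RCLike 𝕜] [AddCommGroup V] [Module 𝕜 V]
    [TopologicalSpace V] [IsTopologicalAddGroup V] [ContinuousSMul 𝕜 V] [T2Space V]
    -- a compatible couple of quasi-Banach spaces with non-trivial intersection
    (A₀ A₁ : RealInterp.QuasiBanachSubspace 𝕜 V)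
    (hA : ∃ f : V, f ≠ 0 ∧ A₀.qnorm f < ∞ ∧ A₁.qnorm f < ∞)
    -- the parameters
    (r r₀ q₀ r₁ q₁ : ℝ≥0∞) (hr : 0 < r) (hr₀ : 0 < r₀) (hq₀ : 0 < q₀)
    (hr₁ : 0 < r₁) (hq₁ : 0 < q₁)
    (a a₀ b₀ a₁ b₁ : ℝ → ℝ)
    (ha : RealInterp.SlowlyVarying a) (ha₀ : RealInterp.SlowlyVarying a₀)
    (hb₀ : RealInterp.SlowlyVarying b₀) (ha₁ : RealInterp.SlowlyVarying a₁)
    (hb₁ : RealInterp.SlowlyVarying b₁)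
    (h₀ : RealInterp.wnorm r₀ (Ioi 1) 0 b₀
      (fun s => RealInterp.wnorm q₀ (Ioo 1 s) 0 a₀ fun _ => 1) < ∞)
    (h₁ : RealInterp.wnorm r₁ (Ioi 1) 0 b₁ (fun _ => 1) < ∞)
    (h₁' : RealInterp.wnorm r₁ (Ioo 0 1) 0 b₁
      (fun s => RealInterp.wnorm q₁ (Ioo 0 s) 0 a₁ fun _ => 1) < ∞)
    -- abbreviations
    (χ₀ χ₁ ρ : ℝ → ℝ)
    (hχ₀ : χ₀ = RealInterp.chi0 r₀ b₀ q₀ a₀) (hχ₁ : χ₁ = RealInterp.chi1 r₁ b₁ q₁ a₁)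
    (hρ : ρ = RealInterp.rho χ₀ χ₁)
    (X₀ X₁ : V → ℝ≥0∞)
    (hX₀ : X₀ = RealInterp.LSpace A₀.qnorm A₁.qnorm 0 r₀ b₀ q₀ a₀)
    (hX₁ : X₁ = RealInterp.LSpace A₀.qnorm A₁.qnorm 1 r₁ b₁ q₁ a₁) :
    (∀ θ : ℝ, 0 < θ → θ < 1 →
      RealInterp.SpaceEq (RealInterp.stdSpace X₀ X₁ θ r a)
        (RealInterp.stdSpace A₀.qnorm A₁.qnorm θ r (RealInterp.aSharp χ₀ χ₁ a θ))) ∧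
    (RealInterp.wnorm r (Ioi 1) 0 a (fun _ => 1) < ∞ →
      RealInterp.SpaceEq (RealInterp.stdSpace X₀ X₁ 0 r a)
        (RealInterp.inter
          (RealInterp.inter
            (RealInterp.stdSpace A₀.qnorm A₁.qnorm 0 r (RealInterp.aSharp χ₀ χ₁ a 0))
            (RealInterp.LSpace A₀.qnorm A₁.qnorm 0 r (RealInterp.B0 r₀ b₀ a ρ) q₀ a₀))
          (RealInterp.LLSpace A₀.qnorm A₁.qnorm 0 r (a ∘ ρ) r₀ b₀ q₀ a₀))) ∧
    (RealInterp.wnorm r (Ioo 0 1) 0 a (fun _ => 1) < ∞ →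
      RealInterp.SpaceEq (RealInterp.stdSpace X₀ X₁ 1 r a)
        (RealInterp.inter
          (RealInterp.stdSpace A₀.qnorm A₁.qnorm 1 r (RealInterp.aSharp χ₀ χ₁ a 1))
          (RealInterp.LRSpace A₀.qnorm A₁.qnorm 1 r (a ∘ ρ) r₁ b₁ q₁ a₁))) := by
  obtain ⟨p, hp, pr, pr₀, pq₀, pr₁, pq₁⟩ := exists_common_exponent hr hr₀ hq₀ hr₁ hq₁
  have S := setting_of_slowlyVarying hp pr₀ pq₀ pr₁ pq₁ ha₀ hb₀ ha₁ hb₁ h₀ h₁ h₁'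
  rw [← hχ₀, ← hχ₁] at S
  rw [LSpace_zero_eq] at hX₀
  rw [LSpace_one_eq] at hX₁
  set Φ₀ := iterNorm r₀ (lw b₀) q₀ (lw a₀) with hΦ₀
  set Φ₁ := iterNorm r₁ (lw b₁) q₁ (lw a₁) with hΦ₁
  set N₀ := A₀.qnorm
  set N₁ := A₁.qnorm
  set φ : ℝ → ℝ := fun x => Real.log (rho χ₀ χ₁ (Real.exp x)) with hφdef
  have hφ : ∀ x, E (φ x) = logRho (lw χ₀) (lw χ₁) x :=
    E_log_rho S.potter₀.ne_zero S.potter₁.ne_zero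
  have hv := ha.potter_lw
  have hK : ∀ f x, logK N₀ N₁ f x = 0 → f = 0 := fun f x => A₀.eq_zero_of_logK A₁
  have hrei := S.reiteration A₀.isQuasiNorm A₁.isQuasiNorm hK hφ hv
  -- the three terms of the Holmstedt-type formula
  set P : ℝ → V → ℝ≥0∞ := fun θ f => eLpNorm (fun x => E (-θ * φ x) * lw a (φ x) *
    Φ₀ ((Iio x).indicator (logK N₀ N₁ f))) r volume with hP
  set T : ℝ → V → ℝ≥0∞ := fun θ f => eLpNorm (fun x => E (-θ * φ x) * lw a (φ x) *
    (logK N₀ N₁ f x * lw χ₀ x)) r volume with hT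
  set R : ℝ → V → ℝ≥0∞ := fun θ f => eLpNorm (fun x => E (-θ * φ x) * lw a (φ x) *
    (logRho (lw χ₀) (lw χ₁) x *
      Φ₁ ((Ioi x).indicator fun u => E (-u) * logK N₀ N₁ f u))) r volume with hR
  have hstd : ∀ θ, ∃ C : ℝ≥0, ∀ f, stdSpace X₀ X₁ θ r a f ≤ C * (P θ f + T θ f + R θ f) ∧
      P θ f ≤ C * stdSpace X₀ X₁ θ r a f ∧ T θ f ≤ C * stdSpace X₀ X₁ θ r a f ∧
      R θ f ≤ C * stdSpace X₀ X₁ θ r a f := by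
    intro θ
    obtain ⟨C, hC⟩ := hrei θ r
    refine ⟨C, fun f => ?_⟩
    rw [stdSpace_eq_log, hX₀, hX₁]
    refine ⟨(hC f).1, le_trans ?_ (hC f).2, le_trans ?_ (hC f).2, le_trans ?_ (hC f).2⟩ <;>
      refine eLpNorm_mono_ennreal (.of_forall fun x => mul_le_mul_right ?_ _)
    · exact le_self_add.trans le_self_add
    · exact le_add_self.trans le_self_add
    · exact le_add_self
  have hTeq : ∀ θ f, stdSpace N₀ N₁ θ r (aSharp χ₀ χ₁ a θ) f = T θ f := fun θ f => by
    simp only [stdSpace_eq_log, E_mul_lw_aSharp S.potter₀.ne_zero S.potter₁.ne_zero, hT, mul_assoc,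
      mul_comm (lw χ₀ _), hφdef]
  have hwρ : ∀ x, lw a (φ x) = lw (a ∘ ρ) x := by
    rw [hρ]; exact lw_log_rho S.potter₀.ne_zero S.potter₁.ne_zero a
  refine ⟨fun θ hθ₀ hθ₁ => ?_, fun _ => ?_, fun _ => ?_⟩
  · obtain ⟨C, hC⟩ := hstd θ
    obtain ⟨D, hD⟩ := S.left_le_middle (N₀ := N₀) (N₁ := N₁) hφ hv hθ₀ pr
    obtain ⟨D', hD'⟩ := S.right_le_middle (N₀ := N₀) (N₁ := N₁) hφ hv hθ₁ pr
    refine ⟨Embeds.of_le (C := C) fun f => ?_, Embeds.of_le (C := C * (D + 1 + D')) fun f => ?_⟩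
    · rw [hTeq]; exact (hC f).2.2.1
    · rw [hTeq]
      calc _ ≤ C * (D * T θ f + T θ f + D' * T θ f) := by
            refine (hC f).1.trans ?_
            gcongr
            exacts [hD f, hD' f]
        _ = _ := by push_cast; ring
  · obtain ⟨C, hC⟩ := hstd 0
    obtain ⟨D', hD'⟩ := S.right_le_middle (N₀ := N₀) (N₁ := N₁) hφ hv zero_lt_one pr
    obtain ⟨c, hc⟩ := S.exists_almost_translation hφ
    have hw : Controlled (lw (a ∘ ρ)) := by
      have := hv.controlled.comp_almost_translation hc
      simpa only [hwρ] using this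
    have P₀ := iterNorm_potter_Ioi S.adm₀ hb₀.potter_lw ha₀.potter_lw hr₀.ne' hq₀.ne' (x := 0) (by
      rw [← wnorm_Ioi_one_eq]
      exact h₀.ne)
    obtain ⟨M, hM⟩ := exists_left_equiv hr₀.ne' hq₀.ne' hb₀.potter_lw ha₀.potter_lw P₀.ne_top hw r
      N₀ N₁
    have hPeq : ∀ f, P 0 f = eLpNorm (fun x => lw (a ∘ ρ) x *
        Φ₀ ((Iio x).indicator (logK N₀ N₁ f))) r volume := fun f => by
      simp only [hP, hwρ, neg_zero, zero_mul, E_zero, one_mul]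
    have hM : ∀ f, P 0 f ≤ M * (LSpace N₀ N₁ 0 r (B0 r₀ b₀ a ρ) q₀ a₀ f +
          LLSpace N₀ N₁ 0 r (a ∘ ρ) r₀ b₀ q₀ a₀ f) ∧
        LSpace N₀ N₁ 0 r (B0 r₀ b₀ a ρ) q₀ a₀ f ≤ P 0 f ∧
        LLSpace N₀ N₁ 0 r (a ∘ ρ) r₀ b₀ q₀ a₀ f ≤ P 0 f := fun f => by
      rw [hPeq]; exact hM f
    refine ⟨Embeds.of_le (C := C) fun f => ?_,
      Embeds.of_le (C := C * (M * 2 + 1 + D')) fun f => ?_⟩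
    · simp only [inter, hTeq]
      exact max_le (max_le (hC f).2.2.1 ((hM f).2.1.trans (hC f).2.1))
        ((hM f).2.2.trans (hC f).2.1)
    · set I := inter (inter (stdSpace N₀ N₁ 0 r (aSharp χ₀ χ₁ a 0))
        (LSpace N₀ N₁ 0 r (B0 r₀ b₀ a ρ) q₀ a₀)) (LLSpace N₀ N₁ 0 r (a ∘ ρ) r₀ b₀ q₀ a₀) f
      have i₁ : T 0 f ≤ I := by
        rw [← hTeq]; exact (le_max_left _ _).trans (le_max_left _ _)
      have i₂ : LSpace N₀ N₁ 0 r (B0 r₀ b₀ a ρ) q₀ a₀ f ≤ I :=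
        (le_max_right _ _).trans (le_max_left _ _)
      have i₃ : LLSpace N₀ N₁ 0 r (a ∘ ρ) r₀ b₀ q₀ a₀ f ≤ I := le_max_right _ _
      calc _ ≤ C * (M * (I + I) + I + D' * I) := by
            refine (hC f).1.trans ?_
            gcongr
            · refine (hM f).1.trans ?_
              gcongr
            · refine (hD' f).trans ?_
              gcongr
        _ = _ := by push_cast; ring
  · obtain ⟨C, hC⟩ := hstd 1
    obtain ⟨D, hD⟩ := S.left_le_middle (N₀ := N₀) (N₁ := N₁) hφ hv zero_lt_one pr
    have hReq : ∀ f, R 1 f = LRSpace N₀ N₁ 1 r (a ∘ ρ) r₁ b₁ q₁ a₁ f := fun f => by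
      have h : ∀ x c, E (-1 * φ x) * lw a (φ x) * (logRho (lw χ₀) (lw χ₁) x * c) =
          lw (a ∘ ρ) x * c := fun x c => by
        rw [← hφ, ← hwρ, neg_one_mul]
        calc _ = E (φ x) * E (-φ x) * (lw a (φ x) * c) := by ring
          _ = _ := by rw [E_mul_neg, one_mul]
      rw [LRSpace_one_eq]
      simp only [hR, h]
      rfl
    refine ⟨Embeds.of_le (C := C) fun f => ?_, Embeds.of_le (C := C * (D + 2)) fun f => ?_⟩
    · simp only [inter, hTeq, ← hReq]
      exact max_le (hC f).2.2.1 (hC f).2.2.2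
    · set I := inter (stdSpace N₀ N₁ 1 r (aSharp χ₀ χ₁ a 1))
        (LRSpace N₀ N₁ 1 r (a ∘ ρ) r₁ b₁ q₁ a₁) f
      have i₁ : T 1 f ≤ I := by rw [← hTeq]; exact le_max_left _ _
      have i₂ : R 1 f ≤ I := by rw [hReq]; exact le_max_right _ _
      calc _ ≤ C * (D * I + I + I) := by
            refine (hC f).1.trans ?_
            gcongr
            refine (hD f).trans ?_
            gcongr
        _ = _ := by push_cast; ring
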